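/- Let $F$ be a non-archimedean local field of odd residual characteristic, with ring of integers $\mathcal O_F$, maximal ideal $\mathfrak p_F$, uniformiser $\varpi$ and valuation $\nu$ (normalized by $\nu(\varpi)=1$, $\nu(0)=\infty$). Let $E=F[\sqrt{\epsilon}]$ be its unramified quadratic extension, where $\epsilon\in\mathcal O_F^\times$ is not a square, with ring of integers $\mathcal O_E$, maximal ideal $\mathfrak p_E$ and nontrivial automorphism $x\mapsto\overline x$ over $F$. Fix an additive character $\psi'$ of $F$ that is trivial on $\mathfrak p_F$ and nontrivial on $\mathcal O_F$, and put $\psi(x)=\psi'\bigl((x+\overline x)/2\bigr)$ for $x\in E$. Let $\mathrm w=\begin{pmatrix}0&1\\1&0\end{pmatrix}$ and $$G=\{g\in M_2(E)\mid \overline g^{\top}\mathrm w g=\mathrm w\},\qquad \mathfrak g=\{X\in M_2(E)\mid \overline X^{\top}\mathrm w+\mathrm wX=0\}.$$ Let $\mathcal K=G\cap M_2(\mathcal O_E)$. For integers $n\ge 0$ and $d\ge 1$ put $$\mathcal K_n=\begin{pmatrix}1+\mathfrak p_E^n&\mathfrak p_E^n\\ \mathfrak p_E^n&1+\mathfrak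 p_E^n\end{pmatrix}\cap G,\qquad \mathcal J_d=\begin{pmatrix}1+\mathfrak p_E^{\lceil d/2\rceil}&\mathfrak p_E^{\lceil d/2\rceil}\\ \mathfrak p_E^{\lceil (d+1)/2\rceil}&1+\mathfrak p_E^{\lceil d/2\rceil}\end{pmatrix}\cap G,$$ and let $\mathfrak k_{-d}$ be the set of $X\in\mathfrak g$ with all entries in $\mathfrak p_E^{-d}$. *Principal series.* Let $T=\{\mathrm{diag}(a,\overline a^{-1})\mid a\in E^\times\}$ be the diagonal torus of $G$ and $S=\{\mathrm{diag}(a,a^{-1})\mid a\in F^\times\}\subset T$. Let $T_0$ be the subgroup of $T$ given by $a\in\mathcal O_E^\times$, let $T_n$ be the one given by $a\in 1+\mathfrak p_E^n$ for $n\ge1$, and let $S_n=S\cap T_n$. For an integer $r\ge 0$, a character $\chi\colon T\to\mathbb C^\times$ has minimal depth $r$ if it is trivial on $T_{r+1}$ and, in case $r>0$, nontrivial on $S_r$ (that is, both $\chi$ and $\chi|_S$ have depth $r$). Extend $\chi$ trivially to the subgroup $B$ of upper triangular matrices of $G$, and let $V_\chi$ be the space of $\pi_\chi=\mathrm{Ind}_B^G\chi$,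 that is, of the locally constant $f\colon G\to\mathbb C$ with $f(bg)=\chi(b)f(g)$ for $b\in B$, $g\in G$, with $G$ acting by right translation. For $d\ge r+1$, let $\mathcal W_{d,\chi}$ denote a $\mathcal K$-stable complement of $V_\chi^{\mathcal K_d}$ in $V_\chi^{\mathcal K_{d+1}}$, so that $V_\chi^{\mathcal K_{d+1}}=V_\chi^{\mathcal K_d}\oplus\mathcal W_{d,\chi}$ as representations of $\mathcal K$. *The representations $\mathcal S_d(X,\zeta)$.* Let $d\ge 1$ and $$X=\begin{pmatrix}z\sqrt\epsilon&u\sqrt\epsilon\\ v\sqrt\epsilon&z\sqrt\epsilon\end{pmatrix},\qquad z,u,v\in F,\quad \nu(z)\ge -d,\quad \nu(v)>\nu(u)=-d. \tag{$*$}$$ Let $T(X)$ be the centralizer of $X$ in $\mathcal K$ and $\Psi_X(g)=\psi(\mathrm{Tr}(X(g-I)))$ for $g\in\mathcal J_d$. If $\zeta$ is a character of $T(X)$ that coincides with $\Psi_X$ on $T(X)\cap\mathcal J_d$, let $\Psi_{X,\zeta}$ be the unique character of the group $T(X)\mathcal J_d$ that extends both $\zeta$ and $\Psi_X$, and put $\mathcal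 S_d(X,\zeta)=\mathrm{Ind}_{T(X)\mathcal J_d}^{\mathcal K}\Psi_{X,\zeta}$. **Theorem.** Let $\chi$ be a character of $T$ of minimal depth $r\in\mathbb Z_{\ge0}$. Then for each integer $d\ge r+1$ there exist an element $Y_\chi\in\mathfrak k_{-d}$ of the form $(*)$ and a character $\zeta_\chi$ of its centralizer $T(Y_\chi)$ in $\mathcal K$ satisfying $$\zeta_\chi|_{T(Y_\chi)\cap\mathcal J_d}=\Psi_{Y_\chi}|_{T(Y_\chi)\cap\mathcal J_d},$$ such that the character $\Psi_{Y_\chi,\zeta_\chi}$ of $T(Y_\chi)\mathcal J_d$ exists, a complement $\mathcal W_{d,\chi}$ exists, and every such complement satisfies $$\mathcal W_{d,\chi}\cong\mathcal S_d(Y_\chi,\zeta_\chi)$$ as representations of $\mathcal K$. -/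

import Mathlib

set_option linter.unusedSectionVars false

noncomputable section

namespace U11

open Matrix

/-! ### Smooth induction of characters -/

section Induction

variable {Γ : Type*} [Group Γ] [TopologicalSpace Γ]

/-- The space of `Ind_H^Γ ρ` for a character `ρ` of a subgroup `H`: the locally constant functions
`f : Γ → ℂ` with `f (h g) = ρ(h) f(g)` for all `h ∈ H`, `g ∈ Γ`. -/
def smoothInd (H : Subgroup Γ) (ρ : H →* ℂˣ) : Submodule ℂ (Γ → ℂ) where
  carrier := {f | IsLocallyConstant f ∧ ∀ (h : H) (g : Γ), f ((h : Γ) * g) = (ρ h : ℂ) * f g}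
  add_mem' := by
    rintro f g ⟨hf, hf'⟩ ⟨hg, hg'⟩
    refine ⟨hf.add hg, fun h x => ?_⟩
    simp only [Pi.add_apply, hf', hg', mul_add]
  zero_mem' := ⟨IsLocallyConstant.const 0, fun h x => by simp⟩
  smul_mem' := by
    rintro c f ⟨hf, hf'⟩
    refine ⟨hf.comp (fun x => c * x), fun h x => ?_⟩
    simp only [Pi.smul_apply, hf', smul_eq_mul]
    ring

/-- The action of `Γ` on `Ind_H^Γ ρ` by right translation, `(g • f)(x) = f (x g)`. -/
def smoothIndRep [ContinuousMul Γ] (H : Subgroup Γ) (ρ : H →* ℂˣ) :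
    Representation ℂ Γ (smoothInd H ρ) where
  toFun g :=
    { toFun := fun f => ⟨fun x => f.1 (x * g),
        f.2.1.comp_continuous (continuous_mul_const g),
        fun h x => by
          have := f.2.2 h (x * g)
          simpa only [mul_assoc] using this⟩
      map_add' := fun _ _ => rfl
      map_smul' := fun _ _ => rfl }
  map_one' := by
    ext f x
    simp
  map_mul' g g' := by
    ext f x
    simp [mul_assoc]

end Induction

/-- The space `V^H` of vectors fixed by a subgroup `H`. -/
def fixedBy {Γ V : Type*} [Group Γ] [AddCommGroup V] [Module ℂ V]
    (π : Representation ℂ Γ V) (H : Subgroup Γ) : Submodule ℂ V :=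
  Representation.invariants (π.comp H.subtype)

/-! ### The fields -/

/-- The arithmetic data attached to a nonarchimedean local field `F` of odd residual characteristic
and its unramified quadratic extension `E = F[√ε]`: a uniformiser `ϖ` of `F` (it is also one of
`E`), a unit `ε` of `F` that is not a square, a square root of `ε` in `E`, the nontrivial
automorphism of `E` over `F`, and an additive character `ψ'` of `F` that is trivial on `𝔭_F` but
not on `𝒪_F`. -/
structure UnramifiedDatum (F E : Type*) [NontriviallyNormedField F] [NormedField E]
    [NormedAlgebra F E] where
  /-- the residual characteristic is odd -/
  norm_two : ‖(2 : F)‖ = 1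
  /-- the uniformiser -/
  unif : F
  unif_ne_zero : unif ≠ 0
  norm_unif_lt_one : ‖unif‖ < 1
  norm_le_norm_unif : ∀ x : F, ‖x‖ < 1 → ‖x‖ ≤ ‖unif‖
  /-- the nonsquare unit `ε` -/
  eps : F
  norm_eps : ‖eps‖ = 1
  not_isSquare_eps : ¬ IsSquare eps
  /-- the element `√ε` of `E` -/
  sqrtEps : E
  sqrtEps_sq : sqrtEps ^ 2 = algebraMap F E eps
  /-- the nontrivial element `x ↦ x̄` of `Gal(E/F)` -/
  conj : E ≃ₐ[F] E
  conj_ne : conj ≠ AlgEquiv.refl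
  /-- the additive character of `F` -/
  psi' : AddChar F ℂ
  psi'_trivial : ∀ x : F, ‖x‖ < 1 → psi' x = 1
  psi'_nontrivial : ∃ x : F, ‖x‖ ≤ 1 ∧ psi' x ≠ 1

namespace UnramifiedDatum

variable {F E : Type*} [NontriviallyNormedField F] [IsUltrametricDist F] [ProperSpace F]
  [NormedField E] [IsUltrametricDist E] [NormedAlgebra F E] [Algebra.IsQuadraticExtension F E]
  (D : UnramifiedDatum F E)

/-- Automorphisms of `E` over `F` preserve the absolute value. -/
theorem norm_algEquiv (τ : E ≃ₐ[F] E) (x : E) : ‖τ x‖ = ‖x‖ := by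
  have : FiniteDimensional F E := inferInstance
  rw [NormedAlgebra.norm_eq_spectralNorm F, NormedAlgebra.norm_eq_spectralNorm F]
  exact (spectralNorm_eq_of_equiv τ x).symm

/-- The character `ψ(x) = ψ'((x + x̄)/2)` of `E`. -/
def psi (x : E) : ℂ := D.psi' (Algebra.trace F E x / 2)

/-- `𝔭_E ^ n` for `n : ℤ`. -/
def pE (n : ℤ) : Set E := {x | ‖x‖ ≤ ‖D.unif‖ ^ n}

/-! ### The group `U(1,1)` and its subgroups -/

/-- The matrix `w` of the hermitian form. -/
def w : Matrix (Fin 2) (Fin 2) E := !![0, 1; 1, 0]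

theorem w_mul_w : (w : Matrix (Fin 2) (Fin 2) E) * w = 1 := by
  ext i j
  fin_cases i <;> fin_cases j <;> simp [w]

/-- The conjugate transpose `ḡᵀ` of a matrix with entries in `E`. -/
def conjTr (X : Matrix (Fin 2) (Fin 2) E) : Matrix (Fin 2) (Fin 2) E := (X.map D.conj)ᵀ

theorem conjTr_mul (X Y : Matrix (Fin 2) (Fin 2) E) : D.conjTr (X * Y) = D.conjTr Y * D.conjTr X := by
  unfold conjTr
  rw [Matrix.map_mul, Matrix.transpose_mul]

theorem conjTr_one : D.conjTr 1 = 1 := by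
  unfold conjTr
  rw [Matrix.map_one _ (map_zero _) (map_one _), Matrix.transpose_one]

/-- `G = U(1,1)(F)`: the matrices `g ∈ M₂(E)` with `ḡᵀ w g = w` (these are invertible). -/
def G : Subgroup (GL (Fin 2) E) where
  carrier := {g | D.conjTr (g : Matrix (Fin 2) (Fin 2) E) * w * (g : Matrix (Fin 2) (Fin 2) E) = w}
  one_mem' := by
    simp [conjTr_one]
  mul_mem' := by
    intro g h hg hh
    simp only [Set.mem_ofPred_eq, Units.val_mul, conjTr_mul] at hg hh ⊢
    calc _ = D.conjTr (h : Matrix (Fin 2) (Fin 2) E) *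
          (D.conjTr (g : Matrix (Fin 2) (Fin 2) E) * w * (g : Matrix (Fin 2) (Fin 2) E)) *
            (h : Matrix (Fin 2) (Fin 2) E) := by simp only [mul_assoc]
      _ = w := by rw [hg, hh]
  inv_mem' := by
    intro g hg
    simp only [Set.mem_ofPred_eq] at hg ⊢
    have h1 : D.conjTr ((g⁻¹ : GL (Fin 2) E) : Matrix (Fin 2) (Fin 2) E) *
        D.conjTr (g : Matrix (Fin 2) (Fin 2) E) = 1 := by
      rw [← conjTr_mul, ← Units.val_mul, mul_inv_cancel, Units.val_one, conjTr_one]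
    have h2 : (g : Matrix (Fin 2) (Fin 2) E) *
        ((g⁻¹ : GL (Fin 2) E) : Matrix (Fin 2) (Fin 2) E) = 1 := by
      rw [← Units.val_mul, mul_inv_cancel, Units.val_one]
    calc _ = D.conjTr ((g⁻¹ : GL (Fin 2) E) : Matrix (Fin 2) (Fin 2) E) *
          (D.conjTr (g : Matrix (Fin 2) (Fin 2) E) * w * (g : Matrix (Fin 2) (Fin 2) E)) *
            ((g⁻¹ : GL (Fin 2) E) : Matrix (Fin 2) (Fin 2) E) := by rw [hg]
      _ = (D.conjTr ((g⁻¹ : GL (Fin 2) E) : Matrix (Fin 2) (Fin 2) E) *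
          D.conjTr (g : Matrix (Fin 2) (Fin 2) E)) * w * ((g : Matrix (Fin 2) (Fin 2) E) *
            ((g⁻¹ : GL (Fin 2) E) : Matrix (Fin 2) (Fin 2) E)) := by simp only [mul_assoc]
      _ = w := by rw [h1, h2, one_mul, mul_one]

/-- The underlying matrix of an element of `G`. -/
abbrev mat (g : D.G) : Matrix (Fin 2) (Fin 2) E := ((g : GL (Fin 2) E) : Matrix (Fin 2) (Fin 2) E)

theorem mat_mul (g h : D.G) : D.mat (g * h) = D.mat g * D.mat h := rfl

theorem mat_one : D.mat 1 = 1 := rfl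

theorem mat_inv (g : D.G) : D.mat g⁻¹ = w * D.conjTr (D.mat g) * w := by
  have h : w * D.conjTr (D.mat g) * w * D.mat g = 1 := by
    have := g.2
    change D.conjTr (D.mat g) * w * D.mat g = w at this
    rw [mul_assoc w, mul_assoc w, this, w_mul_w]
  have h' : D.mat g * D.mat g⁻¹ = 1 := by
    rw [← mat_mul, mul_inv_cancel, mat_one]
  calc D.mat g⁻¹ = (w * D.conjTr (D.mat g) * w * D.mat g) * D.mat g⁻¹ := by rw [h, one_mul]
    _ = w * D.conjTr (D.mat g) * w := by rw [mul_assoc _ (D.mat g), h', mul_one]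

theorem mat_inv_entries (g : D.G) :
    D.mat g⁻¹ = !![D.conj (D.mat g 1 1), D.conj (D.mat g 0 1);
      D.conj (D.mat g 1 0), D.conj (D.mat g 0 0)] := by
  rw [mat_inv]
  ext i j
  fin_cases i <;> fin_cases j <;> simp [w, conjTr, Matrix.mul_apply, Matrix.vecMul, dotProduct, Fin.sum_univ_two]

/-- The matrices `g ∈ G` with `g₀₀ - 1, g₀₁, g₁₁ - 1 ∈ 𝔭_E ^ m` and `g₁₀ ∈ 𝔭_E ^ n`. -/
def congruenceSubgroup (m n : ℕ) : Subgroup D.G where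
  carrier := {g | D.mat g 0 0 - 1 ∈ D.pE m ∧ D.mat g 0 1 ∈ D.pE m ∧
    D.mat g 1 0 ∈ D.pE n ∧ D.mat g 1 1 - 1 ∈ D.pE m}
  one_mem' := by
    have hu : 0 ≤ ‖D.unif‖ := norm_nonneg _
    simp [mat_one, pE, hu]
  mul_mem' := by
    rintro g h ⟨g00, g01, g10, g11⟩ ⟨h00, h01, h10, h11⟩
    have hu : 0 ≤ ‖D.unif‖ := norm_nonneg _
    have hle : ∀ k : ℕ, ‖D.unif‖ ^ k ≤ 1 := fun k =>
      pow_le_one₀ hu D.norm_unif_lt_one.le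
    have hnn : ∀ k : ℕ, 0 ≤ ‖D.unif‖ ^ k := fun k => pow_nonneg hu k
    simp only [pE, Set.mem_ofPred_eq, zpow_natCast] at g00 g01 g10 g11 h00 h01 h10 h11 ⊢
    have add : ∀ {x y : E} {c : ℝ}, ‖x‖ ≤ c → ‖y‖ ≤ c → ‖x + y‖ ≤ c := fun hx hy =>
      (IsUltrametricDist.norm_add_le_max _ _).trans (max_le hx hy)
    have mulr : ∀ {x y : E} {k l : ℕ}, ‖x‖ ≤ ‖D.unif‖ ^ k → ‖y‖ ≤ ‖D.unif‖ ^ l →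
        ‖x * y‖ ≤ ‖D.unif‖ ^ k := fun {x y k l} hx hy => by
      rw [norm_mul]
      exact (mul_le_mul hx (hy.trans (hle l)) (norm_nonneg _) (hnn k)).trans (by simp)
    have mull : ∀ {x y : E} {k l : ℕ}, ‖x‖ ≤ ‖D.unif‖ ^ k → ‖y‖ ≤ ‖D.unif‖ ^ l →
        ‖x * y‖ ≤ ‖D.unif‖ ^ l := fun {x y k l} hx hy => by
      rw [mul_comm]
      exact mulr hy hx
    simp only [mat_mul, Matrix.mul_apply, Fin.sum_univ_two]
    refine ⟨?_, ?_, ?_, ?_⟩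
    · have : D.mat g 0 0 * D.mat h 0 0 + D.mat g 0 1 * D.mat h 1 0 - 1 =
          (D.mat g 0 0 - 1) * (D.mat h 0 0 - 1) + ((D.mat g 0 0 - 1) + (D.mat h 0 0 - 1)) +
            D.mat g 0 1 * D.mat h 1 0 := by ring
      rw [this]
      exact add (add (mulr g00 h00) (add g00 h00)) (mulr g01 h10)
    · have : D.mat g 0 0 * D.mat h 0 1 + D.mat g 0 1 * D.mat h 1 1 =
          ((D.mat g 0 0 - 1) * D.mat h 0 1 + D.mat h 0 1) +
            (D.mat g 0 1 * (D.mat h 1 1 - 1) + D.mat g 0 1) := by ring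
      rw [this]
      exact add (add (mulr g00 h01) h01) (add (mulr g01 h11) g01)
    · have : D.mat g 1 0 * D.mat h 0 0 + D.mat g 1 1 * D.mat h 1 0 =
          (D.mat g 1 0 * (D.mat h 0 0 - 1) + D.mat g 1 0) +
            ((D.mat g 1 1 - 1) * D.mat h 1 0 + D.mat h 1 0) := by ring
      rw [this]
      exact add (add (mulr g10 h00) g10) (add (mull g11 h10) h10)
    · have : D.mat g 1 0 * D.mat h 0 1 + D.mat g 1 1 * D.mat h 1 1 - 1 =
          D.mat g 1 0 * D.mat h 0 1 +
          ((D.mat g 1 1 - 1) * (D.mat h 1 1 - 1) + ((D.mat g 1 1 - 1) + (D.mat h 1 1 - 1))) := by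
        ring
      rw [this]
      exact add (mull g10 h01) (add (mulr g11 h11) (add g11 h11))
  inv_mem' := by
    rintro g ⟨h00, h01, h10, h11⟩
    have hc : ∀ x : E, ‖D.conj x‖ = ‖x‖ := norm_algEquiv D.conj
    have hc' : ∀ x : E, ‖D.conj x - 1‖ = ‖x - 1‖ := fun x => by
      rw [← hc (x - 1), map_sub, map_one]
    simp only [pE, Set.mem_ofPred_eq] at h00 h01 h10 h11 ⊢
    rw [mat_inv_entries]
    simp only [Matrix.of_apply, Matrix.cons_val', Matrix.cons_val_zero, Matrix.cons_val_one,
      Matrix.cons_val_fin_one, hc, hc']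
    exact ⟨h11, h01, h10, h00⟩

/-- `𝒦_n = (1 + 𝔭_E ^ n, 𝔭_E ^ n; 𝔭_E ^ n, 1 + 𝔭_E ^ n) ∩ G`; thus `K 0 = 𝒦 = G ∩ M₂(𝒪_E)`. -/
def K (n : ℕ) : Subgroup D.G := D.congruenceSubgroup n n

/-- `𝒥_d = (1 + 𝔭_E ^ ⌈d/2⌉, 𝔭_E ^ ⌈d/2⌉; 𝔭_E ^ ⌈(d+1)/2⌉, 1 + 𝔭_E ^ ⌈d/2⌉) ∩ G`.
Here `⌈d/2⌉` and `⌈(d+1)/2⌉` are written with the (rounding down) division of natural numbers. -/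
def J (d : ℕ) : Subgroup D.G := D.congruenceSubgroup ((d + 1) / 2) ((d + 2) / 2)

/-- The Borel subgroup of upper triangular matrices in `G`. -/
def B : Subgroup D.G where
  carrier := {g | D.mat g 1 0 = 0}
  one_mem' := by simp [mat_one]
  mul_mem' := by
    intro g h hg hh
    simp only [Set.mem_ofPred_eq] at hg hh ⊢
    rw [mat_mul, Matrix.mul_apply, Fin.sum_univ_two, hg, hh]
    simp
  inv_mem' := by
    intro g hg
    simp only [Set.mem_ofPred_eq] at hg ⊢
    rw [mat_inv_entries]
    simp [hg]

/-- The diagonal torus `T` of `G`; its elements are the matrices `diag(a, ā⁻¹)`, `a ∈ Eˣ`. -/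
def T : Subgroup D.G where
  carrier := {g | D.mat g 0 1 = 0 ∧ D.mat g 1 0 = 0}
  one_mem' := by simp [mat_one]
  mul_mem' := by
    rintro g h ⟨hg, hg'⟩ ⟨hh, hh'⟩
    simp only [Set.mem_ofPred_eq]
    rw [mat_mul, Matrix.mul_apply, Fin.sum_univ_two, Matrix.mul_apply, Fin.sum_univ_two,
      hg, hh, hg', hh']
    simp
  inv_mem' := by
    rintro g ⟨hg, hg'⟩
    simp only [Set.mem_ofPred_eq]
    rw [mat_inv_entries]
    simp [hg, hg']

theorem entries_of_mem_B {g : D.G} (hg : g ∈ D.B) :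
    D.conj (D.mat g 0 0) * D.mat g 1 1 = 1 ∧ D.conj (D.mat g 1 1) * D.mat g 0 0 = 1 := by
  have h : D.mat g⁻¹ * D.mat g = 1 := by rw [← mat_mul, inv_mul_cancel, mat_one]
  rw [mat_inv_entries] at h
  have hg' : D.mat g 1 0 = 0 := hg
  have h0 := congrFun (congrFun h 0) 0
  have h1 := congrFun (congrFun h 1) 1
  simp [Matrix.mul_apply, Fin.sum_univ_two, hg'] at h0 h1
  exact ⟨h1, h0⟩

/-- The diagonal part of an upper triangular matrix in `G`, as an invertible matrix. -/
def diagPart (b : D.B) : GL (Fin 2) E where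
  val := !![D.mat b 0 0, 0; 0, D.mat b 1 1]
  inv := !![D.conj (D.mat b 1 1), 0; 0, D.conj (D.mat b 0 0)]
  val_inv := by
    obtain ⟨h0, h1⟩ := D.entries_of_mem_B b.2
    rw [mul_comm] at h0 h1
    ext i j
    fin_cases i <;> fin_cases j <;> simp [h0, h1]
  inv_val := by
    obtain ⟨h0, h1⟩ := D.entries_of_mem_B b.2
    ext i j
    fin_cases i <;> fin_cases j <;> simp [h0, h1]

theorem diagPart_mem_G (b : D.B) : D.diagPart b ∈ D.G := by
  obtain ⟨h0, h1⟩ := D.entries_of_mem_B b.2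
  change D.conjTr !![D.mat b 0 0, 0; 0, D.mat b 1 1] * w * !![D.mat b 0 0, 0; 0, D.mat b 1 1] = w
  ext i j
  fin_cases i <;> fin_cases j <;>
    simp [conjTr, w, Matrix.mul_apply, Fin.sum_univ_two, h0, h1]

theorem diagPart_mul (b b' : D.B) : D.diagPart (b * b') = D.diagPart b * D.diagPart b' := by
  have hb : D.mat b 1 0 = 0 := b.2
  have hb' : D.mat b' 1 0 = 0 := b'.2
  have e0 : D.mat (b * b' : D.B) 0 0 = D.mat b 0 0 * D.mat b' 0 0 := by
    change (D.mat b * D.mat b') 0 0 = _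
    rw [Matrix.mul_apply, Fin.sum_univ_two, hb', mul_zero, add_zero]
  have e1 : D.mat (b * b' : D.B) 1 1 = D.mat b 1 1 * D.mat b' 1 1 := by
    change (D.mat b * D.mat b') 1 1 = _
    rw [Matrix.mul_apply, Fin.sum_univ_two, hb, zero_mul, zero_add]
  apply Units.ext
  change !![D.mat (b * b' : D.B) 0 0, 0; 0, D.mat (b * b' : D.B) 1 1] =
    !![D.mat b 0 0, 0; 0, D.mat b 1 1] * !![D.mat b' 0 0, 0; 0, D.mat b' 1 1]
  rw [e0, e1]
  simp

theorem diagPart_one : D.diagPart 1 = 1 := by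
  have h := D.diagPart_mul 1 1
  rw [mul_one] at h
  exact left_eq_mul.mp h

/-- The projection `B = T U → T` with kernel the unipotent radical `U`:
it sends an upper triangular matrix to its diagonal part. -/
def borelToTorus : D.B →* D.T where
  toFun b := ⟨⟨D.diagPart b, D.diagPart_mem_G b⟩, ⟨rfl, rfl⟩⟩
  map_one' := Subtype.ext (Subtype.ext D.diagPart_one)
  map_mul' b b' := Subtype.ext (Subtype.ext (D.diagPart_mul b b'))

/-! ### Characters of the torus and their depths -/

/-- `T_n`: the `diag(a, ā⁻¹)` with `a ∈ 𝒪_Eˣ` if `n = 0`, and with `a ∈ 1 + 𝔭_E ^ n` if `n > 0`. -/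
def Tfilt (n : ℕ) : Set D.T := {t | ‖D.mat t 0 0‖ = 1 ∧ D.mat t 0 0 - 1 ∈ D.pE n}

/-- The maximal `F`-split subtorus `S` of `T`: the `diag(a, a⁻¹)` with `a ∈ Fˣ`. -/
def S : Set D.T := {t | ∃ a : F, D.mat t 0 0 = algebraMap F E a}

/-- `χ` has depth `r`: it is trivial on `T_{r+1}` and, unless `r = 0`, nontrivial on `T_r`. -/
def HasDepth (χ : D.T →* ℂˣ) (r : ℕ) : Prop :=
  (∀ t ∈ D.Tfilt (r + 1), χ t = 1) ∧ (r = 0 ∨ ∃ t ∈ D.Tfilt r, χ t ≠ 1)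

/-- `χ` has true depth `r`: its restriction to `S` has depth `r`, where `S_n = S ∩ T_n`. -/
def HasTrueDepth (χ : D.T →* ℂˣ) (r : ℕ) : Prop :=
  (∀ t ∈ D.S ∩ D.Tfilt (r + 1), χ t = 1) ∧ (r = 0 ∨ ∃ t ∈ D.S ∩ D.Tfilt r, χ t ≠ 1)

/-- `χ` has minimal depth `r`: its depth and its true depth are both equal to `r`. -/
def HasMinimalDepth (χ : D.T →* ℂˣ) (r : ℕ) : Prop :=
  D.HasDepth χ r ∧ D.HasTrueDepth χ r

/-! ### Principal series -/

/-- The space `V_χ` of the principal series `π_χ = Ind_B^G χ`, where `χ` is extended trivially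
from `T` to `B`. -/
abbrev V (χ : D.T →* ℂˣ) : Submodule ℂ (D.G → ℂ) := smoothInd D.B (χ.comp D.borelToTorus)

/-- The principal series representation `π_χ` of `G`. -/
def principalSeries (χ : D.T →* ℂˣ) : Representation ℂ D.G (D.V χ) :=
  smoothIndRep D.B (χ.comp D.borelToTorus)

/-- The restriction of `π_χ` to `𝒦`. -/
def resK (χ : D.T →* ℂˣ) : Representation ℂ (D.K 0) (D.V χ) :=
  (D.principalSeries χ).comp (D.K 0).subtype

/-- The `𝒦`-subrepresentation `W` of `π_χ` is a component `𝒲_{d,χ}`: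
`V_χ^{𝒦_{d+1}} = V_χ^{𝒦_d} ⊕ W`. -/
def IsComponent (χ : D.T →* ℂˣ) (d : ℕ) (W : Subrepresentation (D.resK χ)) : Prop :=
  Disjoint (fixedBy (D.principalSeries χ) (D.K d)) W.toSubmodule ∧
    fixedBy (D.principalSeries χ) (D.K d) ⊔ W.toSubmodule =
      fixedBy (D.principalSeries χ) (D.K (d + 1))

/-! ### The representations `𝒮_d(X, ζ)` of `𝒦` -/

/-- `𝔨_n` for `n : ℤ`: the matrices `X` of the Lie algebra `𝔤 = {X | X̄ᵀ w + w X = 0}` with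
entries in `𝔭_E ^ n`. -/
def lieFilt (n : ℤ) : Set (Matrix (Fin 2) (Fin 2) E) :=
  {X | D.conjTr X * w + w * X = 0 ∧ ∀ i j, X i j ∈ D.pE n}

/-- `X = (z√ε, u√ε; v√ε, z√ε)` with `z, u, v ∈ F`, `ν(z) ≥ -d` and `ν(v) > ν(u) = -d`. -/
def IsShalikaElement (d : ℕ) (X : Matrix (Fin 2) (Fin 2) E) : Prop :=
  ∃ z u v : F, ‖z‖ ≤ ‖D.unif‖ ^ (-(d : ℤ)) ∧ ‖u‖ = ‖D.unif‖ ^ (-(d : ℤ)) ∧ ‖v‖ < ‖u‖ ∧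
    X = !![z • D.sqrtEps, u • D.sqrtEps; v • D.sqrtEps, z • D.sqrtEps]

/-- The function `Ψ_X(g) = ψ(Tr(X (g - 1)))`. -/
def Psi (X : Matrix (Fin 2) (Fin 2) E) (g : D.G) : ℂ := D.psi (X * (D.mat g - 1)).trace

/-- The centralizer `T(X)` of `X` in `𝒦`. -/
def TX (X : Matrix (Fin 2) (Fin 2) E) : Subgroup (D.K 0) where
  carrier := {k | D.mat k * X = X * D.mat k}
  one_mem' := by simp [mat_one]
  mul_mem' := by
    intro g h hg hh
    simp only [Set.mem_ofPred_eq, Subgroup.coe_mul, mat_mul] at hg hh ⊢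
    rw [mul_assoc, hh, ← mul_assoc, hg, mul_assoc]
  inv_mem' := by
    intro g hg
    simp only [Set.mem_ofPred_eq, Subgroup.coe_inv] at hg ⊢
    have h1 : D.mat (g : D.G)⁻¹ * D.mat (g : D.G) = 1 := by rw [← mat_mul, inv_mul_cancel, mat_one]
    have h2 : D.mat (g : D.G) * D.mat (g : D.G)⁻¹ = 1 := by rw [← mat_mul, mul_inv_cancel, mat_one]
    calc D.mat (g : D.G)⁻¹ * X
        = D.mat (g : D.G)⁻¹ * (X * D.mat (g : D.G)) * D.mat (g : D.G)⁻¹ := by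
          rw [mul_assoc, mul_assoc, h2, mul_one]
      _ = X * D.mat (g : D.G)⁻¹ := by rw [← hg, ← mul_assoc, h1, one_mul]

/-- `𝒥_d` as a subgroup of `𝒦`. -/
def JK (d : ℕ) : Subgroup (D.K 0) := (D.J d).subgroupOf (D.K 0)

/-- The character `ζ` of `T(X)` coincides with `Ψ_X` on `T(X) ∩ 𝒥_d`. -/
def Compatible (d : ℕ) (X : Matrix (Fin 2) (Fin 2) E) (ζ : D.TX X →* ℂˣ) : Prop :=
  ∀ t : D.TX X, (t : D.K 0) ∈ D.JK d → (ζ t : ℂ) = D.Psi X (t : D.K 0)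

/-- `Ψ` is the character `Ψ_{X,ζ}` of the group `T(X) 𝒥_d` that extends `ζ` and `Ψ_X`
(it is unique, as `T(X)` and `𝒥_d` generate that group). -/
def IsExtension (d : ℕ) (X : Matrix (Fin 2) (Fin 2) E) (ζ : D.TX X →* ℂˣ)
    (Ψ : (D.TX X ⊔ D.JK d : Subgroup (D.K 0)) →* ℂˣ) : Prop :=
  (∀ t : D.TX X, Ψ ⟨t, Subgroup.mem_sup_left t.2⟩ = ζ t) ∧
    ∀ j : D.JK d, (Ψ ⟨j, Subgroup.mem_sup_right j.2⟩ : ℂ) = D.Psi X (j : D.K 0)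

/-- `𝒮_d(X, ζ) = Ind_{T(X) 𝒥_d}^𝒦 Ψ`, where `Ψ = Ψ_{X,ζ}`. -/
def Sd (d : ℕ) (X : Matrix (Fin 2) (Fin 2) E)
    (Ψ : (D.TX X ⊔ D.JK d : Subgroup (D.K 0)) →* ℂˣ) :
    Representation ℂ (D.K 0) (smoothInd (D.TX X ⊔ D.JK d) Ψ) :=
  smoothIndRep (D.TX X ⊔ D.JK d) Ψ

end UnramifiedDatum

end U11

end

/-! The bottom row (c, e) of g determines the coset B g up to the action of the torus, and the
hermitian form forces c/e to be purely imaginary. So B\G is the projective line over F, with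
coordinate c/e in F√ε ∪ {∞}, and a vector of V_χ supported near c/e = 0 has the form μ(e) φ(c/e)
with μ = `torusChar χ` (see `sec`).

As χ has depth less than d, μ is trivial on 1 + 𝔭_E^d, so on 1 + 𝔭_E^⌈d/2⌉ it is 1 + x ↦ ψ(κx) with
κ ∈ 𝔭_E^(1-d) (`exists_linearisation`). Write κ = 2(UT + Z) with U = u√ε, T = τ√ε, Z = z√ε purely
imaginary and |u| = |ϖ|^(-d), and take Y = (Z, U; UT², Z). The row (T, 1) is an eigenvector of Y
with eigenvalue UT + Z, so T(Y) fixes the point T of the projective line.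

Put m = ⌈(d+1)/2⌉ and let v be the vector with values μ(e) ψ(U(c/e - T)) on c/e ∈ T + 𝔭_E^m and zero
elsewhere (`Linearised.eigenvector`). It is fixed by 𝒦_{d+1}, the group 𝒥_d acts on it through Ψ_Y
(`vec_J`), and T(Y) acts by scalars (`vec_TX`). The resulting character Ψ of T(Y)𝒥_d is Ψ_{Y,ζ} for
ζ = Ψ|_{T(Y)}, and Frobenius reciprocity gives a 𝒦-map Φ from 𝒮_d(Y, ζ) to V_χ^{𝒦_{d+1}}.

The image of Φ is a complement of V_χ^{𝒦_d} for two reasons. The Fourier coefficient L of a function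
at the frequency U on T + 𝔭_E^m kills V_χ^{𝒦_d}, is nonzero on v, and is zero on k v unless k ∈
T(Y)𝒥_d (`mem_sup_of_fourier_ne_zero`). Hence L(g Φ(f)) = f(g) L(v), so Φ is injective and its image
meets V_χ^{𝒦_d} only in zero. On the other hand v and V_χ^{𝒦_d} generate V_χ^{𝒦_{d+1}}
(`fixedBy_le`): units of F are norms from E, so torus translates of v give all unit multiples of the
frequency U, while the other integral multiples belong to V_χ^{𝒦_d}. Averaging over the frequencies
isolates a smallest neighbourhood of a point. Neither irreducibility nor a dimension count is
needed. -/

set_option linter.unusedSectionVars false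

noncomputable section

namespace U11

/-! ### Sums over quotients, locally constant functions and induced representations -/

theorem sum_quotient_eq_zero {A : Type*} [AddCommGroup A] (B : AddSubgroup A) [Fintype (A ⧸ B)]
    (φ : A → ℂ) (hφ : ∀ a, ∀ b ∈ B, φ (a + b) = φ a) (x : A) (c : ℂ) (hc : c ≠ 1)
    (hx : ∀ a, φ (a + x) = c * φ a) : ∑ q : A ⧸ B, φ q.out = 0 := by
  have h1 : ∑ q : A ⧸ B, φ q.out = ∑ q : A ⧸ B, φ (q + (x : A ⧸ B)).out :=
    (Fintype.sum_equiv (Equiv.addRight (x : A ⧸ B)) _ _ fun q => rfl).symm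
  have h2 : ∀ q : A ⧸ B, φ (q + (x : A ⧸ B)).out = c * φ q.out := by
    intro q
    have h3 : ((q.out + x : A) : A ⧸ B) = ((q + (x : A ⧸ B)).out : A ⧸ B) := by
      rw [QuotientAddGroup.mk_add, QuotientAddGroup.out_eq', QuotientAddGroup.out_eq']
    have h4 := hφ (q.out + x) _ (QuotientAddGroup.eq.mp h3)
    rw [← hx, ← h4]
    congr 1
    abel
  -- Translating the summation variable by x preserves the sum S, but also multiplies it by c, so (1
  -- - c) S = 0.
  have h5 : (1 - c) * ∑ q : A ⧸ B, φ q.out = 0 := by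
    rw [sub_mul, one_mul, sub_eq_zero]
    conv_lhs => rw [h1]
    rw [Finset.mul_sum]
    exact Finset.sum_congr rfl fun q _ => h2 q
  rcases mul_eq_zero.mp h5 with h | h
  · exact absurd (sub_eq_zero.mp h).symm hc
  · exact h

/-! ### Frobenius reciprocity for a character of a subgroup of finite index -/

section Induced

variable {Γ : Type*} [Group Γ] [TopologicalSpace Γ] [ContinuousMul Γ]

theorem isLocallyConstant_of_right_invariant {X : Type*} (N : Subgroup Γ)
    (hN : IsOpen (N : Set Γ)) (f : Γ → X) (hf : ∀ g, ∀ n ∈ N, f (g * n) = f g) :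
    IsLocallyConstant f := by
  rw [IsLocallyConstant.iff_exists_open]
  intro x
  refine ⟨(fun y => x⁻¹ * y) ⁻¹' N, hN.preimage (continuous_const_mul _), ?_, ?_⟩
  · simp [N.one_mem]
  · intro y hy
    have := hf x _ hy
    rwa [mul_inv_cancel_left] at this

variable (H : Subgroup Γ) (Ψ : H →* ℂˣ) {V : Type*} [AddCommGroup V] [Module ℂ V]
  (ρ : Representation ℂ Γ V) (v : V)

/-- The linear map `Ind_H^Γ Ψ → V` attached by Frobenius reciprocity to a vector `v` on which `H`
acts by `Ψ`. -/
def inducedMap [Fintype (Γ ⧸ H)] : smoothInd H Ψ →ₗ[ℂ] V where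
  toFun f := ∑ q : Γ ⧸ H, f.1 (q.out)⁻¹ • ρ q.out v
  map_add' f g := by
    rw [← Finset.sum_add_distrib]
    exact Finset.sum_congr rfl fun q _ => add_smul _ _ _
  map_smul' c f := by
    rw [RingHom.id_apply, Finset.smul_sum]
    exact Finset.sum_congr rfl fun q _ => mul_smul _ _ _

variable {H Ψ ρ v}

/-- Moving k within k H changes the two factors by inverse values of Ψ. Hence the representatives
`q.out` in `inducedMap` do not matter. -/
theorem induced_term_eq (hv : ∀ h : H, ρ h v = (Ψ h : ℂ) • v)
    (f : smoothInd H Ψ) {k k' : Γ} (h : (k : Γ ⧸ H) = k') :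
    f.1 k⁻¹ • ρ k v = f.1 k'⁻¹ • ρ k' v := by
  have h1 : k⁻¹ * k' ∈ H := QuotientGroup.eq.mp h
  obtain ⟨x, hx⟩ : ∃ x : H, k' = k * x := ⟨⟨_, h1⟩, by simp⟩
  have h2 := f.2.2 x⁻¹ k⁻¹
  rw [hx, map_mul, Module.End.mul_apply, hv, map_smul, mul_inv_rev, smul_smul,
    ← Subgroup.coe_inv, h2, map_inv, mul_right_comm, Units.inv_mul, one_mul]

theorem inducedMap_intertwines [Fintype (Γ ⧸ H)] (hv : ∀ h : H, ρ h v = (Ψ h : ℂ) • v)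
    (g : Γ) (f : smoothInd H Ψ) :
    inducedMap H Ψ ρ v (smoothIndRep H Ψ g f) = ρ g (inducedMap H Ψ ρ v f) := by
  change ∑ q : Γ ⧸ H, f.1 ((q.out)⁻¹ * g) • ρ q.out v = ρ g (∑ q : Γ ⧸ H, f.1 (q.out)⁻¹ • ρ q.out v)
  rw [map_sum]
  symm
  refine Fintype.sum_equiv (MulAction.toPerm g) _ _ fun q => ?_
  rw [map_smul]
  have h1 : ((g⁻¹ * (g • q).out : Γ) : Γ ⧸ H) = (q.out : Γ ⧸ H) := by
    rw [QuotientGroup.out_eq', ← smul_eq_mul, ← MulAction.Quotient.smul_coe, QuotientGroup.out_eq',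
      inv_smul_smul]
  have h2 := induced_term_eq hv f h1
  rw [← map_smul, ← h2, map_smul, ← Module.End.mul_apply, ← map_mul, mul_inv_cancel_left,
    mul_inv_rev, inv_inv]
  rfl

/-- The preimage of v is Ψ extended by zero outside H. The open subgroup N in the kernel of Ψ makes
this function locally constant. -/
theorem mem_range_inducedMap [Fintype (Γ ⧸ H)] (hv : ∀ h : H, ρ h v = (Ψ h : ℂ) • v)
    (N : Subgroup Γ) (hN : IsOpen (N : Set Γ))
    (hNH : N ≤ H) (hNΨ : ∀ n (hn : n ∈ N), Ψ ⟨n, hNH hn⟩ = 1) :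
    v ∈ LinearMap.range (inducedMap H Ψ ρ v) := by
  classical
  have key : ∀ g, ∀ n ∈ N, (if h : g * n ∈ H then (Ψ ⟨g * n, h⟩ : ℂ) else 0) =
      if h : g ∈ H then (Ψ ⟨g, h⟩ : ℂ) else 0 := by
    intro g n hn
    by_cases hg : g ∈ H
    · have h1 : (⟨g * n, H.mul_mem hg (hNH hn)⟩ : H) = ⟨g, hg⟩ * ⟨n, hNH hn⟩ := rfl
      rw [dif_pos hg, dif_pos (H.mul_mem hg (hNH hn)), h1, map_mul, hNΨ n hn, mul_one]
    · rw [dif_neg hg, dif_neg (fun h => hg ((H.mul_mem_cancel_right (hNH hn)).mp h))]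
  refine ⟨⟨fun g => if h : g ∈ H then (Ψ ⟨g, h⟩ : ℂ) else 0,
    isLocallyConstant_of_right_invariant N hN _ key, ?_⟩, ?_⟩
  · intro h g
    by_cases hg : g ∈ H
    · have h1 : (⟨h * g, H.mul_mem h.2 hg⟩ : H) = h * ⟨g, hg⟩ := rfl
      simp only
      rw [dif_pos hg, dif_pos (H.mul_mem h.2 hg), h1, map_mul, Units.val_mul]
    · simp only
      rw [dif_neg hg, dif_neg (fun h' => hg ((H.mul_mem_cancel_left h.2).mp h')), mul_zero]
  · change ∑ q : Γ ⧸ H, (if h : (q.out)⁻¹ ∈ H then (Ψ ⟨_, h⟩ : ℂ) else 0) • ρ q.out v = v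
    rw [Finset.sum_eq_single ((1 : Γ) : Γ ⧸ H)]
    · have h1 : (((1 : Γ) : Γ ⧸ H).out)⁻¹ ∈ H := by
        have := QuotientGroup.eq.mp (QuotientGroup.out_eq' ((1 : Γ) : Γ ⧸ H))
        rwa [mul_one] at this
      have h2 := hv ⟨_, h1⟩⁻¹
      rw [Subgroup.coe_inv, inv_inv] at h2
      rw [dif_pos h1, h2, smul_smul, map_inv, Units.mul_inv, one_smul]
    · intro q _ hq
      rw [dif_neg, zero_smul]
      intro h
      apply hq
      rw [← QuotientGroup.out_eq' q]
      exact QuotientGroup.eq.mpr (by rwa [mul_one])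
    · intro h
      exact absurd (Finset.mem_univ _) h

/-- Only the trivial coset of H contributes to the sum, so a functional that detects H on the orbit
of v recovers f from its image. This yields injectivity, and later also the transversality to the
vectors killed by all translates of L. -/
theorem functional_inducedMap [Fintype (Γ ⧸ H)] (hv : ∀ h : H, ρ h v = (Ψ h : ℂ) • v)
    (L : V →ₗ[ℂ] ℂ)
    (hL : ∀ k, L (ρ k v) ≠ 0 → k ∈ H) (f : smoothInd H Ψ) (g : Γ) :
    L (ρ g (inducedMap H Ψ ρ v f)) = f.1 g * L v := by
  rw [← inducedMap_intertwines hv]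
  change L (∑ q : Γ ⧸ H, f.1 ((q.out)⁻¹ * g) • ρ q.out v) = _
  rw [map_sum, Finset.sum_eq_single ((1 : Γ) : Γ ⧸ H)]
  · have h1 := induced_term_eq hv (smoothIndRep H Ψ g f)
      (QuotientGroup.out_eq' ((1 : Γ) : Γ ⧸ H))
    have h2 : (smoothIndRep H Ψ g f).1 (((1 : Γ) : Γ ⧸ H).out)⁻¹ =
      f.1 ((((1 : Γ) : Γ ⧸ H).out)⁻¹ * g) := rfl
    rw [← h2, h1, map_one, inv_one, map_smul, smul_eq_mul]
    change f.1 (1 * g) * _ = _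
    rw [one_mul]
    rfl
  · intro q _ hq
    rw [map_smul]
    by_contra hne
    have h1 := hL q.out (fun h => hne (by rw [h, smul_zero]))
    apply hq
    rw [← QuotientGroup.out_eq' q]
    exact QuotientGroup.eq.mpr (by simpa using H.inv_mem h1)
  · intro h
    exact absurd (Finset.mem_univ _) h

end Induced

/-- If two subrepresentations are complements of the same submodule in the same submodule, where the
first submodule is stable, then they are isomorphic. -/
theorem nonempty_equiv_of_complements {Γ V : Type*} [Group Γ] [AddCommGroup V] [Module ℂ V]
    {ρ : Representation ℂ Γ V} (U W₁ W₂ : Subrepresentation ρ)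
    (h₁ : Disjoint U.toSubmodule W₁.toSubmodule) (h₂ : Disjoint U.toSubmodule W₂.toSubmodule)
    (h : U.toSubmodule ⊔ W₁.toSubmodule = U.toSubmodule ⊔ W₂.toSubmodule) :
    Nonempty (W₁.toRepresentation.Equiv W₂.toRepresentation) := by
  have hex : ∀ w : W₁.toSubmodule, ∃ w' : W₂.toSubmodule, (w : V) - w' ∈ U.toSubmodule := by
    intro w
    have : (w : V) ∈ U.toSubmodule ⊔ W₂.toSubmodule := h ▸ Submodule.mem_sup_right w.2
    obtain ⟨u, hu, w', hw', he⟩ := Submodule.mem_sup.mp this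
    exact ⟨⟨w', hw'⟩, by simpa [← he] using hu⟩
  have huniq : ∀ x y : W₂.toSubmodule, (x : V) - y ∈ U.toSubmodule → x = y := by
    intro x y hxy
    have := Submodule.disjoint_def.mp h₂ _ hxy (W₂.toSubmodule.sub_mem x.2 y.2)
    exact Subtype.ext (sub_eq_zero.mp this)
  choose φ hφ using hex
  -- Both complements map isomorphically to the quotient by U. The map Φ is the composite
  -- identification, that is, the projection onto W₂ along U.
  let Φ : W₁.toSubmodule →ₗ[ℂ] W₂.toSubmodule :=
    { toFun := φ
      map_add' := fun x y => huniq _ _ (by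
        have := U.toSubmodule.sub_mem (U.toSubmodule.add_mem (hφ x) (hφ y)) (hφ (x + y))
        convert this using 1
        simp only [Submodule.coe_add]
        abel)
      map_smul' := fun c x => huniq _ _ (by
        have := U.toSubmodule.sub_mem (U.toSubmodule.smul_mem c (hφ x)) (hφ (c • x))
        convert this using 1
        simp only [Submodule.coe_smul, RingHom.id_apply, smul_sub]
        abel) }
  have hΦ : ∀ w : W₁.toSubmodule, (w : V) - Φ w ∈ U.toSubmodule := hφ
  refine ⟨Representation.Equiv.mk (LinearEquiv.ofBijective Φ ⟨?_, ?_⟩) ?_⟩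
  · rw [← LinearMap.ker_eq_bot, LinearMap.ker_eq_bot']
    intro w hw
    have h3 := hΦ w
    rw [hw, Submodule.coe_zero, sub_zero] at h3
    exact Subtype.ext (Submodule.disjoint_def.mp h₁ _ h3 w.2)
  · intro w
    have : (w : V) ∈ U.toSubmodule ⊔ W₁.toSubmodule := h ▸ Submodule.mem_sup_right w.2
    obtain ⟨u, hu, w', hw', he⟩ := Submodule.mem_sup.mp this
    refine ⟨⟨w', hw'⟩, huniq _ _ ?_⟩
    have h3 := U.toSubmodule.add_mem (hΦ ⟨w', hw'⟩) hu
    have h4 := U.toSubmodule.neg_mem h3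
    convert h4 using 1
    rw [← he]
    simp only
    abel
  · intro g
    ext w
    refine congrArg Subtype.val (huniq _ _ ?_)
    have h3 := U.apply_mem_toSubmodule g (hΦ w)
    rw [map_sub] at h3
    have h4 := hΦ (W₁.toRepresentation g w)
    have h5 := U.toSubmodule.sub_mem h3 h4
    convert h5 using 1
    change (Φ (W₁.toRepresentation g w) : V) - ρ g (Φ w) =
      (ρ g w - ρ g (Φ w)) - (ρ g w - Φ (W₁.toRepresentation g w))
    abel

namespace UnramifiedDatum

variable {F E : Type*} [NontriviallyNormedField F] [IsUltrametricDist F] [ProperSpace F]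
  [NormedField E] [IsUltrametricDist E] [NormedAlgebra F E] [Algebra.IsQuadraticExtension F E]
  (D : UnramifiedDatum F E)

/-! ### The arithmetic of `E` over `F` -/

theorem norm_unif_pos : 0 < ‖D.unif‖ := norm_pos_iff.mpr D.unif_ne_zero

theorem norm_unif_zpow_pos (k : ℤ) : 0 < ‖D.unif‖ ^ k := zpow_pos D.norm_unif_pos k

theorem norm_conj (x : E) : ‖D.conj x‖ = ‖x‖ := norm_algEquiv D.conj x

/-- The fractional ideal `𝔭_E ^ k` as an additive group. -/
def P (k : ℤ) : AddSubgroup E where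
  carrier := {x | ‖x‖ ≤ ‖D.unif‖ ^ k}
  zero_mem' := by simp [zpow_nonneg]
  add_mem' hx hy := (IsUltrametricDist.norm_add_le_max _ _).trans (max_le hx hy)
  neg_mem' hx := by simpa using hx

variable {D}

theorem mem_P {k : ℤ} {x : E} : x ∈ D.P k ↔ ‖x‖ ≤ ‖D.unif‖ ^ k := Iff.rfl

theorem mem_P_zero {x : E} : x ∈ D.P 0 ↔ ‖x‖ ≤ 1 := by rw [mem_P, zpow_zero]

theorem P_mono {k l : ℤ} (h : l ≤ k) {x : E} (hx : x ∈ D.P k) : x ∈ D.P l :=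
  hx.trans (zpow_le_zpow_right_of_le_one₀ D.norm_unif_pos D.norm_unif_lt_one.le h)

theorem mul_mem_P {k l n : ℤ} {x y : E} (hx : x ∈ D.P k) (hy : y ∈ D.P l) (h : n ≤ k + l) :
    x * y ∈ D.P n := by
  refine P_mono h ?_
  rw [mem_P, norm_mul, zpow_add₀ D.norm_unif_pos.ne']
  exact mul_le_mul hx hy (norm_nonneg _) (D.norm_unif_zpow_pos k).le

theorem mul_mem_P_left {k : ℤ} {x y : E} (hx : x ∈ D.P k) (hy : ‖y‖ ≤ 1) : x * y ∈ D.P k :=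
  mul_mem_P hx (mem_P_zero.mpr hy) (by simp)

theorem mul_mem_P_right {k : ℤ} {x y : E} (hx : ‖x‖ ≤ 1) (hy : y ∈ D.P k) : x * y ∈ D.P k :=
  mul_mem_P (mem_P_zero.mpr hx) hy (by simp)

theorem div_mem_P {k : ℤ} {x y : E} (hx : x ∈ D.P k) (hy : ‖y‖ = 1) : x / y ∈ D.P k := by
  rwa [mem_P, norm_div, hy, div_one]

theorem conj_mem_P {k : ℤ} {x : E} : D.conj x ∈ D.P k ↔ x ∈ D.P k := by
  rw [mem_P, mem_P, norm_conj]

theorem norm_lt_one_of_mem_P {k : ℤ} (hk : 1 ≤ k) {x : E} (hx : x ∈ D.P k) : ‖x‖ < 1 := by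
  have := P_mono hk hx
  rw [mem_P, zpow_one] at this
  exact this.trans_lt D.norm_unif_lt_one

theorem norm_le_one_of_mem_P {k : ℤ} (hk : 0 ≤ k) {x : E} (hx : x ∈ D.P k) : ‖x‖ ≤ 1 :=
  mem_P_zero.mp (P_mono hk hx)

theorem norm_one_add {k : ℤ} (hk : 1 ≤ k) {x : E} (hx : x ∈ D.P k) : ‖1 + x‖ = 1 := by
  have h := norm_lt_one_of_mem_P hk hx
  rw [IsUltrametricDist.norm_add_eq_max_of_norm_ne_norm (by rw [norm_one]; exact h.ne'), norm_one,
    max_eq_left h.le]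

theorem norm_eq_one_of_sub {k : ℤ} (hk : 1 ≤ k) {x : E} (hx : x - 1 ∈ D.P k) : ‖x‖ = 1 := by
  have := norm_one_add hk hx
  rwa [add_sub_cancel] at this

theorem norm_add_eq_left {k : ℤ} (hk : 1 ≤ k) {x y : E} (hx : ‖x‖ = 1) (hy : y ∈ D.P k) :
    ‖x + y‖ = 1 := by
  have h := norm_lt_one_of_mem_P hk hy
  rw [IsUltrametricDist.norm_add_eq_max_of_norm_ne_norm (by rw [hx]; exact h.ne'), hx,
    max_eq_left h.le]

variable (D)

theorem norm_two_E (D : UnramifiedDatum F E) : ‖(2 : E)‖ = 1 := by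
  have := norm_algebraMap' E (2 : F)
  rwa [map_ofNat, D.norm_two] at this

theorem two_ne_zero_E (D : UnramifiedDatum F E) : (2 : E) ≠ 0 := by
  rw [← norm_ne_zero_iff, D.norm_two_E]; exact one_ne_zero

theorem two_ne_zero_F (D : UnramifiedDatum F E) : (2 : F) ≠ 0 := by
  rw [← norm_ne_zero_iff, D.norm_two]; exact one_ne_zero

theorem eps_ne_zero : D.eps ≠ 0 := by
  rw [← norm_ne_zero_iff, D.norm_eps]; exact one_ne_zero

theorem norm_sqrtEps : ‖D.sqrtEps‖ = 1 := by
  have h : ‖D.sqrtEps‖ ^ 2 = 1 := by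
    rw [← norm_pow, D.sqrtEps_sq, norm_algebraMap', D.norm_eps]
  exact (pow_eq_one_iff_of_nonneg (norm_nonneg _) two_ne_zero).mp h

theorem sqrtEps_ne_zero : D.sqrtEps ≠ 0 := by
  rw [← norm_ne_zero_iff, D.norm_sqrtEps]; exact one_ne_zero

/-- A relation s + t√ε = 0 with t ≠ 0 would make ε a square in F, so 1 and √ε form a basis of the
quadratic extension. -/
theorem exists_eq_add_smul (x : E) : ∃ a b : F, x = algebraMap F E a + b • D.sqrtEps := by
  have hli : LinearIndependent F ![(1 : E), D.sqrtEps] := by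
    rw [LinearIndependent.pair_iff]
    intro s t hst
    have ht : t = 0 := by
      by_contra ht
      apply D.not_isSquare_eps
      refine ⟨-(s / t), (algebraMap F E).injective ?_⟩
      have h1 : D.sqrtEps = algebraMap F E (-(s / t)) := by
        have : algebraMap F E t ≠ 0 := by simpa using ht
        rw [Algebra.smul_def, Algebra.smul_def, mul_one] at hst
        rw [map_neg, map_div₀]
        field_simp
        linear_combination hst
      rw [map_mul, ← h1, ← D.sqrtEps_sq, sq]
    refine ⟨?_, ht⟩
    rw [ht, zero_smul, add_zero, Algebra.smul_def, mul_one] at hst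
    simpa using hst
  have hspan := hli.span_eq_top_of_card_eq_finrank' (by
    rw [Fintype.card_fin, Algebra.IsQuadraticExtension.finrank_eq_two])
  have hx : x ∈ Submodule.span F (Set.range ![(1 : E), D.sqrtEps]) := hspan ▸ Submodule.mem_top
  rw [Matrix.range_cons, Matrix.range_cons, Matrix.range_empty, Set.union_empty,
    Set.singleton_union, Submodule.mem_span_pair] at hx
  obtain ⟨a, b, h⟩ := hx
  exact ⟨a, b, by rw [← h, Algebra.smul_def a, mul_one]⟩

theorem conj_algebraMap (a : F) : D.conj (algebraMap F E a) = algebraMap F E a := D.conj.commutes a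

theorem conj_sqrtEps : D.conj D.sqrtEps = -D.sqrtEps := by
  have h : D.conj D.sqrtEps ^ 2 = D.sqrtEps ^ 2 := by
    rw [← map_pow, D.sqrtEps_sq, conj_algebraMap]
  rcases sq_eq_sq_iff_eq_or_eq_neg.mp h with h | h
  · exfalso
    apply D.conj_ne
    ext x
    obtain ⟨a, b, rfl⟩ := D.exists_eq_add_smul x
    rw [map_add, map_smul, conj_algebraMap, h]
    rfl
  · exact h

theorem conj_smul_sqrtEps (b : F) : D.conj (b • D.sqrtEps) = -(b • D.sqrtEps) := by
  rw [map_smul, conj_sqrtEps, smul_neg]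

theorem conj_conj (x : E) : D.conj (D.conj x) = x := by
  obtain ⟨a, b, rfl⟩ := D.exists_eq_add_smul x
  simp [map_smul, conj_sqrtEps]

variable {D}

theorem exists_algebraMap_eq {x : E} (hx : D.conj x = x) : ∃ a : F, algebraMap F E a = x := by
  obtain ⟨a, b, rfl⟩ := D.exists_eq_add_smul x
  refine ⟨a, ?_⟩
  rw [map_add, conj_algebraMap, conj_smul_sqrtEps] at hx
  have : 2 * (b • D.sqrtEps) = 0 := by linear_combination -hx
  rw [(mul_eq_zero.mp this).resolve_left D.two_ne_zero_E, add_zero]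

theorem exists_smul_sqrtEps_eq {x : E} (hx : D.conj x = -x) : ∃ b : F, b • D.sqrtEps = x := by
  obtain ⟨a, b, rfl⟩ := D.exists_eq_add_smul x
  refine ⟨b, ?_⟩
  rw [map_add, conj_algebraMap, conj_smul_sqrtEps] at hx
  have : 2 * (algebraMap F E a) = 0 := by linear_combination hx
  rw [(mul_eq_zero.mp this).resolve_left D.two_ne_zero_E, zero_add]

theorem norm_smul_sqrtEps (b : F) : ‖b • D.sqrtEps‖ = ‖b‖ := by
  rw [norm_smul, D.norm_sqrtEps, mul_one]

theorem norm_left_le (a b : F) : ‖a‖ ≤ ‖algebraMap F E a + b • D.sqrtEps‖ := by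
  have h1 : 2 * algebraMap F E a = (algebraMap F E a + b • D.sqrtEps) +
      D.conj (algebraMap F E a + b • D.sqrtEps) := by
    rw [map_add, conj_algebraMap, conj_smul_sqrtEps]; ring
  have h2 : ‖a‖ = ‖2 * algebraMap F E a‖ := by
    rw [norm_mul, D.norm_two_E, one_mul, norm_algebraMap']
  rw [h2, h1]
  refine (IsUltrametricDist.norm_add_le_max _ _).trans (max_le le_rfl ?_)
  rw [norm_conj]

theorem norm_right_le (a b : F) : ‖b‖ ≤ ‖algebraMap F E a + b • D.sqrtEps‖ := by
  have h1 : 2 * (b • D.sqrtEps) = (algebraMap F E a + b • D.sqrtEps) -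
      D.conj (algebraMap F E a + b • D.sqrtEps) := by
    rw [map_add, conj_algebraMap, conj_smul_sqrtEps]; ring
  have h2 : ‖b‖ = ‖2 * (b • D.sqrtEps)‖ := by
    rw [norm_mul, D.norm_two_E, one_mul, norm_smul_sqrtEps]
  rw [h2, h1]
  rw [sub_eq_add_neg]
  refine (IsUltrametricDist.norm_add_le_max _ _).trans (max_le le_rfl ?_)
  rw [norm_neg, norm_conj]

/-- Discreteness of the valuation, by scaling with ϖ^k to the defining property of the uniformiser.
-/
theorem norm_le_of_norm_lt {x : F} {k : ℤ} (h : ‖x‖ < ‖D.unif‖ ^ k) : ‖x‖ ≤ ‖D.unif‖ ^ (k + 1) := by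
  have hk := D.norm_unif_zpow_pos k
  have h1 : ‖x / D.unif ^ k‖ < 1 := by
    rw [norm_div, norm_zpow, div_lt_one hk]; exact h
  have h2 := D.norm_le_norm_unif _ h1
  rw [norm_div, norm_zpow, div_le_iff₀ hk] at h2
  rwa [zpow_add_one₀ D.norm_unif_pos.ne', mul_comm]

theorem algebraMap_mem_P {a : F} {k : ℤ} : algebraMap F E a ∈ D.P k ↔ ‖a‖ ≤ ‖D.unif‖ ^ k := by
  rw [mem_P, norm_algebraMap']

theorem smul_sqrtEps_mem_P {a : F} {k : ℤ} : a • D.sqrtEps ∈ D.P k ↔ ‖a‖ ≤ ‖D.unif‖ ^ k := by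
  rw [mem_P, norm_smul_sqrtEps]

/-! ### The additive character -/

variable (D)

theorem algebraMap_trace (x : E) : algebraMap F E (Algebra.trace F E x) = x + D.conj x := by
  have htr : Algebra.trace F E D.sqrtEps = 0 := by
    have h1 := Algebra.trace_eq_of_algEquiv D.conj D.sqrtEps
    rw [conj_sqrtEps, map_neg] at h1
    have : 2 * Algebra.trace F E D.sqrtEps = 0 := by linear_combination -h1
    exact (mul_eq_zero.mp this).resolve_left D.two_ne_zero_F
  obtain ⟨a, b, rfl⟩ := D.exists_eq_add_smul x
  rw [map_add, map_smul, htr, Algebra.trace_algebraMap, map_add D.conj, conj_smul_sqrtEps, conj_algebraMap,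
    Algebra.IsQuadraticExtension.finrank_eq_two]
  simp
  rw [map_ofNat]
  ring

theorem psi_add (x y : E) : D.psi (x + y) = D.psi x * D.psi y := by
  rw [psi, map_add, add_div, AddChar.map_add_eq_mul]; rfl

theorem psi_zero : D.psi 0 = 1 := by
  rw [psi, map_zero, zero_div, AddChar.map_zero_eq_one]

theorem psi_neg_mul (x : E) : D.psi (-x) * D.psi x = 1 := by
  rw [← psi_add, neg_add_cancel, psi_zero]

theorem psi_ne_zero (x : E) : D.psi x ≠ 0 := right_ne_zero_of_mul_eq_one (D.psi_neg_mul x)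

variable {D}

theorem psi_eq_one_of_add_conj {x : E} (hx : x + D.conj x ∈ D.P 1) : D.psi x = 1 := by
  apply D.psi'_trivial
  rw [← algebraMap_trace, algebraMap_mem_P, zpow_one] at hx
  rw [norm_div, D.norm_two, div_one]
  exact hx.trans_lt D.norm_unif_lt_one

theorem psi_eq_one {x : E} (hx : x ∈ D.P 1) : D.psi x = 1 :=
  psi_eq_one_of_add_conj ((D.P 1).add_mem hx (conj_mem_P.mpr hx))

theorem psi_eq_one_of_imag {x : E} (hx : D.conj x = -x) : D.psi x = 1 :=
  psi_eq_one_of_add_conj (by rw [hx, add_neg_cancel]; exact (D.P 1).zero_mem)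

theorem psi_eq_of_sub {x y : E} (h : D.psi (x - y) = 1) : D.psi x = D.psi y := by
  rw [← sub_add_cancel x y, psi_add, h, one_mul]

theorem psi_congr {x y : E} (h : x - y ∈ D.P 1) : D.psi x = D.psi y := psi_eq_of_sub (psi_eq_one h)

theorem psi_algebraMap (a : F) : D.psi (algebraMap F E a) = D.psi' a := by
  rw [psi, Algebra.trace_algebraMap, Algebra.IsQuadraticExtension.finrank_eq_two]
  have := D.two_ne_zero_F
  congr 1
  simp
  field_simp

/-- The bound says |y| ≥ |ϖ|^(-k), so y 𝔭_F^k contains 𝒪_F, where ψ' is nontrivial. -/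
theorem exists_psi'_mul_ne_one {y : F} {k : ℤ} (hy : ‖D.unif‖ ^ (1 - k) < ‖y‖) :
    ∃ s : F, ‖s‖ ≤ ‖D.unif‖ ^ k ∧ D.psi' (s * y) ≠ 1 := by
  obtain ⟨x, hx, hx'⟩ := D.psi'_nontrivial
  have hy0 : y ≠ 0 := by
    rw [← norm_pos_iff]; exact (D.norm_unif_zpow_pos _).trans hy
  refine ⟨x / y, ?_, by rwa [div_mul_cancel₀ _ hy0]⟩
  have h1 : ‖D.unif‖ ^ (-k) ≤ ‖y‖ := by
    by_contra h
    have := norm_le_of_norm_lt (not_le.mp h)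
    rw [neg_add_eq_sub] at this
    exact absurd hy (not_lt.mpr this)
  rw [norm_div, div_le_iff₀ (norm_pos_iff.mpr hy0)]
  calc ‖x‖ ≤ 1 := hx
    _ = ‖D.unif‖ ^ k * ‖D.unif‖ ^ (-k) := by
      rw [← zpow_add₀ D.norm_unif_pos.ne', add_neg_cancel, zpow_zero]
    _ ≤ _ := mul_le_mul_of_nonneg_left h1 (D.norm_unif_zpow_pos k).le

theorem psi_smul (s : F) (x : E) : D.psi (s • x) = D.psi' (s * (Algebra.trace F E x / 2)) := by
  rw [psi, map_smul, smul_eq_mul, mul_div_assoc]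

theorem add_conj_mem_P_of_psi {x : E} {k : ℤ}
    (h : ∀ s : F, ‖s‖ ≤ ‖D.unif‖ ^ k → D.psi (s • x) = 1) : x + D.conj x ∈ D.P (1 - k) := by
  by_contra hx
  rw [← algebraMap_trace, algebraMap_mem_P, not_le] at hx
  obtain ⟨s, hs, hs'⟩ := exists_psi'_mul_ne_one (D := D) (y := Algebra.trace F E x / 2) (k := k)
    (by rwa [norm_div, D.norm_two, div_one])
  exact hs' (by rw [← psi_smul]; exact h s hs)

/-- Duality: the annihilator of 𝔭_E^k under ψ is 𝔭_E^(1-k). Multiples by F see the trace of x and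
multiples by F√ε see the trace of √ε x; together these recover 2√ε x, and 2√ε is a unit. -/
theorem mem_P_of_psi {x : E} {k : ℤ} (h : ∀ y ∈ D.P k, D.psi (y * x) = 1) : x ∈ D.P (1 - k) := by
  have h1 : x + D.conj x ∈ D.P (1 - k) := add_conj_mem_P_of_psi fun s hs => by
    rw [Algebra.smul_def]; exact h _ (algebraMap_mem_P.mpr hs)
  have h2 : D.sqrtEps * x + D.conj (D.sqrtEps * x) ∈ D.P (1 - k) :=
    add_conj_mem_P_of_psi fun s hs => by
      rw [← smul_mul_assoc]; exact h _ (smul_sqrtEps_mem_P.mpr hs)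
  rw [map_mul, conj_sqrtEps] at h2
  have h3 : D.sqrtEps * (2 * x) ∈ D.P (1 - k) := by
    have := (D.P _).add_mem (mul_mem_P_right D.norm_sqrtEps.le h1) h2
    convert this using 1
    ring
  rwa [mem_P, norm_mul, norm_mul, D.norm_sqrtEps, D.norm_two_E, one_mul, one_mul] at h3

end UnramifiedDatum

namespace UnramifiedDatum

variable {F E : Type*} [NontriviallyNormedField F] [IsUltrametricDist F] [ProperSpace F]
  [NormedField E] [IsUltrametricDist E] [NormedAlgebra F E] [Algebra.IsQuadraticExtension F E]
  {D : UnramifiedDatum F E}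

/-! ### Elements of `U(1,1)` -/

theorem mat_injective : Function.Injective D.mat := fun _ _ h => Subtype.ext (Units.ext h)

theorem mat_conj_col (g : D.G) :
    D.conj (D.mat g 0 0) * D.mat g 1 0 + D.conj (D.mat g 1 0) * D.mat g 0 0 = 0 ∧
    D.conj (D.mat g 0 0) * D.mat g 1 1 + D.conj (D.mat g 1 0) * D.mat g 0 1 = 1 ∧
    D.conj (D.mat g 0 1) * D.mat g 1 1 + D.conj (D.mat g 1 1) * D.mat g 0 1 = 0 := by
  have h : D.mat g⁻¹ * D.mat g = 1 := by rw [← mat_mul, inv_mul_cancel, mat_one]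
  rw [mat_inv_entries] at h
  have h10 := congrFun (congrFun h 1) 0
  have h11 := congrFun (congrFun h 1) 1
  have h01 := congrFun (congrFun h 0) 1
  simp [Matrix.mul_apply, Fin.sum_univ_two] at h10 h11 h01
  refine ⟨?_, ?_, ?_⟩
  · linear_combination h10
  · linear_combination h11
  · linear_combination h01

theorem mat_conj_row (g : D.G) :
    D.mat g 0 0 * D.conj (D.mat g 1 1) + D.mat g 0 1 * D.conj (D.mat g 1 0) = 1 ∧
    D.mat g 0 0 * D.conj (D.mat g 0 1) + D.mat g 0 1 * D.conj (D.mat g 0 0) = 0 ∧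
    D.mat g 1 0 * D.conj (D.mat g 1 1) + D.mat g 1 1 * D.conj (D.mat g 1 0) = 0 := by
  have h : D.mat g * D.mat g⁻¹ = 1 := by rw [← mat_mul, mul_inv_cancel, mat_one]
  rw [mat_inv_entries] at h
  have h10 := congrFun (congrFun h 1) 0
  have h00 := congrFun (congrFun h 0) 0
  have h01 := congrFun (congrFun h 0) 1
  simp [Matrix.mul_apply, Fin.sum_univ_two] at h10 h00 h01
  exact ⟨h00, h01, h10⟩

variable (D)

/-- The element of `G` with given entries. -/
def elt (a b c e : E) (h1 : D.conj a * c + D.conj c * a = 0) (h2 : D.conj a * e + D.conj c * b = 1)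
    (h3 : D.conj b * e + D.conj e * b = 0) : D.G :=
  have h : D.conjTr !![a, b; c, e] * w * !![a, b; c, e] = w := by
    have h2' := congrArg D.conj h2
    simp only [map_add, map_mul, conj_conj, map_one] at h2'
    ext i j
    fin_cases i <;> fin_cases j <;>
      simp [conjTr, w, Matrix.mul_apply, Fin.sum_univ_two] <;>
      first | linear_combination h1 | linear_combination h2 | linear_combination h2' |
        linear_combination h3
  have h' : w * D.conjTr !![a, b; c, e] * w * !![a, b; c, e] = 1 := by
    rw [mul_assoc w, mul_assoc w, h, w_mul_w]
  ⟨⟨!![a, b; c, e], w * D.conjTr !![a, b; c, e] * w, mul_eq_one_comm.mp h', h'⟩, h⟩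

theorem mat_elt (a b c e : E) (h1 h2 h3) : D.mat (D.elt a b c e h1 h2 h3) = !![a, b; c, e] := rfl

/-- The lower triangular unipotent element `(1, 0; s√ε, 1)` of `G`. -/
def lower (s : F) : D.G :=
  D.elt 1 0 (s • D.sqrtEps) 1 (by rw [conj_smul_sqrtEps, map_one]; ring) (by simp) (by simp)

theorem mat_lower (s : F) : D.mat (D.lower s) = !![1, 0; s • D.sqrtEps, 1] := rfl

theorem lower_add (s t : F) : D.lower (s + t) = D.lower s * D.lower t := by
  apply mat_injective
  rw [mat_mul, mat_lower, mat_lower, mat_lower, add_smul]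
  ext i j
  fin_cases i <;> fin_cases j <;> simp

theorem lower_zero : D.lower 0 = 1 := by
  have := D.lower_add 0 0
  rw [add_zero] at this
  exact left_eq_mul.mp this

theorem lower_neg (s : F) : D.lower (-s) = (D.lower s)⁻¹ := by
  rw [eq_inv_iff_mul_eq_one, ← lower_add, neg_add_cancel, lower_zero]

theorem lower_comm (s t : F) : D.lower s * D.lower t = D.lower t * D.lower s := by
  rw [← lower_add, add_comm, lower_add]

/-- The Weyl element `w` of `G`. -/
def weyl : D.G := D.elt 0 1 1 0 (by simp) (by simp) (by simp)

/-- The upper triangular element `(p, b; 0, e)` of `G`. -/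
def upper (p b e : E) (h : D.conj p * e = 1) (h' : D.conj b * e + D.conj e * b = 0) : D.G :=
  D.elt p b 0 e (by simp) (by simp [h]) h'

theorem mat_upper (p b e : E) (h h') : D.mat (D.upper p b e h h') = !![p, b; 0, e] := rfl

variable {D}

theorem mat_lower_mul (s : F) (g : D.G) : D.mat (D.lower s * g) =
    !![D.mat g 0 0, D.mat g 0 1; s • D.sqrtEps * D.mat g 0 0 + D.mat g 1 0,
      s • D.sqrtEps * D.mat g 0 1 + D.mat g 1 1] := by
  rw [mat_mul, mat_lower]
  ext i j
  fin_cases i <;> fin_cases j <;> simp [Matrix.mul_apply, Fin.sum_univ_two]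

theorem mat_mul_lower (s : F) (g : D.G) : D.mat (g * D.lower s) =
    !![D.mat g 0 0 + D.mat g 0 1 * (s • D.sqrtEps), D.mat g 0 1;
      D.mat g 1 0 + D.mat g 1 1 * (s • D.sqrtEps), D.mat g 1 1] := by
  rw [mat_mul, mat_lower]
  ext i j
  fin_cases i <;> fin_cases j <;> simp [Matrix.mul_apply, Fin.sum_univ_two]

theorem mat_lower_conj (s : F) (g : D.G) : D.mat (D.lower s * g * D.lower (-s)) =
    !![D.mat g 0 0 - s • D.sqrtEps * D.mat g 0 1, D.mat g 0 1;
      s • D.sqrtEps * (D.mat g 0 0 - D.mat g 1 1) + D.mat g 1 0 -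
        (s • D.sqrtEps) ^ 2 * D.mat g 0 1,
      s • D.sqrtEps * D.mat g 0 1 + D.mat g 1 1] := by
  rw [mat_mul_lower, mat_lower_mul, neg_smul]
  generalize s • D.sqrtEps = t
  ext i j
  fin_cases i <;> fin_cases j <;> simp <;> ring

/-! ### Congruence subgroups -/

theorem mem_congruenceSubgroup {m n : ℕ} {g : D.G} : g ∈ D.congruenceSubgroup m n ↔
    D.mat g 0 0 - 1 ∈ D.P m ∧ D.mat g 0 1 ∈ D.P m ∧ D.mat g 1 0 ∈ D.P n ∧ D.mat g 1 1 - 1 ∈ D.P m :=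
  Iff.rfl

theorem mem_K_iff {n : ℕ} {g : D.G} : g ∈ D.K n ↔ ∀ i j, (D.mat g - 1) i j ∈ D.P n := by
  rw [K, mem_congruenceSubgroup]
  simp only [Fin.forall_fin_two, Matrix.sub_apply]
  simp [and_assoc]

theorem mem_K_zero_iff {g : D.G} : g ∈ D.K 0 ↔ ∀ i j, ‖D.mat g i j‖ ≤ 1 := by
  rw [mem_K_iff]
  refine forall_congr' fun i => forall_congr' fun j => ?_
  have h : (1 : Matrix (Fin 2) (Fin 2) E) i j ∈ D.P 0 := by
    rw [mem_P_zero, Matrix.one_apply]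
    split_ifs <;> simp
  rw [Matrix.sub_apply, Nat.cast_zero, sub_eq_add_neg,
    (D.P 0).add_mem_cancel_right ((D.P 0).neg_mem h), mem_P_zero]

theorem K_mono {n n' : ℕ} (h : n ≤ n') : D.K n' ≤ D.K n := by
  intro g hg
  rw [mem_K_iff] at hg ⊢
  exact fun i j => P_mono (by exact_mod_cast h) (hg i j)

theorem mul_entries_mem {n : ℤ} {X Y : Matrix (Fin 2) (Fin 2) E} (hX : ∀ i j, X i j ∈ D.P n)
    (hY : ∀ i j, ‖Y i j‖ ≤ 1) (i j : Fin 2) : (X * Y) i j ∈ D.P n := by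
  rw [Matrix.mul_apply]
  exact (D.P n).sum_mem fun k _ => mul_mem_P_left (hX i k) (hY k j)

theorem mul_entries_mem' {n : ℤ} {X Y : Matrix (Fin 2) (Fin 2) E} (hX : ∀ i j, ‖X i j‖ ≤ 1)
    (hY : ∀ i j, Y i j ∈ D.P n) (i j : Fin 2) : (X * Y) i j ∈ D.P n := by
  rw [Matrix.mul_apply]
  exact (D.P n).sum_mem fun k _ => mul_mem_P_right (hX i k) (hY k j)

theorem conj_mem_K {n : ℕ} {k g : D.G} (hk : k ∈ D.K 0) (hg : g ∈ D.K n) : k * g * k⁻¹ ∈ D.K n := by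
  rw [mem_K_iff] at hg ⊢
  have h : D.mat (k * g * k⁻¹) - 1 = D.mat k * (D.mat g - 1) * D.mat k⁻¹ := by
    have h1 : D.mat k * D.mat k⁻¹ = 1 := by rw [← mat_mul, mul_inv_cancel, mat_one]
    rw [mat_mul, mat_mul, mul_sub, sub_mul, mul_one, h1]
  rw [h]
  exact mul_entries_mem (mul_entries_mem' (mem_K_zero_iff.mp hk) hg)
    (mem_K_zero_iff.mp ((D.K 0).inv_mem hk))

theorem inv_mul_mem_K {n : ℕ} {k g : D.G} (hk : k ∈ D.K 0)
    (h : ∀ i j, (D.mat g - D.mat k) i j ∈ D.P n) : k⁻¹ * g ∈ D.K n := by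
  rw [mem_K_iff]
  have h1 : D.mat k⁻¹ * D.mat k = 1 := by rw [← mat_mul, inv_mul_cancel, mat_one]
  rw [mat_mul, ← h1, ← mul_sub]
  exact mul_entries_mem' (mem_K_zero_iff.mp ((D.K 0).inv_mem hk)) h

theorem J_le_K_zero (d : ℕ) : D.J d ≤ D.K 0 := by
  intro g hg
  rw [J, mem_congruenceSubgroup] at hg
  rw [K, mem_congruenceSubgroup]
  have h : ∀ {k : ℕ} {x : E}, x ∈ D.P k → x ∈ D.P (0 : ℕ) := fun hx => P_mono (by simp) hx
  exact ⟨h hg.1, h hg.2.1, h hg.2.2.1, h hg.2.2.2⟩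

theorem K_le_J {d : ℕ} (hd : 1 ≤ d) : D.K d ≤ D.J d := by
  intro g hg
  rw [K, mem_congruenceSubgroup] at hg
  rw [J, mem_congruenceSubgroup]
  exact ⟨P_mono (by omega) hg.1, P_mono (by omega) hg.2.1, P_mono (by omega) hg.2.2.1,
    P_mono (by omega) hg.2.2.2⟩

theorem lower_mem_K {n : ℕ} {s : F} : D.lower s ∈ D.K n ↔ ‖s‖ ≤ ‖D.unif‖ ^ (n : ℤ) := by
  rw [K, mem_congruenceSubgroup, mat_lower, ← smul_sqrtEps_mem_P]
  simp [(D.P n).zero_mem]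

theorem lower_mem_K_zero {s : F} : D.lower s ∈ D.K 0 ↔ ‖s‖ ≤ 1 := by
  rw [lower_mem_K, Nat.cast_zero, zpow_zero]

theorem weyl_mem_K_zero : D.weyl ∈ D.K 0 := by
  rw [mem_K_zero_iff, weyl, mat_elt]
  simp [Fin.forall_fin_two]

theorem row_ne_zero {g : D.G} (h : D.mat g 1 1 = 0) : D.mat g 1 0 ≠ 0 := by
  intro h'
  have := (mat_conj_row g).1
  rw [h, h', map_zero, mul_zero, mul_zero, add_zero] at this
  exact zero_ne_one this

/-- The bottom row is isotropic for the hermitian form. This is what makes B\G a projective line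
over F rather than over E. For a zero denominator the quotient is 0 by convention, and the relation
still holds. -/
theorem conj_row_div (g : D.G) :
    D.conj (D.mat g 1 0 / D.mat g 1 1) = -(D.mat g 1 0 / D.mat g 1 1) := by
  by_cases he : D.mat g 1 1 = 0
  · simp [he]
  have h := (mat_conj_row g).2.2
  have he' : D.conj (D.mat g 1 1) ≠ 0 := (map_ne_zero D.conj).mpr he
  rw [map_div₀]
  field_simp
  linear_combination h

theorem exists_eq_mul_lower {g : D.G} (he : D.mat g 1 1 ≠ 0) :
    ∃ b : D.B, ∃ s : F, g = b * D.lower s ∧ s • D.sqrtEps = D.mat g 1 0 / D.mat g 1 1 := by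
  obtain ⟨s, hs⟩ := exists_smul_sqrtEps_eq (conj_row_div g)
  refine ⟨⟨g * D.lower (-s), ?_⟩, s, ?_, hs⟩
  · change D.mat _ 1 0 = 0
    rw [mat_mul_lower, neg_smul, hs]
    simp
    field_simp
    ring
  · rw [mul_assoc, ← lower_add, neg_add_cancel, lower_zero, mul_one]

/-- The Iwasawa decomposition `G = B 𝒦`. -/
theorem exists_eq_mul (g : D.G) : ∃ b ∈ D.B, ∃ k ∈ D.K 0, g = b * k := by
  have aux : ∀ g : D.G, ‖D.mat g 1 0‖ ≤ ‖D.mat g 1 1‖ → ∃ b ∈ D.B, ∃ k ∈ D.K 0, g = b * k := by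
    intro g hg
    have he : D.mat g 1 1 ≠ 0 := by
      intro he
      rw [he, norm_zero, norm_le_zero_iff] at hg
      exact row_ne_zero he hg
    obtain ⟨b, s, h, hs⟩ := exists_eq_mul_lower he
    refine ⟨b, b.2, D.lower s, ?_, h⟩
    rw [lower_mem_K_zero, ← norm_smul_sqrtEps (D := D), hs, norm_div]
    exact div_le_one_of_le₀ hg (norm_nonneg _)
  rcases le_total ‖D.mat g 1 0‖ ‖D.mat g 1 1‖ with h | h
  · exact aux g h
  -- The Weyl element interchanges the two entries of the bottom row.
  · obtain ⟨b, hb, k, hk, he⟩ := aux (g * D.weyl⁻¹) (by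
      rw [mat_mul, mat_inv_entries, weyl, mat_elt]
      simpa [Matrix.mul_apply, Fin.sum_univ_two] using h)
    exact ⟨b, hb, k * D.weyl, (D.K 0).mul_mem hk weyl_mem_K_zero, by
      rw [← mul_assoc, ← he, inv_mul_cancel_right]⟩

/-! ### Topology -/

theorem continuous_mat (i j : Fin 2) : Continuous fun g : D.G => D.mat g i j :=
  (Units.continuous_val.comp continuous_subtype_val).matrix_elem i j

theorem isOpen_P (k : ℤ) : IsOpen (D.P k : Set E) := by
  have : (D.P k : Set E) = Metric.closedBall 0 (‖D.unif‖ ^ k) := by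
    ext x
    rw [mem_closedBall_zero_iff]
    rfl
  rw [this]
  exact IsUltrametricDist.isOpen_closedBall _ (D.norm_unif_zpow_pos k).ne'

theorem isOpen_K (n : ℕ) : IsOpen (D.K n : Set D.G) := by
  have h : (D.K n : Set D.G) = ⋂ i, ⋂ j, {g | (D.mat g - 1) i j ∈ D.P n} := by
    ext g
    rw [SetLike.mem_coe, mem_K_iff]
    simp
  rw [h]
  exact isOpen_iInter_of_finite fun i => isOpen_iInter_of_finite fun j =>
    (isOpen_P n).preimage ((continuous_mat i j).sub continuous_const)

theorem isOpen_K_subgroupOf (n : ℕ) : IsOpen ((D.K n).subgroupOf (D.K 0) : Set (D.K 0)) :=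
  (isOpen_K n).preimage continuous_subtype_val

theorem exists_finite_cover (D : UnramifiedDatum F E) (k : ℤ) : ∃ t : Set E, t.Finite ∧ ∀ x ∈ D.P 0, ∃ y ∈ t, x - y ∈ D.P k := by
  have : ProperSpace E := FiniteDimensional.proper F E
  obtain ⟨t, -, ht, hc⟩ := (isCompact_closedBall (0 : E) 1).finite_cover_balls
    (D.norm_unif_zpow_pos k)
  refine ⟨t, ht, fun x hx => ?_⟩
  have hx' := hc (mem_closedBall_zero_iff.mpr (mem_P_zero.mp hx))
  rw [Set.mem_iUnion₂] at hx'
  obtain ⟨y, hy, hxy⟩ := hx'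
  exact ⟨y, hy, by rw [mem_P, ← dist_eq_norm]; exact (Metric.mem_ball.mp hxy).le⟩

theorem finite_quotient_K (n : ℕ) : Finite ((D.K 0) ⧸ (D.K n).subgroupOf (D.K 0)) := by
  obtain ⟨t, ht, hc⟩ := exists_finite_cover D n
  have := ht.to_subtype
  have hc' : ∀ x : E, ∃ y : t, x ∈ D.P 0 → x - y ∈ D.P n := by
    intro x
    by_cases hx : x ∈ D.P 0
    · obtain ⟨y, hy, h⟩ := hc x hx
      exact ⟨⟨y, hy⟩, fun _ => h⟩
    · obtain ⟨y, hy, -⟩ := hc 0 (D.P 0).zero_mem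
      exact ⟨⟨y, hy⟩, fun h => absurd h hx⟩
  choose φ hφ using hc'
  refine Finite.of_injective
    (fun (q : (D.K 0) ⧸ (D.K n).subgroupOf (D.K 0)) (i j : Fin 2) => φ (D.mat (q.out : D.G) i j)) ?_
  intro q q' h
  rw [← QuotientGroup.out_eq' q, ← QuotientGroup.out_eq' q']
  refine QuotientGroup.eq.mpr ?_
  rw [Subgroup.mem_subgroupOf]
  refine inv_mul_mem_K q.out.2 fun i j => ?_
  have h1 := hφ _ (mem_P_zero.mpr (mem_K_zero_iff.mp q.out.2 i j))
  have h2 := hφ _ (mem_P_zero.mpr (mem_K_zero_iff.mp q'.out.2 i j))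
  have h3 : φ (D.mat (q.out : D.G) i j) = φ (D.mat (q'.out : D.G) i j) :=
    congrFun (congrFun h i) j
  rw [← h3] at h2
  have h4 := (D.P n).sub_mem h2 h1
  rwa [sub_sub_sub_cancel_right] at h4

end UnramifiedDatum

namespace UnramifiedDatum

variable {F E : Type*} [NontriviallyNormedField F] [IsUltrametricDist F] [ProperSpace F]
  [NormedField E] [IsUltrametricDist E] [NormedAlgebra F E] [Algebra.IsQuadraticExtension F E]
  {D : UnramifiedDatum F E}

/-! ### Characters of the torus as functions on `E` -/

variable (D) in
/-- The element `diag(ē⁻¹, e)` of the torus. -/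
def torus : Eˣ →* D.T where
  toFun e := ⟨D.upper (D.conj (e : E))⁻¹ 0 e (by rw [map_inv₀, conj_conj]; simp) (by simp),
    rfl, rfl⟩
  map_one' := by
    apply Subtype.ext
    apply mat_injective
    change !![_, _; _, _] = (1 : Matrix (Fin 2) (Fin 2) E)
    ext i j
    fin_cases i <;> fin_cases j <;> simp
  map_mul' e e' := by
    apply Subtype.ext
    apply mat_injective
    change !![_, _; _, _] = !![_, _; _, _] * !![_, _; _, _]
    ext i j
    fin_cases i <;> fin_cases j <;> simp [mul_comm]

/-- The character `e ↦ χ(diag(ē⁻¹, e))` of `E`, extended by zero. -/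
def torusChar (χ : D.T →* ℂˣ) : E →*₀ ℂ := by
  classical
  exact
  { toFun x := if h : x = 0 then 0 else χ (D.torus (Units.mk0 x h))
    map_zero' := by simp
    map_one' := by simp
    map_mul' x y := by
      by_cases hx : x = 0
      · simp [hx]
      · by_cases hy : y = 0
        · simp [hy]
        · rw [dif_neg hx, dif_neg hy, dif_neg (mul_ne_zero hx hy), Units.mk0_mul, map_mul, map_mul,
            Units.val_mul] }

theorem torusChar_of_ne_zero (χ : D.T →* ℂˣ) {x : E} (hx : x ≠ 0) :
    torusChar χ x = χ (D.torus (Units.mk0 x hx)) := dif_neg hx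

theorem torusChar_ne_zero (χ : D.T →* ℂˣ) {x : E} (hx : x ≠ 0) : torusChar χ x ≠ 0 := by
  rw [torusChar_of_ne_zero χ hx]; exact Units.ne_zero _

theorem chi_borelToTorus (χ : D.T →* ℂˣ) (b : D.B) :
    ((χ.comp D.borelToTorus b : ℂˣ) : ℂ) = torusChar χ (D.mat b 1 1) := by
  obtain ⟨h0, h1⟩ := D.entries_of_mem_B b.2
  have he : D.mat b 1 1 ≠ 0 := right_ne_zero_of_mul_eq_one h0
  rw [torusChar_of_ne_zero χ he, MonoidHom.comp_apply]
  congr 2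
  apply Subtype.ext
  apply mat_injective
  change !![D.mat b 0 0, 0; 0, D.mat b 1 1] = !![(D.conj (D.mat b 1 1))⁻¹, 0; 0, D.mat b 1 1]
  rw [eq_inv_of_mul_eq_one_right h1]

theorem torusChar_one_add (χ : D.T →* ℂˣ) {r d : ℕ} (hd : r + 1 ≤ d) (hχ : D.HasDepth χ r) {x : E}
    (hx : x ∈ D.P d) : torusChar χ (1 + x) = 1 := by
  have hn : ‖1 + x‖ = 1 := norm_one_add (by omega) hx
  have h0 : 1 + x ≠ 0 := by rw [← norm_ne_zero_iff, hn]; exact one_ne_zero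
  rw [torusChar_of_ne_zero χ h0, hχ.1 _ ?_, Units.val_one]
  change ‖(D.conj (1 + x))⁻¹‖ = 1 ∧ (D.conj (1 + x))⁻¹ - 1 ∈ D.P ((r : ℤ) + 1)
  refine ⟨by rw [norm_inv, norm_conj, hn, inv_one], ?_⟩
  have h0' : D.conj (1 + x) ≠ 0 := (map_ne_zero D.conj).mpr h0
  have h1 : (D.conj (1 + x))⁻¹ - 1 = -D.conj x / D.conj (1 + x) := by
    field_simp
    rw [map_add, map_one]
    ring
  rw [h1]
  refine div_mem_P ?_ (by rw [norm_conj, hn])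
  exact (D.P _).neg_mem (conj_mem_P.mpr (P_mono (by omega) hx))

/-! ### Sections supported near the line through `(0, 1)` -/

/-- The elements `g` whose bottom row `(c, e)` satisfies `c / e ∈ 𝔭_E ^ m`. -/
def Near (m : ℤ) (g : D.G) : Prop := D.mat g 1 1 ≠ 0 ∧ D.mat g 1 0 / D.mat g 1 1 ∈ D.P m

open Classical in
/-- The function on `G` with `g ↦ μ(e) φ(c / e)` on the elements with bottom row `(c, e)` such that
`c / e ∈ 𝔭_E ^ m`. -/
def sec (χ : D.T →* ℂˣ) (m : ℤ) (φ : E → ℂ) (g : D.G) : ℂ :=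
  if Near m g then torusChar χ (D.mat g 1 1) * φ (D.mat g 1 0 / D.mat g 1 1) else 0

theorem sec_of_near {χ : D.T →* ℂˣ} {m : ℤ} {φ : E → ℂ} {g : D.G} (h : Near m g) :
    sec χ m φ g = torusChar χ (D.mat g 1 1) * φ (D.mat g 1 0 / D.mat g 1 1) := if_pos h

theorem sec_of_not_near {χ : D.T →* ℂˣ} {m : ℤ} {φ : E → ℂ} {g : D.G} (h : ¬ Near m g) :
    sec χ m φ g = 0 := if_neg h

theorem row_borel_mul (b : D.B) (g : D.G) (i : Fin 2) :
    D.mat (b * g) 1 i = D.mat b 1 1 * D.mat g 1 i := by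
  have hb : D.mat b 1 0 = 0 := b.2
  rw [mat_mul, Matrix.mul_apply, Fin.sum_univ_two, hb, zero_mul, zero_add]

theorem near_borel_mul {m : ℤ} (b : D.B) (g : D.G) : Near m ((b : D.G) * g) ↔ Near m g := by
  have he : D.mat b 1 1 ≠ 0 := right_ne_zero_of_mul_eq_one (D.entries_of_mem_B b.2).1
  rw [Near, Near, row_borel_mul, row_borel_mul, mul_div_mul_left _ _ he, mul_ne_zero_iff_left he]

theorem sec_borel_mul (χ : D.T →* ℂˣ) (m : ℤ) (φ : E → ℂ) (b : D.B) (g : D.G) :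
    sec χ m φ (b * g) = ((χ.comp D.borelToTorus b : ℂˣ) : ℂ) * sec χ m φ g := by
  have he : D.mat b 1 1 ≠ 0 := right_ne_zero_of_mul_eq_one (D.entries_of_mem_B b.2).1
  have h : Near m ((b : D.G) * g) ↔ Near m g := near_borel_mul b g
  by_cases hg : Near m g
  · rw [sec_of_near hg, sec_of_near (h.mpr hg), row_borel_mul, row_borel_mul,
      mul_div_mul_left _ _ he, chi_borelToTorus, map_mul, mul_assoc]
  · rw [sec_of_not_near hg, sec_of_not_near (mt h.mp hg), mul_zero]

/-- Right multiplication by an element close to `1` moves `c / e` only a little. -/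
theorem near_mul {m : ℤ} {k : ℕ} (hm : 0 ≤ m) (hmk : m ≤ k) (hk : 1 ≤ k) {g n : D.G}
    (hn : n ∈ D.K k) (hg : Near m g) :
    Near m (g * n) ∧ (∃ x ∈ D.P k, D.mat (g * n) 1 1 = D.mat g 1 1 * (1 + x)) ∧
      ∃ s ∈ D.P k, D.mat (g * n) 1 0 / D.mat (g * n) 1 1 = D.mat g 1 0 / D.mat g 1 1 + s := by
  obtain ⟨he, ht⟩ := hg
  obtain ⟨h00, h01, h10, h11⟩ := mem_congruenceSubgroup.mp hn
  set t := D.mat g 1 0 / D.mat g 1 1 with htdef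
  have hc : D.mat g 1 0 = t * D.mat g 1 1 := by rw [htdef]; field_simp
  have ht0 : ‖t‖ ≤ 1 := norm_le_one_of_mem_P hm ht
  have hx : t * D.mat n 0 1 + (D.mat n 1 1 - 1) ∈ D.P k :=
    (D.P k).add_mem (mul_mem_P_right ht0 h01) h11
  -- With (c, e) = e (t, 1), the bottom row of g n is e (t n₀₀ + n₁₀, t n₀₁ + n₁₁), and x is the
  -- deviation of its last factor from 1.
  set x := t * D.mat n 0 1 + (D.mat n 1 1 - 1) with hxdef
  have hx1 : ‖1 + x‖ = 1 := norm_one_add (by omega) hx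
  have hx0 : 1 + x ≠ 0 := by rw [← norm_ne_zero_iff, hx1]; exact one_ne_zero
  have e1 : D.mat (g * n) 1 1 = D.mat g 1 1 * (1 + x) := by
    rw [mat_mul, Matrix.mul_apply, Fin.sum_univ_two, hc, hxdef]
    ring
  have e0 : D.mat (g * n) 1 0 = D.mat g 1 1 * (t * D.mat n 0 0 + D.mat n 1 0) := by
    rw [mat_mul, Matrix.mul_apply, Fin.sum_univ_two, hc]
    ring
  have hs : (t * (D.mat n 0 0 - 1) + D.mat n 1 0 - t * x) / (1 + x) ∈ D.P k :=
    div_mem_P ((D.P k).sub_mem ((D.P k).add_mem (mul_mem_P_right ht0 h00) h10)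
      (mul_mem_P_right ht0 hx)) hx1
  have e2 : D.mat (g * n) 1 0 / D.mat (g * n) 1 1 =
      t + (t * (D.mat n 0 0 - 1) + D.mat n 1 0 - t * x) / (1 + x) := by
    rw [e0, e1, mul_div_mul_left _ _ he]
    field_simp
    ring
  refine ⟨⟨by rw [e1]; exact mul_ne_zero he hx0, ?_⟩, ⟨x, hx, e1⟩, ⟨_, hs, e2⟩⟩
  rw [e2]
  exact (D.P m).add_mem ht (P_mono hmk hs)

theorem sec_mul (χ : D.T →* ℂˣ) {m : ℤ} {k : ℕ} (hm : 0 ≤ m) (hmk : m ≤ k) (hk : 1 ≤ k)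
    (hχ : ∀ x ∈ D.P k, torusChar χ (1 + x) = 1) {φ : E → ℂ}
    (hφ : ∀ t ∈ D.P m, ∀ s ∈ D.P k, φ (t + s) = φ t) (g : D.G) {n : D.G} (hn : n ∈ D.K k) :
    sec χ m φ (g * n) = sec χ m φ g := by
  by_cases hg : Near m g
  · obtain ⟨h, ⟨x, hx, h1⟩, ⟨s, hs, h2⟩⟩ := near_mul hm hmk hk hn hg
    rw [sec_of_near h, sec_of_near hg, h1, ← h1, h2, hφ _ hg.2 s hs, h1, map_mul, hχ x hx, mul_one]
  · rw [sec_of_not_near hg, sec_of_not_near]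
    intro h
    have := (near_mul hm hmk hk ((D.K k).inv_mem hn) h).1
    rw [mul_inv_cancel_right] at this
    exact hg this

theorem mem_fixedBy {χ : D.T →* ℂˣ} {H : Subgroup D.G} {f : D.V χ} :
    f ∈ fixedBy (D.principalSeries χ) H ↔ ∀ g, ∀ h ∈ H, f.1 (g * h) = f.1 g := by
  constructor
  · intro hf g h hh
    exact congrFun (congrArg Subtype.val (hf ⟨h, hh⟩)) g
  · intro hf h
    exact Subtype.ext (funext fun g => hf g h h.2)

theorem mem_V_of_right_invariant {χ : D.T →* ℂˣ} {k : ℕ} {f : D.G → ℂ}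
    (h : ∀ g, ∀ n ∈ D.K k, f (g * n) = f g)
    (h' : ∀ (b : D.B) (g : D.G), f (b * g) = ((χ.comp D.borelToTorus b : ℂˣ) : ℂ) * f g) :
    f ∈ D.V χ :=
  ⟨isLocallyConstant_of_right_invariant (D.K k) (isOpen_K k) f h, h'⟩

/-- An element of `V_χ` is determined by its values on `𝒦`. -/
theorem V_ext {χ : D.T →* ℂˣ} {f f' : D.V χ} (h : ∀ k ∈ D.K 0, f.1 k = f'.1 k) : f = f' := by
  apply Subtype.ext
  funext g
  obtain ⟨b, hb, k, hk, rfl⟩ := exists_eq_mul g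
  rw [f.2.2 ⟨b, hb⟩ k, f'.2.2 ⟨b, hb⟩ k, h k hk]

theorem psi_mul_periodic {ω : E} {k : ℤ} (hω : ω ∈ D.P (1 - k)) (t : E) {s : E} (hs : s ∈ D.P k) :
    D.psi (ω * (t + s)) = D.psi (ω * t) := by
  apply psi_congr
  have : ω * (t + s) - ω * t = ω * s := by ring
  rw [this]
  exact mul_mem_P hω hs (by omega)

/-- Unitarity gives a ē = 1 - b c̄ for the entries of g. The right side is a unit, and both factors
on the left are integral. -/
theorem norm_eq_one_of_mem_K_zero {g : D.G} (hg : g ∈ D.K 0) {m : ℤ} (hm : 1 ≤ m)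
    (hc : D.mat g 1 0 ∈ D.P m) : ‖D.mat g 1 1‖ = 1 := by
  have hg' := mem_K_zero_iff.mp hg
  have h := (mat_conj_row g).1
  have h1 : D.mat g 0 0 * D.conj (D.mat g 1 1) = 1 + -(D.mat g 0 1 * D.conj (D.mat g 1 0)) := by
    linear_combination h
  have h2 : ‖D.mat g 0 0 * D.conj (D.mat g 1 1)‖ = 1 := by
    rw [h1]
    exact norm_one_add hm ((D.P m).neg_mem (mul_mem_P_right (hg' 0 1) (conj_mem_P.mpr hc)))
  rw [norm_mul, norm_conj] at h2
  refine le_antisymm (hg' 1 1) ?_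
  calc (1 : ℝ) = ‖D.mat g 0 0‖ * ‖D.mat g 1 1‖ := h2.symm
    _ ≤ 1 * ‖D.mat g 1 1‖ := mul_le_mul_of_nonneg_right (hg' 0 0) (norm_nonneg _)
    _ = _ := one_mul _

theorem near_lower_mul {m : ℤ} (hm : 1 ≤ m) {g : D.G} (hg : g ∈ D.K 0) (hc : D.mat g 1 0 ∈ D.P m)
    {s : F} (hs : ‖s‖ ≤ ‖D.unif‖ ^ m) : Near m (D.lower s * g) := by
  have he := norm_eq_one_of_mem_K_zero hg hm hc
  have hg' := mem_K_zero_iff.mp hg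
  have hy : s • D.sqrtEps ∈ D.P m := smul_sqrtEps_mem_P.mpr hs
  have h1 : ‖s • D.sqrtEps * D.mat g 0 1 + D.mat g 1 1‖ = 1 := by
    rw [add_comm]
    exact norm_add_eq_left hm he (mul_mem_P_left hy (hg' 0 1))
  rw [Near, mat_lower_mul]
  refine ⟨?_, div_mem_P ((D.P m).add_mem (mul_mem_P_left hy (hg' 0 0)) hc) h1⟩
  rw [← norm_ne_zero_iff]
  exact h1.trans_ne one_ne_zero

theorem near_mul_of_mem_K {m : ℤ} (hm : 1 ≤ m) {x g : D.G} (hg : g ∈ D.K 0)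
    (hc : D.mat g 1 0 ∈ D.P m) (hx : Near m x) : Near m (x * g) := by
  obtain ⟨b, s, rfl, hs⟩ := exists_eq_mul_lower hx.1
  rw [mul_assoc, near_borel_mul]
  exact near_lower_mul hm hg hc (smul_sqrtEps_mem_P.mp (hs ▸ hx.2))

/-- If right translation by `g` multiplies the values of a section near the line through `(0, 1)`
by a constant, then it multiplies the section by this constant. -/
theorem sec_mul_of_lower {χ : D.T →* ℂˣ} {m : ℤ} (hm : 1 ≤ m) {φ : E → ℂ} {g : D.G}
    (hg : g ∈ D.K 0) (hc : D.mat g 1 0 ∈ D.P m) (C : ℂ)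
    (h : ∀ s : F, ‖s‖ ≤ ‖D.unif‖ ^ m →
      sec χ m φ (D.lower s * g) = C * φ (s • D.sqrtEps)) (x : D.G) :
    sec χ m φ (x * g) = C * sec χ m φ x := by
  by_cases hx : Near m x
  · obtain ⟨b, s, hxs, hs⟩ := exists_eq_mul_lower hx.1
    have hs' : ‖s‖ ≤ ‖D.unif‖ ^ m := smul_sqrtEps_mem_P.mp (hs ▸ hx.2)
    have h1 : sec χ m φ (D.lower s) = φ (s • D.sqrtEps) := by
      have h2 : D.mat (D.lower s) 1 1 = 1 := rfl
      have h3 : D.mat (D.lower s) 1 0 = s • D.sqrtEps := rfl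
      rw [sec_of_near, h2, h3, map_one, one_mul, div_one]
      rw [Near, h2, h3, div_one]
      exact ⟨one_ne_zero, smul_sqrtEps_mem_P.mpr hs'⟩
    rw [hxs, mul_assoc, sec_borel_mul, sec_borel_mul, h s hs', h1]
    ring
  · rw [sec_of_not_near hx, mul_zero, sec_of_not_near]
    intro h'
    apply hx
    have h1 := near_mul_of_mem_K hm ((D.K 0).inv_mem hg) (g := g⁻¹)
      (by rw [mat_inv_entries]; exact conj_mem_P.mpr hc) h'
    rwa [mul_inv_cancel_right] at h1

/-- The translates of an exponential section by elements of `𝒦` that preserve its support. -/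
theorem sec_psi_lower_mul {χ : D.T →* ℂˣ} {j m d : ℤ} (hm : 1 ≤ m) (hjm : j ≤ m) (hmd : d + 1 ≤ 2 * m)
    {κ ω : E} (hκ : ∀ x ∈ D.P j, torusChar χ (1 + x) = D.psi (κ * x)) (hω : ω ∈ D.P (-d))
    {g : D.G} (hg : g ∈ D.K 0) (hc : D.mat g 1 0 ∈ D.P m) {s : F} (hs : ‖s‖ ≤ ‖D.unif‖ ^ m) :
    sec χ m (fun t => D.psi (ω * t)) (D.lower s * g) =
      torusChar χ (D.mat g 1 1) * D.psi (ω * (D.mat g 1 0 / D.mat g 1 1)) *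
        D.psi (s • D.sqrtEps * (κ * (D.mat g 0 1 / D.mat g 1 1) +
          ω * (D.mat g 0 0 / D.mat g 1 1))) := by
  have he := norm_eq_one_of_mem_K_zero hg hm hc
  have he0 : D.mat g 1 1 ≠ 0 := by rw [← norm_ne_zero_iff, he]; exact one_ne_zero
  have hg' := mem_K_zero_iff.mp hg
  have hy : s • D.sqrtEps ∈ D.P m := smul_sqrtEps_mem_P.mpr hs
  have e0 : D.mat (D.lower s * g) 1 0 = s • D.sqrtEps * D.mat g 0 0 + D.mat g 1 0 := by
    rw [mat_lower_mul]; rfl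
  have e1 : D.mat (D.lower s * g) 1 1 = s • D.sqrtEps * D.mat g 0 1 + D.mat g 1 1 := by
    rw [mat_lower_mul]; rfl
  generalize s • D.sqrtEps = y at hy e0 e1 ⊢
  have hx : y * (D.mat g 0 1 / D.mat g 1 1) ∈ D.P m :=
    mul_mem_P_left hy (by rw [norm_div, he, div_one]; exact hg' 0 1)
  set x := y * (D.mat g 0 1 / D.mat g 1 1) with hxdef
  have hx1 : ‖1 + x‖ = 1 := norm_one_add hm hx
  have hx0 : 1 + x ≠ 0 := by rw [← norm_ne_zero_iff, hx1]; exact one_ne_zero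
  have e1' : D.mat (D.lower s * g) 1 1 = D.mat g 1 1 * (1 + x) := by
    rw [e1, hxdef]; field_simp; ring
  have hnum : y * D.mat g 0 0 + D.mat g 1 0 ∈ D.P m :=
    (D.P m).add_mem (mul_mem_P_left hy (hg' 0 0)) hc
  have hnear : Near m (D.lower s * g) := near_lower_mul hm hg hc hs
  rw [sec_of_near hnear, e1', map_mul, hκ x (P_mono hjm hx), e0, mul_assoc, mul_assoc, ← psi_add,
    ← psi_add]
  congr 1
  apply psi_congr
  -- The exact error is ω times a product of two elements of 𝔭_E^m, up to a unit. As 2m ≥ d + 1 and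
  -- ω ∈ 𝔭_E^(-d), it lies in 𝔭_E, where ψ is trivial.
  have h : κ * x + ω * ((y * D.mat g 0 0 + D.mat g 1 0) / (D.mat g 1 1 * (1 + x))) -
      (ω * (D.mat g 1 0 / D.mat g 1 1) + y * (κ * (D.mat g 0 1 / D.mat g 1 1) +
        ω * (D.mat g 0 0 / D.mat g 1 1))) =
      -(ω * ((y * D.mat g 0 0 + D.mat g 1 0) * x / (D.mat g 1 1 * (1 + x)))) := by
    have hx2 : y * (κ * (D.mat g 0 1 / D.mat g 1 1) + ω * (D.mat g 0 0 / D.mat g 1 1)) =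
        κ * x + ω * (y * D.mat g 0 0 / D.mat g 1 1) := by rw [hxdef]; ring
    rw [hx2]
    clear_value x
    field_simp
    ring
  rw [h]
  refine (D.P 1).neg_mem (mul_mem_P (l := d + 1) hω (div_mem_P (mul_mem_P hnum hx (by omega)) ?_)
    (by omega))
  rw [norm_mul, he, hx1, one_mul]

end UnramifiedDatum

namespace UnramifiedDatum

variable {F E : Type*} [NontriviallyNormedField F] [IsUltrametricDist F] [ProperSpace F]
  [NormedField E] [IsUltrametricDist E] [NormedAlgebra F E] [Algebra.IsQuadraticExtension F E]
  {D : UnramifiedDatum F E}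

/-! ### Square roots and norms -/

/-- The equation (1 + x)² = w is the fixed point equation x = (w - 1 - x²)/2. On the ball of radius
r = |ϖ|^j < 1 the right side contracts by the factor r, because 2 is a unit. -/
theorem exists_sqrt (D : UnramifiedDatum F E) {j : ℤ} (hj : 1 ≤ j) {w : F}
    (hw : ‖w - 1‖ ≤ ‖D.unif‖ ^ j) : ∃ δ : F, ‖δ - 1‖ ≤ ‖D.unif‖ ^ j ∧ δ ^ 2 = w := by
  set r : ℝ := ‖D.unif‖ ^ j with hr
  have hr0 : 0 < r := D.norm_unif_zpow_pos j
  have hr1 : r < 1 := by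
    rw [hr]
    exact (zpow_le_zpow_right_of_le_one₀ D.norm_unif_pos D.norm_unif_lt_one.le hj).trans_lt
      (by rw [zpow_one]; exact D.norm_unif_lt_one)
  let S := Metric.closedBall (0 : F) r
  have hT : ∀ x : S, (w - 1 - (x : F) ^ 2) / 2 ∈ S := by
    intro x
    have hx : ‖(x : F)‖ ≤ r := mem_closedBall_zero_iff.mp x.2
    rw [mem_closedBall_zero_iff, norm_div, D.norm_two, div_one, sub_eq_add_neg]
    refine (IsUltrametricDist.norm_add_le_max _ _).trans (max_le hw ?_)
    rw [norm_neg, norm_pow, sq]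
    exact (mul_le_mul hx (hx.trans hr1.le) (norm_nonneg _) hr0.le).trans (by rw [mul_one])
  let T : S → S := fun x => ⟨_, hT x⟩
  have hc : ContractingWith (Real.toNNReal r) T := by
    refine ⟨Real.toNNReal_lt_one.mpr hr1, LipschitzWith.of_dist_le_mul fun x y => ?_⟩
    have hx : ‖(x : F)‖ ≤ r := mem_closedBall_zero_iff.mp x.2
    have hy : ‖(y : F)‖ ≤ r := mem_closedBall_zero_iff.mp y.2
    rw [Subtype.dist_eq, Subtype.dist_eq, dist_eq_norm, dist_eq_norm, Real.coe_toNNReal r hr0.le]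
    have h2 := D.two_ne_zero_F
    have h : (T x : F) - T y = (-((x : F) + y) * (x - y)) / 2 := by
      change (w - 1 - (x : F) ^ 2) / 2 - (w - 1 - (y : F) ^ 2) / 2 = _
      ring
    rw [h, norm_div, D.norm_two, div_one, norm_mul, norm_neg]
    exact mul_le_mul_of_nonneg_right
      ((IsUltrametricDist.norm_add_le_max _ _).trans (max_le hx hy)) (norm_nonneg _)
  have : CompleteSpace S := Metric.isClosed_closedBall.completeSpace_coe
  have : Nonempty S := ⟨⟨0, by simp [S, hr0.le]⟩⟩
  obtain ⟨x, hx⟩ : ∃ x : S, T x = x := ⟨_, hc.fixedPoint_isFixedPt⟩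
  refine ⟨1 + x, by rw [add_sub_cancel_left]; exact mem_closedBall_zero_iff.mp x.2, ?_⟩
  have hx' : (w - 1 - (x : F) ^ 2) / 2 = x := congrArg Subtype.val hx
  have h2 := D.two_ne_zero_F
  field_simp at hx'
  linear_combination -hx'

/-- The residue field is finite of odd order, and there the sets of values of x² and of n + εy² are
too large to be disjoint. -/
theorem exists_residue_quadratic (D : UnramifiedDatum F E) {n : F} (hn : ‖n‖ = 1) :
    ∃ a b : F, ‖a ^ 2 - D.eps * b ^ 2 - n‖ < 1 := by
  let R := (NormedField.valuation (K := F)).valuationSubring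
  let k := IsLocalRing.ResidueField R
  have hmem : ∀ x : F, x ∈ R ↔ ‖x‖ ≤ 1 := fun x => by
    rw [Valuation.mem_valuationSubring_iff, NormedField.valuation_apply, ← NNReal.coe_le_coe]
    simp
  have hres : ∀ x : R, IsLocalRing.residue R x = 0 ↔ ‖(x : F)‖ < 1 := by
    intro x
    rw [IsLocalRing.residue_eq_zero_iff]
    have h := Valuation.mem_maximalIdeal_iff (v := NormedField.valuation (K := F)) (a := x)
    rw [NormedField.valuation_apply, ← NNReal.coe_lt_coe] at h
    simpa using h
  have : Finite k := by
    obtain ⟨t, ht, hc⟩ := exists_finite_cover D 1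
    have := ht.to_subtype
    have hs : Function.Surjective (IsLocalRing.residue R) := IsLocalRing.residue_surjective
    choose l hl using hs
    have hc' : ∀ x : k, ∃ y : t, algebraMap F E (l x : F) - y ∈ D.P 1 := fun x => by
      obtain ⟨y, hy, h⟩ := hc (algebraMap F E (l x : F))
        (mem_P_zero.mpr (by rw [norm_algebraMap']; exact (hmem _).mp (l x).2))
      exact ⟨⟨y, hy⟩, h⟩
    choose φ hφ using hc'
    refine Finite.of_injective φ fun x y hxy => ?_
    have h := (D.P 1).sub_mem (hφ x) (hφ y)
    rw [hxy, sub_sub_sub_cancel_right, ← map_sub, algebraMap_mem_P, zpow_one] at h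
    have h' := (hres (l x - l y)).mpr (h.trans_lt D.norm_unif_lt_one)
    rw [map_sub, hl, hl, sub_eq_zero] at h'
    exact h'
  have := Fintype.ofFinite k
  let ε : R := ⟨D.eps, (hmem _).mpr D.norm_eps.le⟩
  let n' : R := ⟨n, (hmem _).mpr hn.le⟩
  have hε : IsLocalRing.residue R ε ≠ 0 := by
    rw [Ne, hres, not_lt]; exact D.norm_eps.ge
  have h2 : ringChar k ≠ 2 := by
    intro h
    have h0 : ((2 : ℕ) : k) = 0 := h ▸ ringChar.Nat.cast_ringChar
    have h1 : IsLocalRing.residue R 2 = 0 := by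
      rw [← h0, Nat.cast_ofNat, map_ofNat]
    rw [hres] at h1
    have : ((2 : R) : F) = 2 := rfl
    rw [this, D.norm_two] at h1
    exact lt_irrefl _ h1
  obtain ⟨a, b, hab⟩ := FiniteField.exists_root_sum_quadratic
    (f := (Polynomial.X ^ 2 : Polynomial k))
    (g := Polynomial.C (-(IsLocalRing.residue R ε)) * Polynomial.X ^ 2 +
      Polynomial.C 0 * Polynomial.X + Polynomial.C (-(IsLocalRing.residue R n')))
    (Polynomial.degree_X_pow 2)
    (Polynomial.degree_quadratic (neg_ne_zero.mpr hε)) (FiniteField.odd_card_of_char_ne_two h2)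
  obtain ⟨a, rfl⟩ := IsLocalRing.residue_surjective a
  obtain ⟨b, rfl⟩ := IsLocalRing.residue_surjective b
  refine ⟨a, b, (hres (a ^ 2 - ε * b ^ 2 - n')).mp ?_⟩
  simp only [Polynomial.eval_add, Polynomial.eval_mul, Polynomial.eval_pow, Polynomial.eval_X,
    Polynomial.eval_C] at hab
  rw [map_sub, map_sub, map_mul, map_pow, map_pow]
  linear_combination hab

/-- Every unit of `F` is a norm from `E`. -/
theorem exists_norm_eq (D : UnramifiedDatum F E) {n : F} (hn : ‖n‖ = 1) :
    ∃ x : E, x * D.conj x = algebraMap F E n := by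
  obtain ⟨a, b, hab⟩ := exists_residue_quadratic D hn
  have hn0 : n ≠ 0 := by rw [← norm_ne_zero_iff, hn]; exact one_ne_zero
  -- The approximate solution is off by a factor in 1 + 𝔭_F, which is a square δ². Dividing a + b√ε
  -- by δ corrects its norm to n.
  obtain ⟨δ, hδ, hδ'⟩ := exists_sqrt D (j := 1) le_rfl (w := (a ^ 2 - D.eps * b ^ 2) / n) (by
    have h : (a ^ 2 - D.eps * b ^ 2) / n - 1 = (a ^ 2 - D.eps * b ^ 2 - n) / n := by
      field_simp
    rw [h, norm_div, hn, div_one, zpow_one]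
    exact D.norm_le_norm_unif _ hab)
  have hδ0 : δ ≠ 0 := by
    rintro rfl
    rw [zero_sub, norm_neg, norm_one, zpow_one] at hδ
    exact absurd D.norm_unif_lt_one (not_lt.mpr hδ)
  have hδE : algebraMap F E δ ≠ 0 := by simpa using hδ0
  refine ⟨(algebraMap F E a + b • D.sqrtEps) / algebraMap F E δ, ?_⟩
  rw [map_div₀, map_add, conj_smul_sqrtEps, conj_algebraMap, conj_algebraMap, Algebra.smul_def,
    div_mul_div_comm, div_eq_iff (mul_ne_zero hδE hδE)]
  have h1 : n * δ ^ 2 = a ^ 2 - D.eps * b ^ 2 := by rw [hδ']; field_simp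
  have h2 := congrArg (algebraMap F E) h1
  simp only [map_mul, map_sub, map_pow] at h2
  linear_combination -h2 - (algebraMap F E b) ^ 2 * D.sqrtEps_sq

/-! ### The linearisation of a character of `1 + 𝔭_E ^ j` -/

theorem finite_quotient_P (D : UnramifiedDatum F E) {j d : ℤ} (hj : 0 ≤ j) :
    Finite (D.P j ⧸ (D.P d).addSubgroupOf (D.P j)) := by
  obtain ⟨t, ht, hc⟩ := exists_finite_cover D d
  have := ht.to_subtype
  have hc' : ∀ x : D.P j, ∃ y : t, (x : E) - y ∈ D.P d := fun x => by
    obtain ⟨y, hy, h⟩ := hc x (P_mono hj x.2)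
    exact ⟨⟨y, hy⟩, h⟩
  choose φ hφ using hc'
  refine Finite.of_injective
    (fun q : D.P j ⧸ (D.P d).addSubgroupOf (D.P j) => φ q.out) fun q q' h => ?_
  rw [← QuotientAddGroup.out_eq' q, ← QuotientAddGroup.out_eq' q']
  refine QuotientAddGroup.eq.mpr ?_
  rw [AddSubgroup.mem_addSubgroupOf]
  have h1 := (D.P d).sub_mem (hφ q'.out) (hφ q.out)
  have h2 : φ q.out = φ q'.out := h
  rw [h2, sub_sub_sub_cancel_right] at h1
  rwa [AddSubgroup.coe_add, AddSubgroup.coe_neg, neg_add_eq_sub]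

/-- Descent of an additive character to a quotient. -/
theorem exists_addChar_quotient {A : Type*} [AddCommGroup A] (B : AddSubgroup A) (θ : A → ℂ)
    (h0 : θ 0 = 1) (hadd : ∀ x y, θ (x + y) = θ x * θ y) (hB : ∀ b ∈ B, θ b = 1) :
    ∃ θ' : AddChar (A ⧸ B) ℂ, ∀ x : A, θ' (x : A ⧸ B) = θ x := by
  have hout : ∀ x : A, θ (Quotient.out (x : A ⧸ B)) = θ x := by
    intro x
    have h1 := hB _ (QuotientAddGroup.eq.mp (QuotientAddGroup.out_eq' (x : A ⧸ B)))
    have h2 := hadd (Quotient.out (x : A ⧸ B)) (-(Quotient.out (x : A ⧸ B)) + x)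
    rw [add_neg_cancel_left, h1, mul_one] at h2
    exact h2.symm
  refine ⟨⟨fun q => θ q.out, by rw [← QuotientAddGroup.mk_zero B, hout, h0], fun q q' => ?_⟩, hout⟩
  conv_lhs => rw [← QuotientAddGroup.out_eq' q, ← QuotientAddGroup.out_eq' q',
    ← QuotientAddGroup.mk_add, hout, hadd]

/-- Since 2j ≥ d, the map x ↦ μ(1 + x) is an additive character of the finite group 𝔭_E^j/𝔭_E^d, and
ψ identifies this group with its dual. -/
theorem exists_linearisation (χ : D.T →* ℂˣ) {j d : ℤ} (hj : 1 ≤ j) (hd : d ≤ 2 * j)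
    (hχ : ∀ x ∈ D.P d, torusChar χ (1 + x) = 1) :
    ∃ κ ∈ D.P (1 - d), ∀ x ∈ D.P j, torusChar χ (1 + x) = D.psi (κ * x) := by
  let B := (D.P d).addSubgroupOf (D.P j)
  have : Finite (D.P j ⧸ B) := finite_quotient_P D (by omega)
  have := Fintype.ofFinite (D.P j ⧸ B)
  -- This exponent makes c 𝔭_E^j = 𝔭_E^(1-d) the annihilator of 𝔭_E^d and c 𝔭_E^d = 𝔭_E^(1-j) that
  -- of 𝔭_E^j, so a ↦ ψ(c a x) is well defined and injective on the quotient.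
  set c : E := algebraMap F E D.unif ^ (1 - d - j) with hc
  have hcn : ‖c‖ = ‖D.unif‖ ^ (1 - d - j) := by rw [hc, norm_zpow, norm_algebraMap']
  have hcP : c ∈ D.P (1 - d - j) := hcn.le
  have hex : ∀ a : D.P j, ∃ θ : AddChar (D.P j ⧸ B) ℂ, ∀ x : D.P j,
      θ (x : D.P j ⧸ B) = D.psi (c * a * x) := fun a =>
    exists_addChar_quotient B (fun x : D.P j => D.psi (c * a * x)) (by simp [psi_zero])
      (fun x y => by rw [← psi_add, ← mul_add]; rfl)
      (fun b hb => psi_eq_one (mul_mem_P (mul_mem_P hcP a.2 le_rfl)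
        (AddSubgroup.mem_addSubgroupOf.mp hb) (by omega)))
  choose Θ hΘ using hex
  have hinj : Function.Injective fun q : D.P j ⧸ B => Θ q.out := by
    intro q q' h
    rw [← QuotientAddGroup.out_eq' q, ← QuotientAddGroup.out_eq' q']
    refine QuotientAddGroup.eq.mpr ?_
    refine AddSubgroup.mem_addSubgroupOf.mpr ?_
    rw [AddSubgroup.coe_add, AddSubgroup.coe_neg]
    have h1 : c * (-(q.out : D.P j) + (q'.out : D.P j) : E) ∈ D.P (1 - j) := by
      refine mem_P_of_psi fun y hy => ?_
      have h2 := hΘ q.out ⟨y, hy⟩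
      have h3 := hΘ q'.out ⟨y, hy⟩
      have h4 : Θ q.out = Θ q'.out := h
      rw [h4, h3] at h2
      have h5 : y * (c * (-(q.out : D.P j) + (q'.out : D.P j) : E)) =
        -(c * (q.out : D.P j) * y) + c * (q'.out : D.P j) * y := by ring
      rw [h5, psi_add]
      simp only at h2
      rw [h2, psi_neg_mul]
    rw [mem_P, norm_mul, hcn] at h1
    have h6 := D.norm_unif_zpow_pos (1 - d - j)
    have h7 : ‖D.unif‖ ^ (1 - j) = ‖D.unif‖ ^ (1 - d - j) * ‖D.unif‖ ^ d := by
      rw [← zpow_add₀ D.norm_unif_pos.ne']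
      congr 1
      ring
    rw [h7] at h1
    exact le_of_mul_le_mul_left h1 h6
  -- A finite abelian group and its dual have the same order, so injectivity is enough.
  have hbij := hinj.bijective_of_nat_card_le (by
    rw [Nat.card_eq_fintype_card, Nat.card_eq_fintype_card, AddChar.card_eq])
  have hone : ∀ x ∈ D.P j, 1 + x ≠ 0 := fun x hx => by
    rw [← norm_ne_zero_iff, norm_one_add hj hx]; exact one_ne_zero
  obtain ⟨θ, hθ⟩ := exists_addChar_quotient B (fun x : D.P j => torusChar χ (1 + x)) (by simp)
    (fun x y => by
      -- The last factor lies in 1 + 𝔭_E^(2j), which is contained in 1 + 𝔭_E^d, so μ does not see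
      -- it.
      have h1 : (1 + ((x + y : D.P j) : E)) = (1 + x) * (1 + y) *
          (1 + -(x * y / ((1 + x) * (1 + y)))) := by
        have hx := hone x x.2
        have hy := hone y y.2
        field_simp
        rw [AddSubgroup.coe_add]
        ring
      rw [h1, map_mul, map_mul, hχ _ ((D.P d).neg_mem (div_mem_P (mul_mem_P x.2 y.2 (by omega)) (by
        rw [norm_mul, norm_one_add hj x.2, norm_one_add hj y.2, one_mul]))), mul_one])
    (fun b hb => hχ _ (AddSubgroup.mem_addSubgroupOf.mp hb))
  obtain ⟨q, hq⟩ := hbij.2 θ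
  refine ⟨c * (q.out : D.P j), mul_mem_P hcP (q.out : D.P j).2 (by omega), fun x hx => ?_⟩
  have h1 := hΘ q.out ⟨x, hx⟩
  have h2 := hθ ⟨x, hx⟩
  have hq' : Θ q.out = θ := hq
  rw [hq', h2] at h1
  exact h1

end UnramifiedDatum

namespace UnramifiedDatum

variable {F E : Type*} [NontriviallyNormedField F] [IsUltrametricDist F] [ProperSpace F]
  [NormedField E] [IsUltrametricDist E] [NormedAlgebra F E] [Algebra.IsQuadraticExtension F E]
  {D : UnramifiedDatum F E}

/-! ### The element of the Lie algebra attached to a character -/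

/-- On `1 + 𝔭_E ^ ⌈d/2⌉` the character `e ↦ χ(diag(ē⁻¹, e))` is given by
`1 + x ↦ ψ(2 (u√ε · τ√ε + z√ε) x)`, and it is trivial on `1 + 𝔭_E ^ d`. -/
structure Linearised (χ : D.T →* ℂˣ) (d : ℕ) (u z τ : F) : Prop where
  one_le : 1 ≤ d
  trivial : ∀ x ∈ D.P d, torusChar χ (1 + x) = 1
  norm_u : ‖u‖ = ‖D.unif‖ ^ (-(d : ℤ))
  norm_z : z • D.sqrtEps ∈ D.P (1 - d)
  norm_τ : τ • D.sqrtEps ∈ D.P 1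
  linear : ∀ x ∈ D.P ((d + 1) / 2 : ℕ), torusChar χ (1 + x) =
    D.psi (2 * (u • D.sqrtEps * (τ • D.sqrtEps) + z • D.sqrtEps) * x)

theorem exists_linearised (χ : D.T →* ℂˣ) {d : ℕ} (hd : 1 ≤ d)
    (hχ : ∀ x ∈ D.P d, torusChar χ (1 + x) = 1) : ∃ u z τ : F, Linearised χ d u z τ := by
  obtain ⟨κ, hκ, h⟩ := exists_linearisation χ (j := ((d + 1) / 2 : ℕ)) (d := d) (by omega)
    (by omega) hχ
  obtain ⟨a, b, hab⟩ := D.exists_eq_add_smul κ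
  have ha : ‖a‖ ≤ ‖D.unif‖ ^ (1 - (d : ℤ)) := by
    rw [mem_P, hab] at hκ; exact (norm_left_le a b).trans hκ
  have hb : ‖b‖ ≤ ‖D.unif‖ ^ (1 - (d : ℤ)) := by
    rw [mem_P, hab] at hκ; exact (norm_right_le a b).trans hκ
  have hϖ := D.unif_ne_zero
  have h2 := D.two_ne_zero_F
  have hε := D.eps_ne_zero
  have hu : D.unif ^ (-(d : ℤ)) ≠ 0 := zpow_ne_zero _ hϖ
  -- Matching κ = a + b√ε with 2(uτε + z√ε) forces z = b/2 and τ = a/(2εu). Since |a| ≤ |ϖ|^(1-d),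
  -- the choice |u| = |ϖ|^(-d) puts τ in 𝔭_F.
  refine ⟨D.unif ^ (-(d : ℤ)), b / 2, a / (2 * D.eps * D.unif ^ (-(d : ℤ))),
    ⟨hd, hχ, norm_zpow _ _, ?_, ?_, ?_⟩⟩
  · rw [smul_sqrtEps_mem_P, norm_div, D.norm_two, div_one]
    exact hb
  · rw [smul_sqrtEps_mem_P, norm_div, norm_mul, norm_mul, D.norm_two, D.norm_eps, norm_zpow,
      one_mul, one_mul, div_le_iff₀ (D.norm_unif_zpow_pos _), ← zpow_add₀ D.norm_unif_pos.ne',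
      ← sub_eq_add_neg]
    exact ha
  · intro x hx
    rw [h x hx]
    congr 2
    have h3 : algebraMap F E a = 2 * (D.unif ^ (-(d : ℤ)) • D.sqrtEps *
        ((a / (2 * D.eps * D.unif ^ (-(d : ℤ)))) • D.sqrtEps)) := by
      rw [smul_mul_smul_comm, ← sq, D.sqrtEps_sq, Algebra.smul_def, ← map_mul,
        ← map_ofNat (algebraMap F E), ← map_mul]
      congr 1
      field_simp
    have h4 : b • D.sqrtEps = 2 * ((b / 2) • D.sqrtEps) := by
      rw [two_mul, ← add_smul, ← add_div, ← two_mul, mul_div_cancel_left₀ _ h2]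
    rw [hab, mul_add, ← h3, ← h4]

/-! ### The eigenvector of T(X) 𝒥_d -/

namespace Linearised

variable {χ : D.T →* ℂˣ} {d : ℕ} {u z τ : F} (hl : Linearised χ d u z τ)

/-- The matrix `(z√ε, u√ε; v√ε, z√ε)` with `v = u ε τ²`. -/
def shalika (D : UnramifiedDatum F E) (u z τ : F) : Matrix (Fin 2) (Fin 2) E :=
  !![z • D.sqrtEps, u • D.sqrtEps; (u * D.eps * τ ^ 2) • D.sqrtEps, z • D.sqrtEps]

/-- The vector of `V_χ` supported on the translate by `(1, 0; -τ√ε, 1)` of a small neighbourhood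
of the line through `(0, 1)`, and given there by an exponential function. -/
def vec (χ : D.T →* ℂˣ) (d : ℕ) (u : F) : D.G → ℂ :=
  sec χ ((d + 2) / 2 : ℕ) fun t => D.psi (u • D.sqrtEps * t)

/-- With U, Z, T for the multiples of √ε by u, z, τ, the matrix is X = (Z, U; UT², Z). The row (T,
1) is an eigenvector of X with eigenvalue UT + Z, half the coefficient κ of the linearised
character. -/
theorem shalika_coeff (D : UnramifiedDatum F E) (u τ : F) : (u * D.eps * τ ^ 2) • D.sqrtEps =
    u • D.sqrtEps * (τ • D.sqrtEps) ^ 2 := by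
  rw [smul_pow, D.sqrtEps_sq]
  simp only [Algebra.smul_def, map_mul, map_pow]
  ring

theorem vec_mul_of_lower (hd : 1 ≤ d) {g : D.G} (hg : g ∈ D.K 0)
    (hc : D.mat g 1 0 ∈ D.P ((d + 2) / 2 : ℕ)) (C : ℂ)
    (h : ∀ s : F, ‖s‖ ≤ ‖D.unif‖ ^ (((d + 2) / 2 : ℕ) : ℤ) →
      vec χ d u (D.lower s * g) = C * D.psi (u • D.sqrtEps * (s • D.sqrtEps))) (x : D.G) :
    vec χ d u (x * g) = C * vec χ d u x :=
  sec_mul_of_lower (by omega) hg hc C h x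

include hl

theorem mem_P_u : u • D.sqrtEps ∈ D.P (-(d : ℤ)) := by
  rw [smul_sqrtEps_mem_P, hl.norm_u]

theorem u_ne_zero : u ≠ 0 := by
  rw [← norm_pos_iff, hl.norm_u]; exact D.norm_unif_zpow_pos _

theorem coeff_mem : 2 * (u • D.sqrtEps * (τ • D.sqrtEps) + z • D.sqrtEps) ∈ D.P (1 - d) :=
  mul_mem_P_right D.norm_two_E.le
    ((D.P _).add_mem (mul_mem_P hl.mem_P_u hl.norm_τ (by omega)) hl.norm_z)

theorem norm_τ_le : ‖τ‖ ≤ 1 := by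
  rw [← norm_smul_sqrtEps (D := D)]
  exact norm_le_one_of_mem_P zero_le_one hl.norm_τ

theorem lower_mem : D.lower τ ∈ D.K 0 := lower_mem_K_zero.mpr hl.norm_τ_le

theorem isShalikaElement : D.IsShalikaElement d (shalika D u z τ) := by
  refine ⟨z, u, u * D.eps * τ ^ 2, ?_, hl.norm_u, ?_, rfl⟩
  · exact smul_sqrtEps_mem_P.mp (P_mono (by omega) hl.norm_z)
  · have hτ : ‖τ‖ < 1 := by
      rw [← norm_smul_sqrtEps (D := D)]
      exact norm_lt_one_of_mem_P le_rfl hl.norm_τ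
    rw [norm_mul, norm_mul, D.norm_eps, mul_one, norm_pow]
    have hu : 0 < ‖u‖ := norm_pos_iff.mpr hl.u_ne_zero
    exact mul_lt_of_lt_one_right hu (pow_lt_one₀ (norm_nonneg _) hτ two_ne_zero)

theorem shalika_mem : shalika D u z τ ∈ D.lieFilt (-(d : ℤ)) := by
  obtain ⟨z', u', v', hz, hu, hv, he⟩ := hl.isShalikaElement
  rw [he]
  refine ⟨?_, ?_⟩
  · ext i j
    fin_cases i <;> fin_cases j <;>
      simp [conjTr, w, Matrix.mul_apply, Fin.sum_univ_two, conj_sqrtEps]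
  · have h : ∀ x : F, ‖x‖ ≤ ‖D.unif‖ ^ (-(d : ℤ)) → x • D.sqrtEps ∈ D.pE (-(d : ℤ)) :=
      fun x hx => smul_sqrtEps_mem_P.mpr hx
    intro i j
    fin_cases i <;> fin_cases j
    · exact h _ hz
    · exact h _ hu.le
    · exact h _ (hv.le.trans hu.le)
    · exact h _ hz

theorem vec_lower_mul {g : D.G} (hg : g ∈ D.K 0) (hc : D.mat g 1 0 ∈ D.P ((d + 2) / 2 : ℕ)) {s : F}
    (hs : ‖s‖ ≤ ‖D.unif‖ ^ (((d + 2) / 2 : ℕ) : ℤ)) :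
    vec χ d u (D.lower s * g) = torusChar χ (D.mat g 1 1) *
      D.psi (u • D.sqrtEps * (D.mat g 1 0 / D.mat g 1 1)) *
        D.psi (s • D.sqrtEps * (2 * (u • D.sqrtEps * (τ • D.sqrtEps) + z • D.sqrtEps) *
          (D.mat g 0 1 / D.mat g 1 1) + u • D.sqrtEps * (D.mat g 0 0 / D.mat g 1 1))) := by
  have hd := hl.one_le
  exact sec_psi_lower_mul (d := d) (by omega) (by omega) (by omega) hl.linear hl.mem_P_u hg hc hs

theorem vec_lower {s : F} (hs : ‖s‖ ≤ ‖D.unif‖ ^ (((d + 2) / 2 : ℕ) : ℤ)) :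
    vec χ d u (D.lower s) = D.psi (u • D.sqrtEps * (s • D.sqrtEps)) := by
  have h := hl.vec_lower_mul (g := 1) (D.K 0).one_mem
    (by rw [mat_one]; exact (D.P _).zero_mem) hs
  rw [mul_one, mat_one] at h
  simpa [psi_zero, mul_comm] using h

/-- `𝒥_d` acts by `Ψ_X` on the translate of `vec`. -/
theorem vec_J {k : D.G} (hk : k ∈ D.J d) (x : D.G) :
    vec χ d u (x * (D.lower τ * k * D.lower (-τ))) =
      D.Psi (shalika D u z τ) k * vec χ d u x := by
  have hd := hl.one_le
  obtain ⟨h00, h01, h10, h11⟩ := mem_congruenceSubgroup.mp hk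
  set g := D.lower τ * k * D.lower (-τ) with hgdef
  have hg : g ∈ D.K 0 := by
    rw [hgdef, lower_neg]
    exact conj_mem_K hl.lower_mem (J_le_K_zero d hk)
  have hmat := mat_lower_conj τ k
  rw [← hgdef] at hmat
  obtain ⟨hrow1, hrow2, -⟩ := mat_conj_row k
  have hu := hl.mem_P_u
  have hz := hl.norm_z
  have hτ := hl.norm_τ
  have huc := D.conj_smul_sqrtEps u
  have hzc := D.conj_smul_sqrtEps z
  have hτc := D.conj_smul_sqrtEps τ
  have hlin := hl.linear
  have hκ := hl.coeff_mem
  have hvec := fun (hc : D.mat g 1 0 ∈ D.P ((d + 2) / 2 : ℕ)) s hs => hl.vec_lower_mul hg hc (s := s) hs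
  have key := fun hc C => vec_mul_of_lower (χ := χ) (u := u) hd hg hc C
  have hΨ : D.Psi (shalika D u z τ) k = D.psi (z • D.sqrtEps * (D.mat k 0 0 - 1) +
      u • D.sqrtEps * D.mat k 1 0 + (u • D.sqrtEps * (τ • D.sqrtEps) ^ 2 * D.mat k 0 1 +
        z • D.sqrtEps * (D.mat k 1 1 - 1))) := by
    rw [Psi, shalika, shalika_coeff, Matrix.trace_fin_two, Matrix.mul_apply, Matrix.mul_apply,
      Fin.sum_univ_two, Fin.sum_univ_two]
    simp
  rw [hΨ]
  generalize u • D.sqrtEps = U at *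
  generalize z • D.sqrtEps = Z at *
  generalize τ • D.sqrtEps = T at *
  have e00 : D.mat g 0 0 = D.mat k 0 0 - T * D.mat k 0 1 := by rw [hmat]; rfl
  have e01 : D.mat g 0 1 = D.mat k 0 1 := by rw [hmat]; rfl
  have e10 : D.mat g 1 0 = T * (D.mat k 0 0 - D.mat k 1 1) + D.mat k 1 0 - T ^ 2 * D.mat k 0 1 := by
    rw [hmat]; rfl
  have e11 : D.mat g 1 1 = T * D.mat k 0 1 + D.mat k 1 1 := by rw [hmat]; rfl
  generalize D.mat k 0 0 = a at *
  generalize D.mat k 0 1 = b at *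
  generalize D.mat k 1 0 = c at *
  generalize D.mat k 1 1 = e at *
  have hTb : T * b ∈ D.P (((d + 1) / 2 : ℕ) + 1) := mul_mem_P hτ h01 (by omega)
  have hae : a - e ∈ D.P ((d + 1) / 2 : ℕ) := by
    have := (D.P _).sub_mem h00 h11
    rwa [sub_sub_sub_cancel_right] at this
  have hc' : D.mat g 1 0 ∈ D.P ((d + 2) / 2 : ℕ) := by
    rw [e10]
    refine (D.P _).sub_mem ((D.P _).add_mem (mul_mem_P hτ hae (by omega)) h10) ?_
    rw [sq, mul_assoc]
    exact mul_mem_P hτ hTb (by omega)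
  have he' : D.mat g 1 1 - 1 ∈ D.P ((d + 1) / 2 : ℕ) := by
    rw [e11, add_sub_assoc]
    exact (D.P _).add_mem (P_mono (by omega) hTb) h11
  have hae' : D.mat g 0 0 - D.mat g 1 1 ∈ D.P ((d + 1) / 2 : ℕ) := by
    have h : D.mat g 0 0 - D.mat g 1 1 = (a - e) - 2 * (T * b) := by rw [e00, e11]; ring
    rw [h]
    exact (D.P _).sub_mem hae (mul_mem_P_right D.norm_two_E.le (P_mono (by omega) hTb))
  have hn : ‖D.mat g 1 1‖ = 1 := norm_eq_one_of_sub (by omega) he'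
  have hn0 : D.mat g 1 1 ≠ 0 := by rw [← norm_ne_zero_iff, hn]; exact one_ne_zero
  -- The linear relations of the Lie algebra hold for k - 1 modulo 𝔭_E^d: the quadratic terms in the
  -- unitarity relations are products of two elements of 𝔭_E^⌈d/2⌉.
  have hδ : (a - 1) + (D.conj e - 1) ∈ D.P d := by
    have h : (a - 1) + (D.conj e - 1) = -((a - 1) * D.conj (e - 1)) - b * D.conj c := by
      rw [map_sub, map_one]
      linear_combination hrow1
    rw [h]
    exact (D.P _).sub_mem ((D.P _).neg_mem (mul_mem_P h00 (conj_mem_P.mpr h11) (by omega)))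
      (mul_mem_P h01 (conj_mem_P.mpr h10) (by omega))
  have hbb : b + D.conj b ∈ D.P d := by
    have h : b + D.conj b = -((a - 1) * D.conj b + b * D.conj (a - 1)) := by
      rw [map_sub, map_one]
      linear_combination hrow2
    rw [h]
    exact (D.P _).neg_mem ((D.P _).add_mem (mul_mem_P h00 (conj_mem_P.mpr h01) (by omega))
      (mul_mem_P h01 (conj_mem_P.mpr h00) (by omega)))
  refine key hc' _ (fun s hs => ?_) x
  rw [hvec hc' s hs]
  have hy : s • D.sqrtEps ∈ D.P ((d + 2) / 2 : ℕ) := smul_sqrtEps_mem_P.mpr hs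
  generalize s • D.sqrtEps = Y at *
  have hμ : torusChar χ (D.mat g 1 1) = D.psi (2 * (U * T + Z) * (D.mat g 1 1 - 1)) := by
    rw [← hlin _ he', add_sub_cancel]
  rw [hμ, ← psi_add, ← psi_add, ← psi_add]
  apply psi_eq_of_sub
  -- The exponent splits into a linear part and a remainder. Each term of the remainder has a factor
  -- in 𝔭_E^⌈d/2⌉ and one in 𝔭_E^⌈(d+1)/2⌉, whose product in 𝔭_E^(d+1) offsets a coefficient in
  -- 𝔭_E^(-d).
  have hsplit : 2 * (U * T + Z) * (D.mat g 1 1 - 1) + U * (D.mat g 1 0 / D.mat g 1 1) +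
      Y * (2 * (U * T + Z) * (D.mat g 0 1 / D.mat g 1 1) + U * (D.mat g 0 0 / D.mat g 1 1)) -
      (Z * (a - 1) + U * c + (U * T ^ 2 * b + Z * (e - 1)) + U * Y) =
      (2 * (U * T + Z) * (D.mat g 1 1 - 1) + U * D.mat g 1 0 -
        (Z * (a - 1) + U * c + (U * T ^ 2 * b + Z * (e - 1)))) +
      (-(U * (D.mat g 1 0 * (D.mat g 1 1 - 1) / D.mat g 1 1)) +
        (2 * (U * T + Z) * (Y * D.mat g 0 1 / D.mat g 1 1) +
          U * (Y * (D.mat g 0 0 - D.mat g 1 1) / D.mat g 1 1))) := by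
    field_simp
    ring
  rw [hsplit, psi_add]
  have hsmall : D.psi (-(U * (D.mat g 1 0 * (D.mat g 1 1 - 1) / D.mat g 1 1)) +
        (2 * (U * T + Z) * (Y * D.mat g 0 1 / D.mat g 1 1) +
          U * (Y * (D.mat g 0 0 - D.mat g 1 1) / D.mat g 1 1))) = 1 := by
    apply psi_eq_one
    rw [e01]
    refine (D.P 1).add_mem ((D.P 1).neg_mem ?_) ((D.P 1).add_mem ?_ ?_)
    · exact mul_mem_P (l := d + 1) hu (div_mem_P (mul_mem_P hc' he' (by omega)) hn) (by omega)
    · exact mul_mem_P (l := d + 1) hκ (div_mem_P (mul_mem_P hy h01 (by omega)) hn) (by omega)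
    · exact mul_mem_P (l := d + 1) hu (div_mem_P (mul_mem_P hy hae' (by omega)) hn) (by omega)
  rw [hsmall, mul_one]
  apply psi_eq_one_of_add_conj
  -- Only the trace matters for ψ. For the linear part it is a combination of the Lie algebra
  -- defects of k and their conjugates, all in 𝔭_E^d, with coefficients built from UT, Z and ZT, all
  -- in 𝔭_E^(1-d).
  have hmain : 2 * (U * T + Z) * (D.mat g 1 1 - 1) + U * D.mat g 1 0 -
        (Z * (a - 1) + U * c + (U * T ^ 2 * b + Z * (e - 1))) +
      D.conj (2 * (U * T + Z) * (D.mat g 1 1 - 1) + U * D.mat g 1 0 -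
        (Z * (a - 1) + U * c + (U * T ^ 2 * b + Z * (e - 1)))) =
      U * (T * ((a - 1) + (D.conj e - 1))) + U * (T * D.conj ((a - 1) + (D.conj e - 1))) +
      (Z * D.conj ((a - 1) + (D.conj e - 1)) - Z * ((a - 1) + (D.conj e - 1)) +
        2 * (Z * (T * (b + D.conj b)))) := by
    rw [e11, e10]
    simp only [map_add, map_sub, map_mul, map_pow, map_one, map_ofNat, huc, hzc, hτc, conj_conj]
    ring
  rw [hmain]
  have hδ' := conj_mem_P.mpr hδ
  refine (D.P 1).add_mem ((D.P 1).add_mem ?_ ?_) ((D.P 1).add_mem ((D.P 1).sub_mem ?_ ?_) ?_)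
  · exact mul_mem_P hu (mul_mem_P (n := 1 + d) hτ hδ le_rfl) (by omega)
  · exact mul_mem_P hu (mul_mem_P (n := 1 + d) hτ hδ' le_rfl) (by omega)
  · exact mul_mem_P hz hδ' (by omega)
  · exact mul_mem_P hz hδ (by omega)
  · exact mul_mem_P_right D.norm_two_E.le
      (mul_mem_P hz (mul_mem_P (n := 1 + d) hτ hbb le_rfl) (by omega))

-- The scalar Z drops out, and commuting with U (0, 1; T², 0) leaves two conditions. Conjugation by
-- `lower τ` moves the fixed line (T, 1) to (0, 1), which makes such elements upper triangular.
omit hl in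
theorem mem_TX_iff (hu : u ≠ 0) {k : D.K 0} : k ∈ D.TX (shalika D u z τ) ↔
    D.mat (k : D.G) 1 0 = (τ • D.sqrtEps) ^ 2 * D.mat (k : D.G) 0 1 ∧
      D.mat (k : D.G) 1 1 = D.mat (k : D.G) 0 0 := by
  have hU : u • D.sqrtEps ≠ 0 := smul_ne_zero hu D.sqrtEps_ne_zero
  change D.mat (k : D.G) * shalika D u z τ = shalika D u z τ * D.mat (k : D.G) ↔ _
  rw [shalika, shalika_coeff]
  generalize u • D.sqrtEps = U at *
  generalize z • D.sqrtEps = Z at *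
  generalize τ • D.sqrtEps = T at *
  rw [← Matrix.ext_iff]
  simp only [Fin.forall_fin_two, Matrix.mul_apply, Fin.sum_univ_two]
  simp
  constructor
  · rintro ⟨⟨h1, h2⟩, -, -⟩
    exact ⟨mul_left_cancel₀ hU (by linear_combination -h1),
      mul_left_cancel₀ hU (by linear_combination -h2)⟩
  · rintro ⟨h1, h2⟩
    rw [h1, h2]
    refine ⟨⟨?_, ?_⟩, ?_, ?_⟩ <;> ring

/-- The centralizer of `X` acts by scalars on the translate of `vec`. -/
theorem vec_TX {k : D.K 0} (hk : k ∈ D.TX (shalika D u z τ)) :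
    ∃ C : ℂˣ, ∀ x, vec χ d u (x * (D.lower τ * k * D.lower (-τ))) = C * vec χ d u x := by
  have hd := hl.one_le
  obtain ⟨hk1, hk2⟩ := (mem_TX_iff hl.u_ne_zero).mp hk
  set g := D.lower τ * k * D.lower (-τ) with hgdef
  have hg : g ∈ D.K 0 := by
    rw [hgdef, lower_neg]
    exact conj_mem_K hl.lower_mem k.2
  have hmat := mat_lower_conj τ (k : D.G)
  rw [← hgdef] at hmat
  have huc := D.conj_smul_sqrtEps u
  have hzc := D.conj_smul_sqrtEps z
  have hτc := D.conj_smul_sqrtEps τ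
  have hvec := fun (hc : D.mat g 1 0 ∈ D.P ((d + 2) / 2 : ℕ)) s hs => hl.vec_lower_mul hg hc (s := s) hs
  have key := fun hc C => vec_mul_of_lower (χ := χ) (u := u) hd hg hc C
  generalize u • D.sqrtEps = U at *
  generalize z • D.sqrtEps = Z at *
  generalize τ • D.sqrtEps = T at *
  have e00 : D.mat g 0 0 = D.mat k 0 0 - T * D.mat k 0 1 := by rw [hmat]; rfl
  have e01 : D.mat g 0 1 = D.mat k 0 1 := by rw [hmat]; rfl
  have e10 : D.mat g 1 0 = 0 := by
    have : D.mat g 1 0 = T * (D.mat k 0 0 - D.mat k 1 1) + D.mat k 1 0 - T ^ 2 * D.mat k 0 1 := by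
      rw [hmat]; rfl
    rw [this, hk1, hk2]
    ring
  have e11 : D.mat g 1 1 = T * D.mat k 0 1 + D.mat k 0 0 := by rw [← hk2, hmat]; rfl
  have hc' : D.mat g 1 0 ∈ D.P ((d + 2) / 2 : ℕ) := by rw [e10]; exact (D.P _).zero_mem
  have hn := norm_eq_one_of_mem_K_zero hg (by omega) hc'
  have hn0 : D.mat g 1 1 ≠ 0 := by rw [← norm_ne_zero_iff, hn]; exact one_ne_zero
  have hn0' : D.conj (D.mat g 1 1) ≠ 0 := (map_ne_zero D.conj).mpr hn0
  refine ⟨Units.mk0 _ (torusChar_ne_zero χ hn0), key hc' _ fun s hs => ?_⟩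
  rw [hvec hc' s hs, e10, zero_div, mul_zero, psi_zero, mul_one, Units.val_mk0]
  congr 1
  apply psi_eq_of_sub
  have hyc := D.conj_smul_sqrtEps s
  generalize s • D.sqrtEps = Y at *
  have hβ : D.conj (D.mat g 0 1 / D.mat g 1 1) = -(D.mat g 0 1 / D.mat g 1 1) := by
    have h := (mat_conj_col g).2.2
    rw [map_div₀]
    field_simp
    linear_combination h
  -- For g in the conjugated centralizer, a = e - 2Tb, so the UT terms cancel. What remains is a
  -- product of three purely imaginary factors up to 2, whose trace is zero.
  have h : Y * (2 * (U * T + Z) * (D.mat g 0 1 / D.mat g 1 1) +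
      U * (D.mat g 0 0 / D.mat g 1 1)) - U * Y = 2 * Z * Y * (D.mat g 0 1 / D.mat g 1 1) := by
    have h1 : D.mat g 0 0 = D.mat g 1 1 - 2 * T * D.mat g 0 1 := by rw [e00, e11, e01]; ring
    rw [h1]
    field_simp
    ring
  rw [h]
  apply psi_eq_one_of_imag
  rw [map_mul, map_mul, map_mul, map_ofNat, hzc, hyc, hβ]
  ring

end Linearised

end UnramifiedDatum

namespace UnramifiedDatum

variable {F E : Type*} [NontriviallyNormedField F] [IsUltrametricDist F] [ProperSpace F]
  [NormedField E] [IsUltrametricDist E] [NormedAlgebra F E] [Algebra.IsQuadraticExtension F E]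
  {D : UnramifiedDatum F E}

/-! ### A Fourier coefficient -/

variable (D) in
/-- The ideal `𝔭_F ^ n` as an additive group. -/
def PF (n : ℕ) : AddSubgroup F := (D.P n).comap (algebraMap F E).toAddMonoidHom

theorem mem_PF {n : ℕ} {s : F} : s ∈ D.PF n ↔ ‖s‖ ≤ ‖D.unif‖ ^ (n : ℤ) := algebraMap_mem_P

theorem smul_mem_P_of_mem_PF {n : ℕ} {s : F} (hs : s ∈ D.PF n) : s • D.sqrtEps ∈ D.P n :=
  smul_sqrtEps_mem_P.mpr (mem_PF.mp hs)

theorem PF_mono {n n' : ℕ} (h : n ≤ n') {s : F} (hs : s ∈ D.PF n') : s ∈ D.PF n :=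
  P_mono (D := D) (by exact_mod_cast h) hs

instance finite_quotient_PF (m n : ℕ) : Finite (D.PF m ⧸ (D.PF n).addSubgroupOf (D.PF m)) := by
  have := finite_quotient_P D (j := m) (d := n) (by omega)
  let φ : D.PF m → D.P m := fun s => ⟨algebraMap F E s, s.2⟩
  refine Finite.of_injective (fun q : D.PF m ⧸ (D.PF n).addSubgroupOf (D.PF m) =>
    (φ q.out : D.P m ⧸ (D.P n).addSubgroupOf (D.P m))) fun q q' h => ?_
  rw [← QuotientAddGroup.out_eq' q, ← QuotientAddGroup.out_eq' q']
  refine QuotientAddGroup.eq.mpr (AddSubgroup.mem_addSubgroupOf.mpr ?_)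
  have h1 := AddSubgroup.mem_addSubgroupOf.mp (QuotientAddGroup.eq.mp h)
  change algebraMap F E (-(q.out : F) + (q'.out : F)) ∈ D.P n
  rw [map_add, map_neg]
  exact h1

instance fintypeQuotientPF (m n : ℕ) : Fintype (D.PF m ⧸ (D.PF n).addSubgroupOf (D.PF m)) :=
  Fintype.ofFinite _

theorem smul_mul_smul_sqrtEps (u s : F) :
    u • D.sqrtEps * (s • D.sqrtEps) = algebraMap F E (s * (u * D.eps)) := by
  rw [smul_mul_smul_comm, ← sq, D.sqrtEps_sq, Algebra.smul_def, ← map_mul]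
  congr 1
  ring

/-- The functional on functions on `G` that extracts a Fourier coefficient on a neighbourhood of
the line through `(τ√ε, 1)`. -/
def fourier (D : UnramifiedDatum F E) (d : ℕ) (u τ : F) : (D.G → ℂ) →ₗ[ℂ] ℂ where
  toFun f := ∑ q : D.PF ((d + 2) / 2) ⧸ (D.PF (d + 1)).addSubgroupOf (D.PF ((d + 2) / 2)),
    D.psi (-(u • D.sqrtEps * ((q.out : F) • D.sqrtEps))) * f (D.lower (q.out : F) * D.lower τ)
  map_add' f g := by
    rw [← Finset.sum_add_distrib]
    exact Finset.sum_congr rfl fun q _ => mul_add _ _ _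
  map_smul' c f := by
    rw [RingHom.id_apply, Finset.smul_sum]
    exact Finset.sum_congr rfl fun q _ => mul_left_comm _ _ _

theorem fourier_apply (d : ℕ) (u τ : F) (f : D.G → ℂ) : fourier D d u τ f =
    ∑ q : D.PF ((d + 2) / 2) ⧸ (D.PF (d + 1)).addSubgroupOf (D.PF ((d + 2) / 2)),
      D.psi (-(u • D.sqrtEps * ((q.out : F) • D.sqrtEps))) *
        f (D.lower (q.out : F) * D.lower τ) := rfl

namespace Linearised

variable {χ : D.T →* ℂˣ} {d : ℕ} {u z τ : F} (hl : Linearised χ d u z τ)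

include hl

/-- The functional `fourier` vanishes on the functions invariant under `𝒦_d`. -/
theorem fourier_eq_zero {f : D.G → ℂ} (hf : ∀ g, ∀ n ∈ D.K d, f (g * n) = f g) :
    fourier D d u τ f = 0 := by
  have hd := hl.one_le
  have hshift : ∀ s s' : F, s' ∈ D.PF d → f (D.lower (s + s') * D.lower τ) =
      f (D.lower s * D.lower τ) := by
    intro s s' hs'
    rw [lower_add, mul_assoc, D.lower_comm s' τ, ← mul_assoc,
      hf _ _ (lower_mem_K.mpr (mem_PF.mp hs'))]
  -- As |uε| = |ϖ|^(-d), the frequency is nontrivial on 𝔭_F^d, whereas translation by 𝔭_F^d fixes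
  -- the values of f.
  obtain ⟨s₀, hs₀, hne⟩ := exists_psi'_mul_ne_one (D := D) (y := -(u * D.eps)) (k := d) (by
    rw [norm_neg, norm_mul, D.norm_eps, mul_one, hl.norm_u]
    exact zpow_lt_zpow_right_of_lt_one₀ D.norm_unif_pos D.norm_unif_lt_one (by omega))
  have hs₀' : s₀ ∈ D.PF d := mem_PF.mpr hs₀
  have hadd : ∀ s s' : F, D.psi (-(u • D.sqrtEps * ((s + s') • D.sqrtEps))) =
      D.psi (-(u • D.sqrtEps * (s' • D.sqrtEps))) * D.psi (-(u • D.sqrtEps * (s • D.sqrtEps))) := by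
    intro s s'
    rw [← psi_add, add_smul]
    congr 1
    ring
  rw [fourier_apply]
  refine sum_quotient_eq_zero _ (fun s : D.PF ((d + 2) / 2) =>
    D.psi (-(u • D.sqrtEps * ((s : F) • D.sqrtEps))) * f (D.lower (s : F) * D.lower τ)) ?_
    ⟨s₀, PF_mono (by omega) hs₀'⟩ (D.psi' (s₀ * -(u * D.eps))) hne ?_
  · intro s b hb
    have hb' : (b : F) ∈ D.PF (d + 1) := AddSubgroup.mem_addSubgroupOf.mp hb
    simp only [AddSubgroup.coe_add]
    rw [hadd, hshift _ _ (PF_mono (by omega) hb'), psi_eq_one, one_mul]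
    exact (D.P 1).neg_mem (mul_mem_P hl.mem_P_u (smul_mem_P_of_mem_PF hb') (by omega))
  · intro s
    simp only [AddSubgroup.coe_add]
    rw [hadd, hshift _ _ hs₀', smul_mul_smul_sqrtEps u s₀, ← map_neg, psi_algebraMap, mul_neg,
      mul_assoc]

/-- Frequency and base point match, so every term of the sum is 1 and its value is the index of a
finite quotient. -/
theorem fourier_vec_ne_zero : fourier D d u τ (fun x => vec χ d u (x * D.lower (-τ))) ≠ 0 := by
  rw [fourier_apply, Finset.sum_congr rfl (g := fun _ => 1), Finset.sum_const, nsmul_one,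
    Nat.cast_ne_zero, Finset.card_univ]
  · exact Fintype.card_ne_zero
  · intro q _
    rw [mul_assoc, ← D.lower_add τ, add_neg_cancel, lower_zero, mul_one,
      hl.vec_lower (mem_PF.mp (q.out : D.PF _).2), psi_neg_mul]

/-- The elements of `𝒦` near the stabiliser of the line through `vec`, moved by `(1, 0; τ√ε, 1)`,
belong to `T(X) 𝒥_d`. -/
theorem mem_sup_of_estimate {k : D.K 0} {g : D.G} (hgk : D.lower τ * k * D.lower (-τ) = g)
    (hg : g ∈ D.K 0) (hc : D.mat g 1 0 ∈ D.P ((d + 2) / 2 : ℕ))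
    {Θ : E} (hΘ : Θ = 2 * (u • D.sqrtEps * (τ • D.sqrtEps) + z • D.sqrtEps) *
      (D.mat g 0 1 / D.mat g 1 1) + u • D.sqrtEps * (D.mat g 0 0 / D.mat g 1 1) - u • D.sqrtEps)
    (h : D.sqrtEps * Θ + D.conj (D.sqrtEps * Θ) ∈ D.P (1 - ((d + 2) / 2 : ℕ))) :
    k ∈ D.TX (shalika D u z τ) ⊔ D.JK d := by
  have hd := hl.one_le
  have hn := norm_eq_one_of_mem_K_zero hg (by omega) hc
  have he0 : D.mat g 1 1 ≠ 0 := by rw [← norm_ne_zero_iff, hn]; exact one_ne_zero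
  have hce0 : D.conj (D.mat g 1 1) ≠ 0 := (map_ne_zero D.conj).mpr he0
  have hg' := mem_K_zero_iff.mp hg
  -- the lower triangular factor
  have hSc := conj_row_div g
  obtain ⟨s, hs⟩ := exists_smul_sqrtEps_eq hSc
  have hS : s • D.sqrtEps ∈ D.P ((d + 2) / 2 : ℕ) := by rw [hs]; exact div_mem_P hc hn
  have hcS : D.mat g 1 0 = D.mat g 1 1 * (s • D.sqrtEps) := by rw [hs]; field_simp
  rw [← hs] at hSc
  -- the diagonal entries
  obtain ⟨hrow1, -, -⟩ := mat_conj_row g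
  have hcol3 := (mat_conj_col g).2.2
  set β := D.mat g 0 1 / D.mat g 1 1 with hβdef
  have hb : D.mat g 0 1 = β * D.mat g 1 1 := by rw [hβdef]; field_simp
  have hβ : D.conj β = -β := by
    rw [hβdef, map_div₀]
    field_simp
    linear_combination hcol3
  have hβ1 : ‖β‖ ≤ 1 := by rw [hβdef, norm_div, hn, div_one]; exact hg' 0 1
  -- With S = c/e and β = b/e purely imaginary and ν = 1/(e ē) in F, unitarity gives a = e(ν + βS),
  -- so g is described by e, β and S.
  set ν := (D.mat g 1 1 * D.conj (D.mat g 1 1))⁻¹ with hνdef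
  have hν : D.conj ν = ν := by rw [hνdef, map_inv₀, map_mul, conj_conj, mul_comm]
  have ha : D.mat g 0 0 = D.mat g 1 1 * (ν + β * (s • D.sqrtEps)) := by
    have h1 : D.mat g 0 0 * D.conj (D.mat g 1 1) -
        β * D.mat g 1 1 * (s • D.sqrtEps) * D.conj (D.mat g 1 1) = 1 := by
      have h2 := congrArg D.conj hcS
      rw [map_mul, hSc] at h2
      rw [h2, hb] at hrow1
      linear_combination hrow1
    rw [hνdef]
    field_simp
    linear_combination h1
  have hae : D.mat g 0 0 / D.mat g 1 1 = ν + β * (s • D.sqrtEps) := by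
    rw [ha]; field_simp
  have hee : ν * (D.mat g 1 1 * D.conj (D.mat g 1 1)) = 1 := by
    rw [hνdef]; exact inv_mul_cancel₀ (mul_ne_zero he0 hce0)
  clear_value β ν
  -- the estimate
  have huc := D.conj_smul_sqrtEps u
  have hzc := D.conj_smul_sqrtEps z
  have hτc := D.conj_smul_sqrtEps τ
  have hρ : 2 * (τ • D.sqrtEps) * β + ν - 1 ∈ D.P ((d + 1) / 2 : ℕ) := by
    -- The Z term of √ε Θ is purely imaginary and disappears from the trace. The hypothesis thus
    -- controls 2Tβ + ν - 1 modulo 𝔭_E^⌈d/2⌉, up to the small term βS.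
    have h1 : D.sqrtEps * Θ + D.conj (D.sqrtEps * Θ) = 2 * (D.sqrtEps * (u • D.sqrtEps)) *
        (2 * (τ • D.sqrtEps) * β + ν - 1 + β * (s • D.sqrtEps)) := by
      rw [hΘ, hae]
      simp only [map_add, map_sub, map_mul, map_ofNat, huc, hzc, hτc, hSc, hβ, hν, conj_sqrtEps]
      ring
    rw [h1, mem_P, norm_mul, norm_mul, norm_mul, D.norm_two_E, D.norm_sqrtEps, norm_smul_sqrtEps,
      hl.norm_u, one_mul, one_mul] at h
    have h2 : ‖D.unif‖ ^ (1 - (((d + 2) / 2 : ℕ) : ℤ)) =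
        ‖D.unif‖ ^ (-(d : ℤ)) * ‖D.unif‖ ^ (((d + 1) / 2 : ℕ) : ℤ) := by
      rw [← zpow_add₀ D.norm_unif_pos.ne']
      congr 1
      omega
    rw [h2] at h
    have h3 : 2 * (τ • D.sqrtEps) * β + ν - 1 + β * (s • D.sqrtEps) ∈ D.P ((d + 1) / 2 : ℕ) :=
      le_of_mul_le_mul_left h (D.norm_unif_zpow_pos _)
    have h4 := (D.P _).sub_mem h3 (P_mono (l := ((d + 1) / 2 : ℕ)) (by omega)
      (mul_mem_P_right hβ1 hS))
    rwa [add_sub_cancel_right] at h4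
  have hTβ : 2 * (τ • D.sqrtEps) * β ∈ D.P 1 :=
    mul_mem_P_left (mul_mem_P_right D.norm_two_E.le hl.norm_τ) hβ1
  -- The conjugated centralizer consists of upper triangular elements with a = ηe. Here the ratio is
  -- ν up to the term βS, and ν/η is close to 1, hence a square δ²; the diagonal element with
  -- entries δ, δ⁻¹ makes up the difference.
  set η := 1 - 2 * (τ • D.sqrtEps) * β with hηdef
  have hη1 : ‖η‖ = 1 := by
    rw [hηdef, sub_eq_add_neg]
    exact norm_one_add le_rfl ((D.P 1).neg_mem hTβ)
  have hη0 : η ≠ 0 := by rw [← norm_ne_zero_iff, hη1]; exact one_ne_zero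
  have hηc : D.conj η = η := by
    rw [hηdef]
    simp only [map_sub, map_mul, map_one, map_ofNat, hτc, hβ]
    ring
  -- the square root
  obtain ⟨w, hw⟩ := exists_algebraMap_eq (x := ν / η) (by rw [map_div₀, hν, hηc])
  have hw1 : ‖w - 1‖ ≤ ‖D.unif‖ ^ (((d + 1) / 2 : ℕ) : ℤ) := by
    rw [← algebraMap_mem_P, map_sub, map_one, hw]
    have h1 : ν / η - 1 = (2 * (τ • D.sqrtEps) * β + ν - 1) / η := by
      field_simp
      rw [hηdef]
      ring
    rw [h1]
    exact div_mem_P hρ hη1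
  obtain ⟨δ₀, hδ₀, hδw⟩ := exists_sqrt D (by omega) hw1
  have hδP : algebraMap F E δ₀ - 1 ∈ D.P ((d + 1) / 2 : ℕ) := by
    rw [← map_one (algebraMap F E), ← map_sub, algebraMap_mem_P]
    exact hδ₀
  have hδc := D.conj_algebraMap δ₀
  have hδη : (algebraMap F E δ₀) ^ 2 * η = ν := by
    rw [← map_pow, hδw, hw]; field_simp
  set δ := algebraMap F E δ₀ with hδdef
  have hδ1 : ‖δ‖ = 1 := norm_eq_one_of_sub (by omega) hδP
  have hδne : δ ≠ 0 := by rw [← norm_ne_zero_iff, hδ1]; exact one_ne_zero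
  have hδinv : δ⁻¹ - 1 ∈ D.P ((d + 1) / 2 : ℕ) := by
    have h1 : δ⁻¹ - 1 = -(δ - 1) / δ := by field_simp; ring
    rw [h1]
    exact div_mem_P ((D.P _).neg_mem hδP) hδ1
  clear_value η δ
  -- the factorisation
  let k₁ : D.G := D.upper (η * (D.mat g 1 1 * δ)) (β * (D.mat g 1 1 * δ)) (D.mat g 1 1 * δ)
    (by
      simp only [map_mul, hηc, hδc]
      linear_combination hee + D.conj (D.mat g 1 1) * D.mat g 1 1 * hδη)
    (by
      simp only [map_mul, hβ, hδc]
      ring)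
  let k₂ : D.G := D.upper δ 0 δ⁻¹ (by rw [hδc]; field_simp) (by simp)
  have hfac : g = k₁ * k₂ * D.lower s := by
    apply mat_injective
    rw [mat_mul_lower, mat_mul, mat_upper, mat_upper]
    generalize s • D.sqrtEps = S at ha hcS
    ext i j
    fin_cases i <;> fin_cases j
    · simp
      field_simp
      rw [ha]
      linear_combination (-D.mat g 1 1) * hδη
    · simp
      rw [hb]
      field_simp
    · simp
      rw [hcS]
      field_simp
    · simp
      field_simp
  -- Conjugating back does not change `lower s`, which commutes with `lower τ`. The first factor
  -- falls in T(X), the other two in 𝒥_d.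
  have hkfac : (k : D.G) = (D.lower (-τ) * k₁ * D.lower (- -τ)) *
      ((D.lower (-τ) * k₂ * D.lower (- -τ)) * D.lower s) := by
    have h1 : (k : D.G) = D.lower (-τ) * g * D.lower τ := by
      rw [← hgk, lower_neg]
      group
    rw [h1, hfac, neg_neg, mul_assoc _ (D.lower τ) (_ * _), mul_assoc (_ * _) (D.lower τ) (D.lower s),
      D.lower_comm τ s, lower_neg]
    group
  have hlK : D.lower s ∈ D.J d := by
    rw [J, mem_congruenceSubgroup]
    refine ⟨?_, (D.P _).zero_mem, hS, ?_⟩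
    · change (1 : E) - 1 ∈ _
      rw [sub_self]
      exact (D.P _).zero_mem
    · change (1 : E) - 1 ∈ _
      rw [sub_self]
      exact (D.P _).zero_mem
  have hk₂J : D.lower (-τ) * k₂ * D.lower (- -τ) ∈ D.J d := by
    rw [J, mem_congruenceSubgroup, mat_lower_conj]
    refine ⟨?_, (D.P _).zero_mem, ?_, ?_⟩
    · change δ - (-τ) • D.sqrtEps * 0 - 1 ∈ _
      rwa [mul_zero, sub_zero]
    · change (-τ) • D.sqrtEps * (δ - δ⁻¹) + 0 - ((-τ) • D.sqrtEps) ^ 2 * 0 ∈ _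
      rw [mul_zero, sub_zero, add_zero, neg_smul, neg_mul]
      have h1 : δ - δ⁻¹ ∈ D.P ((d + 1) / 2 : ℕ) := by
        have := (D.P _).sub_mem hδP hδinv
        rwa [sub_sub_sub_cancel_right] at this
      exact (D.P _).neg_mem (mul_mem_P hl.norm_τ h1 (by omega))
    · change (-τ) • D.sqrtEps * 0 + δ⁻¹ - 1 ∈ _
      rwa [mul_zero, zero_add]
  have hjJ := (D.J d).mul_mem hk₂J hlK
  have hjK := J_le_K_zero d hjJ
  have hk₁K : D.lower (-τ) * k₁ * D.lower (- -τ) ∈ D.K 0 := by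
    have h1 := (D.K 0).mul_mem k.2 ((D.K 0).inv_mem hjK)
    have h2 : (k : D.G) * ((D.lower (-τ) * k₂ * D.lower (- -τ)) * D.lower s)⁻¹ =
        D.lower (-τ) * k₁ * D.lower (- -τ) := by
      rw [hkfac, mul_inv_cancel_right]
    rwa [h2] at h1
  have hk₁T : (⟨_, hk₁K⟩ : D.K 0) ∈ D.TX (shalika D u z τ) := by
    rw [mem_TX_iff hl.u_ne_zero]
    change D.mat (D.lower (-τ) * k₁ * D.lower (- -τ)) 1 0 = _ *
      D.mat (D.lower (-τ) * k₁ * D.lower (- -τ)) 0 1 ∧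
      D.mat (D.lower (-τ) * k₁ * D.lower (- -τ)) 1 1 =
      D.mat (D.lower (-τ) * k₁ * D.lower (- -τ)) 0 0
    rw [mat_lower_conj, neg_smul]
    change -(τ • D.sqrtEps) * (η * (D.mat g 1 1 * δ) - D.mat g 1 1 * δ) + 0 -
      (-(τ • D.sqrtEps)) ^ 2 * (β * (D.mat g 1 1 * δ)) =
        (τ • D.sqrtEps) ^ 2 * (β * (D.mat g 1 1 * δ)) ∧
      -(τ • D.sqrtEps) * (β * (D.mat g 1 1 * δ)) + D.mat g 1 1 * δ =
        η * (D.mat g 1 1 * δ) - -(τ • D.sqrtEps) * (β * (D.mat g 1 1 * δ))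
    rw [hηdef]
    constructor <;> ring
  have hkeq : k = ⟨_, hk₁K⟩ * ⟨_, hjK⟩ := Subtype.ext hkfac
  rw [hkeq]
  exact Subgroup.mul_mem _ (Subgroup.mem_sup_left hk₁T)
    (Subgroup.mem_sup_right (Subgroup.mem_subgroupOf.mpr hjJ))

/-- The functional `fourier` vanishes on the translates of the eigenvector by the elements of `𝒦`
outside of `T(X) 𝒥_d`. -/
theorem mem_sup_of_fourier_ne_zero {k : D.K 0}
    (h : fourier D d u τ (fun x => vec χ d u (x * k * D.lower (-τ))) ≠ 0) :
    k ∈ D.TX (shalika D u z τ) ⊔ D.JK d := by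
  have hd := hl.one_le
  obtain ⟨g, hgk⟩ : ∃ g, D.lower τ * k * D.lower (-τ) = g := ⟨_, rfl⟩
  have hg : g ∈ D.K 0 := by
    rw [← hgk, lower_neg]
    exact conj_mem_K hl.lower_mem k.2
  have hg' := mem_K_zero_iff.mp hg
  rw [fourier_apply] at h
  have hterm : ∀ s : F, D.lower s * D.lower τ * k * D.lower (-τ) = D.lower s * g := fun s => by
    rw [← hgk]; group
  simp only [hterm] at h
  -- A nonzero term means that g moves some point of 𝔭_E^m into 𝔭_E^m, where m = ⌈(d+1)/2⌉. For
  -- integral g this forces c ∈ 𝔭_E^m.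
  have hc : D.mat g 1 0 ∈ D.P ((d + 2) / 2 : ℕ) := by
    obtain ⟨q, -, hq⟩ := Finset.exists_ne_zero_of_sum_ne_zero h
    have hq' := right_ne_zero_of_mul hq
    have hy := smul_mem_P_of_mem_PF (q.out : D.PF ((d + 2) / 2)).2
    have hnear : Near ((d + 2) / 2 : ℕ) (D.lower ((q.out : D.PF ((d + 2) / 2)) : F) * g) := by
      by_contra hn
      exact hq' (sec_of_not_near hn)
    rw [Near, mat_lower_mul] at hnear
    generalize ((q.out : D.PF ((d + 2) / 2)) : F) • D.sqrtEps = y at hy hnear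
    obtain ⟨h1, h2⟩ := hnear
    change y * D.mat g 0 1 + D.mat g 1 1 ≠ 0 at h1
    change (y * D.mat g 0 0 + D.mat g 1 0) / (y * D.mat g 0 1 + D.mat g 1 1) ∈ _ at h2
    have h3 : ‖y * D.mat g 0 1 + D.mat g 1 1‖ ≤ 1 :=
      (IsUltrametricDist.norm_add_le_max _ _).trans (max_le
        (norm_le_one_of_mem_P (by omega) (mul_mem_P_left hy (hg' 0 1))) (hg' 1 1))
    have h4 : y * D.mat g 0 0 + D.mat g 1 0 ∈ D.P ((d + 2) / 2 : ℕ) := by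
      have := mul_mem_P_left h2 h3
      rwa [div_mul_cancel₀ _ h1] at this
    have h5 := (D.P _).sub_mem h4 (mul_mem_P_left hy (hg' 0 0))
    rwa [add_sub_cancel_left] at h5
  have hn := norm_eq_one_of_mem_K_zero hg (by omega) hc
  obtain ⟨Θ, hΘ⟩ : ∃ Θ, Θ = 2 * (u • D.sqrtEps * (τ • D.sqrtEps) + z • D.sqrtEps) *
      (D.mat g 0 1 / D.mat g 1 1) + u • D.sqrtEps * (D.mat g 0 0 / D.mat g 1 1) -
        u • D.sqrtEps := ⟨_, rfl⟩
  have hΘP : Θ ∈ D.P (-(d : ℤ)) := by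
    rw [hΘ]
    refine (D.P _).sub_mem ((D.P _).add_mem ?_ ?_) hl.mem_P_u
    · exact P_mono (by omega) (mul_mem_P_left hl.coeff_mem (by rw [norm_div, hn, div_one]; exact hg' 0 1))
    · exact mul_mem_P_left hl.mem_P_u (by rw [norm_div, hn, div_one]; exact hg' 0 0)
  refine hl.mem_sup_of_estimate hgk hg hc hΘ (add_conj_mem_P_of_psi fun s₀ hs₀ => ?_)
  by_contra hne
  apply h
  set C := torusChar χ (D.mat g 1 1) * D.psi (u • D.sqrtEps * (D.mat g 1 0 / D.mat g 1 1))
  -- The summand is a constant times an additive character of 𝔭_F^m. A nonzero sum requires this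
  -- character to be trivial, which is the estimate on the trace of √ε Θ.
  have hval : ∀ s : F, s ∈ D.PF ((d + 2) / 2) →
      D.psi (-(u • D.sqrtEps * (s • D.sqrtEps))) * vec χ d u (D.lower s * g) =
        C * D.psi (s • (D.sqrtEps * Θ)) := by
    intro s hs
    rw [hl.vec_lower_mul hg hc (mem_PF.mp hs), mul_left_comm, ← psi_add, ← smul_mul_assoc, hΘ]
    congr 2
    ring
  rw [Finset.sum_congr rfl fun q _ => hval _ (q.out : D.PF ((d + 2) / 2)).2]
  refine sum_quotient_eq_zero _ (fun s : D.PF ((d + 2) / 2) =>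
    C * D.psi ((s : F) • (D.sqrtEps * Θ))) ?_ ⟨s₀, mem_PF.mpr hs₀⟩ _ hne ?_
  · intro s b hb
    have hb' : (b : F) ∈ D.PF (d + 1) := AddSubgroup.mem_addSubgroupOf.mp hb
    simp only [AddSubgroup.coe_add]
    rw [add_smul, psi_add, ← smul_mul_assoc (b : F), psi_eq_one (mul_mem_P
      (smul_mem_P_of_mem_PF hb') hΘP (by omega)), mul_one]
  · intro s
    simp only [AddSubgroup.coe_add]
    rw [add_smul, psi_add]
    ring

end Linearised

end UnramifiedDatum

/-! ### Sums over cosets and eigencharacters -/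

theorem sum_quotient_mul_left {Γ : Type*} [Group Γ] (N : Subgroup Γ) [Fintype (Γ ⧸ N)] (φ : Γ → ℂ)
    (hφ : ∀ x, ∀ n ∈ N, φ (x * n) = φ x) (g : Γ) :
    ∑ q : Γ ⧸ N, φ (g * q.out) = ∑ q : Γ ⧸ N, φ q.out := by
  refine Fintype.sum_equiv (MulAction.toPerm g) _ _ fun q => ?_
  have h1 : ((g * q.out : Γ) : Γ ⧸ N) = ((g • q).out : Γ ⧸ N) := by
    rw [QuotientGroup.out_eq', ← smul_eq_mul, ← MulAction.Quotient.smul_coe, QuotientGroup.out_eq']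
  have h2 := hφ (g * q.out) _ (QuotientGroup.eq.mp h1)
  rw [mul_inv_cancel_left] at h2
  exact h2.symm

section Eigencharacter

variable {Γ V : Type*} [Group Γ] [AddCommGroup V] [Module ℂ V]

/-- The stabiliser of the line spanned by a vector. -/
def lineStabilizer (ρ : Representation ℂ Γ V) (v : V) : Subgroup Γ where
  carrier := {g | ∃ C : ℂˣ, ρ g v = (C : ℂ) • v}
  one_mem' := ⟨1, by simp⟩
  mul_mem' := by
    rintro g h ⟨C, hC⟩ ⟨C', hC'⟩
    refine ⟨C * C', ?_⟩
    rw [map_mul, Module.End.mul_apply, hC', map_smul, hC, smul_smul, Units.val_mul, mul_comm]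
  inv_mem' := by
    rintro g ⟨C, hC⟩
    refine ⟨C⁻¹, ?_⟩
    have h : ρ g⁻¹ (ρ g v) = v := by
      rw [← Module.End.mul_apply, ← map_mul, inv_mul_cancel, map_one, Module.End.one_apply]
    rw [hC, map_smul] at h
    rw [← h, smul_smul, Units.inv_mul, one_smul, h]

/-- Since v ≠ 0 the scalars are unique, hence multiplicative. This produces the extension to T(X)𝒥_d
at once, without gluing ζ and Ψ_X by hand. -/
theorem exists_eigencharacter {ρ : Representation ℂ Γ V} {v : V} (hv : v ≠ 0) (H : Subgroup Γ)
    (h : H ≤ lineStabilizer ρ v) : ∃ Ψ : H →* ℂˣ, ∀ g : H, ρ g v = (Ψ g : ℂ) • v := by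
  have hex : ∀ g : H, ∃ C : ℂˣ, ρ g v = (C : ℂ) • v := fun g => h g.2
  choose Ψ hΨ using hex
  have huniq : ∀ C C' : ℂˣ, (C : ℂ) • v = (C' : ℂ) • v → C = C' := fun C C' h =>
    Units.ext (smul_left_injective ℂ hv h)
  refine ⟨⟨⟨Ψ, huniq _ _ ?_⟩, fun g g' => huniq _ _ ?_⟩, hΨ⟩
  · rw [← hΨ]
    simp
  · rw [← hΨ, Subgroup.coe_mul, map_mul, Module.End.mul_apply, hΨ, map_smul, hΨ, smul_smul,
      Units.val_mul, mul_comm]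

end Eigencharacter

namespace UnramifiedDatum

variable {F E : Type*} [NontriviallyNormedField F] [IsUltrametricDist F] [ProperSpace F]
  [NormedField E] [IsUltrametricDist E] [NormedAlgebra F E] [Algebra.IsQuadraticExtension F E]
  {D : UnramifiedDatum F E}

/-! ### Generation of the vectors fixed by `𝒦_{d+1}` -/

theorem fixedBy_stable {χ : D.T →* ℂˣ} (n : ℕ) (k : D.K 0) {f : D.V χ}
    (hf : f ∈ fixedBy (D.principalSeries χ) (D.K n)) :
    D.resK χ k f ∈ fixedBy (D.principalSeries χ) (D.K n) := by
  rw [mem_fixedBy] at hf ⊢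
  intro g h hh
  change f.1 (g * h * k) = f.1 (g * k)
  have h1 := hf (g * k) _ (conj_mem_K ((D.K 0).inv_mem k.2) hh)
  rw [← h1]
  group

theorem fixedBy_mono {χ : D.T →* ℂˣ} {n n' : ℕ} (h : n ≤ n') :
    fixedBy (D.principalSeries χ) (D.K n) ≤ fixedBy (D.principalSeries χ) (D.K n') := fun _ hf =>
  mem_fixedBy.mpr fun g x hx => mem_fixedBy.mp hf g x (K_mono h hx)

/-- The space `V_χ^{𝒦_n}` as a representation of `𝒦`. -/
def fixedSub (χ : D.T →* ℂˣ) (n : ℕ) : Subrepresentation (D.resK χ) where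
  toSubmodule := fixedBy (D.principalSeries χ) (D.K n)
  apply_mem_toSubmodule k _ hf := fixedBy_stable n k hf

/-- Translation of a section by an element of the torus. -/
theorem sec_torus (χ : D.T →* ℂˣ) (m : ℤ) (φ : E → ℂ) {e : Eˣ} (he : ‖(e : E)‖ = 1) {n : E}
    (hn : n * ((e : E) * D.conj e) = 1) (x : D.G) :
    sec χ m φ (x * D.torus e) = torusChar χ e * sec χ m (fun t => φ (n * t)) x := by
  have hce : D.conj (e : E) ≠ 0 := (map_ne_zero D.conj).mpr e.ne_zero
  have hmat : D.mat (D.torus e) = !![(D.conj (e : E))⁻¹, 0; 0, (e : E)] := rfl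
  have h1 : D.mat (x * D.torus e) 1 1 = D.mat x 1 1 * e := by
    rw [mat_mul, hmat, Matrix.mul_apply, Fin.sum_univ_two]; simp
  have h0 : D.mat (x * D.torus e) 1 0 = D.mat x 1 0 * (D.conj (e : E))⁻¹ := by
    rw [mat_mul, hmat, Matrix.mul_apply, Fin.sum_univ_two]; simp
  have hdiv : D.mat (x * D.torus e) 1 0 / D.mat (x * D.torus e) 1 1 =
      n * (D.mat x 1 0 / D.mat x 1 1) := by
    have hn' : n = ((e : E) * D.conj e)⁻¹ := eq_inv_of_mul_eq_one_left hn
    rw [h0, h1, hn', div_eq_mul_inv, div_eq_mul_inv, mul_inv, mul_inv]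
    ring
  have hn1 : ‖n‖ = 1 := by
    have := congrArg norm hn
    rwa [norm_mul, norm_mul, norm_conj, he, norm_one, mul_one, mul_one] at this
  have hnear : Near m (x * (D.torus e : D.G)) ↔ Near m x := by
    rw [Near, Near, hdiv, h1, mul_ne_zero_iff_right e.ne_zero, mem_P, norm_mul, hn1, one_mul, mem_P]
  by_cases hx : Near m x
  · rw [sec_of_near hx, sec_of_near (hnear.mpr hx), hdiv, h1, map_mul]
    ring
  · rw [sec_of_not_near hx, sec_of_not_near (mt hnear.mp hx), mul_zero]

theorem near_lower_iff_mul {m : ℤ} {k : ℕ} (hm : 0 ≤ m) (hmk : m ≤ k) (hk : 1 ≤ k) {g n : D.G}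
    (hn : n ∈ D.K k) : Near m (g * n) ↔ Near m g := by
  refine ⟨fun h => ?_, fun h => (near_mul hm hmk hk hn h).1⟩
  have := (near_mul hm hmk hk ((D.K k).inv_mem hn) h).1
  rwa [mul_inv_cancel_right] at this

/-- The vectors fixed by `𝒦_N` are generated by a section supported on `B 𝒦_N`. -/
theorem mem_of_sec_mem {χ : D.T →* ℂˣ} {N : ℕ} (hN : 1 ≤ N) (M : Subrepresentation (D.resK χ))
    {e : D.V χ} (he : e ∈ M.toSubmodule) (hsec : e.1 = sec χ N fun _ => 1) {f : D.V χ}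
    (hf : f ∈ fixedBy (D.principalSeries χ) (D.K N)) : f ∈ M.toSubmodule := by
  classical
  have : Finite ((D.K 0) ⧸ (D.K N).subgroupOf (D.K 0)) := finite_quotient_K N
  have := Fintype.ofFinite ((D.K 0) ⧸ (D.K N).subgroupOf (D.K 0))
  have hfK := mem_fixedBy.mp hf
  let c : ℂ := ∑ q : (D.K 0) ⧸ (D.K N).subgroupOf (D.K 0), if Near N (q.out : D.G) then 1 else 0
  have hc : c ≠ 0 := by
    have h1 : (Quotient.out ((1 : D.K 0) : (D.K 0) ⧸ (D.K N).subgroupOf (D.K 0)) : D.K 0) ∈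
        (D.K N).subgroupOf (D.K 0) := by
      have := QuotientGroup.eq.mp
        (QuotientGroup.out_eq' ((1 : D.K 0) : (D.K 0) ⧸ (D.K N).subgroupOf (D.K 0))).symm
      rwa [inv_one, one_mul] at this
    have h2 : Near N (1 : D.G) := by
      rw [Near, mat_one]
      simp [(D.P N).zero_mem]
    have h3 : Near N ((Quotient.out ((1 : D.K 0) : (D.K 0) ⧸ (D.K N).subgroupOf (D.K 0)) : D.K 0) :
        D.G) := by
      have := (near_mul (by omega) le_rfl hN (Subgroup.mem_subgroupOf.mp h1) h2).1
      rwa [one_mul] at this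
    change (∑ q : (D.K 0) ⧸ (D.K N).subgroupOf (D.K 0),
      if Near N (q.out : D.G) then (1 : ℂ) else 0) ≠ 0
    rw [Finset.sum_boole, Nat.cast_ne_zero, Finset.card_ne_zero]
    exact ⟨_, Finset.mem_filter.mpr ⟨Finset.mem_univ _, h3⟩⟩
  -- A 𝒦-translate of e is supported on one small neighbourhood, so f is a weighted sum of
  -- translates. The number c counts the cosets that contribute at a given point.
  have hsum : (∑ q : (D.K 0) ⧸ (D.K N).subgroupOf (D.K 0),
      f.1 ((q.out)⁻¹ : D.K 0) • D.resK χ q.out e) = c • f := by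
    apply V_ext
    intro g hg
    have h1 : (∑ q : (D.K 0) ⧸ (D.K N).subgroupOf (D.K 0),
        f.1 ((q.out)⁻¹ : D.K 0) • D.resK χ q.out e).1 g =
        ∑ q : (D.K 0) ⧸ (D.K N).subgroupOf (D.K 0), f.1 ((q.out)⁻¹ : D.K 0) * e.1 (g * q.out) := by
      rw [Submodule.coe_sum, Finset.sum_apply]
      rfl
    have h2 : (c • f).1 g = c * f.1 g := rfl
    -- This count does not depend on the point g.
    have h3 := sum_quotient_mul_left ((D.K N).subgroupOf (D.K 0))
      (fun x : D.K 0 => if Near N (x : D.G) then (1 : ℂ) else 0) (fun x n hn => by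
        simp only [Subgroup.coe_mul]
        exact if_congr (near_lower_iff_mul (by omega) le_rfl hN (Subgroup.mem_subgroupOf.mp hn))
          rfl rfl) ⟨g, hg⟩
    have h4 : c = _ := h3.symm
    rw [h1, h2, h4, Finset.sum_mul]
    refine Finset.sum_congr rfl fun q _ => ?_
    generalize (q.out : D.K 0) = k
    rw [hsec]
    simp only [Subgroup.coe_mul]
    by_cases hk : Near N (g * (k : D.G))
    · rw [sec_of_near hk, if_pos hk, one_mul, mul_one]
      obtain ⟨b, s, hgk, hs⟩ := exists_eq_mul_lower hk.1
      have hsK : D.lower s ∈ D.K N := lower_mem_K.mpr (smul_sqrtEps_mem_P.mp (hs ▸ hk.2))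
      have hbK : (b : D.G) ∈ D.K 0 := by
        have h5 : (b : D.G) = g * k * (D.lower s)⁻¹ := by rw [hgk, mul_inv_cancel_right]
        rw [h5]
        exact (D.K 0).mul_mem ((D.K 0).mul_mem hg k.2)
          ((D.K 0).inv_mem (K_mono (Nat.zero_le N) hsK))
      -- From g k = b `lower s` it follows that k⁻¹ and b⁻¹g differ on the right by an element of
      -- 𝒦_N, because 𝒦_N is normal in 𝒦.
      have h6 : ((k⁻¹ : D.K 0) : D.G) = ((b : D.G)⁻¹ * g) *
          (((b : D.G)⁻¹ * g)⁻¹ * (D.lower s)⁻¹ * ((b : D.G)⁻¹ * g)⁻¹⁻¹) := by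
        have h7 : (k : D.G) = g⁻¹ * (b * D.lower s) := by rw [← hgk, inv_mul_cancel_left]
        rw [Subgroup.coe_inv, h7]
        group
      have h8 : f.1 ((k⁻¹ : D.K 0) : D.G) = f.1 ((b : D.G)⁻¹ * g) := by
        rw [h6]
        exact hfK _ _ (conj_mem_K ((D.K 0).inv_mem ((D.K 0).mul_mem ((D.K 0).inv_mem hbK) hg))
          ((D.K N).inv_mem hsK))
      have h9 : f.1 g = torusChar χ (D.mat b 1 1) * f.1 ((b : D.G)⁻¹ * g) := by
        rw [← chi_borelToTorus, ← f.2.2 b, mul_inv_cancel_left]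
      have h10 : D.mat (g * k) 1 1 = D.mat b 1 1 := by
        rw [hgk, mat_mul_lower]
        rfl
      rw [h8, h9, h10, mul_comm]
    · rw [sec_of_not_near hk, if_neg hk, mul_zero, zero_mul]
  have hmem : c • f ∈ M.toSubmodule := by
    rw [← hsum]
    exact Submodule.sum_mem _ fun q _ =>
      Submodule.smul_mem _ _ (M.apply_mem_toSubmodule q.out he)
  have := M.toSubmodule.smul_mem c⁻¹ hmem
  rwa [smul_smul, inv_mul_cancel₀ hc, one_smul] at this

/-! ### The eigenvector and V_χ^{𝒦_d} generate V_χ^{𝒦_{d+1}} -/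

namespace Linearised

variable {χ : D.T →* ℂˣ} {d : ℕ} {u z τ : F} (hl : Linearised χ d u z τ)

include hl

theorem sec_psi_mul {k : ℕ} (hk : d ≤ k) {ω : E} (hω : ω ∈ D.P (1 - k)) (g : D.G) {n : D.G}
    (hn : n ∈ D.K k) : sec χ ((d + 2) / 2 : ℕ) (fun t => D.psi (ω * t)) (g * n) =
      sec χ ((d + 2) / 2 : ℕ) (fun t => D.psi (ω * t)) g := by
  have hd := hl.one_le
  exact sec_mul χ (by omega) (by omega) (by omega)
    (fun x hx => hl.trivial x (P_mono (by exact_mod_cast hk) hx))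
    (fun t _ s hs => psi_mul_periodic hω t hs) g hn

theorem sec_psi_mem_V {k : ℕ} (hk : d ≤ k) {ω : E} (hω : ω ∈ D.P (1 - k)) :
    sec χ ((d + 2) / 2 : ℕ) (fun t => D.psi (ω * t)) ∈ D.V χ :=
  mem_V_of_right_invariant (fun g _ hn => hl.sec_psi_mul hk hω g hn) (sec_borel_mul χ _ _)

theorem vec_mem_V : vec χ d u ∈ D.V χ :=
  hl.sec_psi_mem_V (k := d + 1) (Nat.le_succ d) (P_mono (by push_cast; omega) hl.mem_P_u)

/-- The eigenvector of `T(X) 𝒥_d` in `V_χ`. -/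
def eigenvector : D.V χ := D.principalSeries χ (D.lower (-τ)) ⟨vec χ d u, hl.vec_mem_V⟩

theorem eigenvector_mem_fixedBy :
    hl.eigenvector ∈ fixedBy (D.principalSeries χ) (D.K (d + 1)) := by
  have hτ : D.lower (-τ) ∈ D.K 0 := by rw [lower_neg]; exact (D.K 0).inv_mem hl.lower_mem
  refine fixedBy_stable (d + 1) ⟨_, hτ⟩ (mem_fixedBy.mpr fun g n hn => ?_)
  exact hl.sec_psi_mul (k := d + 1) (Nat.le_succ d) (P_mono (by push_cast; omega) hl.mem_P_u) g hn

/-- For a nonunit n the frequency un lies in 𝔭_F^(1-d) and the section is fixed by 𝒦_d. For a unit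
n, the inverse n⁻¹ is the norm of some e, and the torus element of e scales the coordinate by n. -/
theorem sec_psi_mem {M : Subrepresentation (D.resK χ)} (hv : hl.eigenvector ∈ M.toSubmodule)
    (hM : fixedBy (D.principalSeries χ) (D.K d) ≤ M.toSubmodule) {n : F} (hn : ‖n‖ ≤ 1) :
    ∃ f ∈ M.toSubmodule, f.1 =
      sec χ ((d + 2) / 2 : ℕ) fun t => D.psi (u • D.sqrtEps * (algebraMap F E n * t)) := by
  rcases hn.lt_or_eq with hn | hn
  · have hω : u • D.sqrtEps * algebraMap F E n ∈ D.P (1 - d) := by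
      refine mul_mem_P (l := 1) hl.mem_P_u (algebraMap_mem_P.mpr ?_) (by omega)
      rw [zpow_one]
      exact D.norm_le_norm_unif n hn
    refine ⟨⟨_, hl.sec_psi_mem_V le_rfl hω⟩,
      hM (mem_fixedBy.mpr fun g x hx => hl.sec_psi_mul le_rfl hω g hx), ?_⟩
    simp only [mul_assoc]
  · obtain ⟨e, he⟩ := exists_norm_eq D (n := n⁻¹) (by rw [norm_inv, hn, inv_one])
    have hn0 : n ≠ 0 := by rw [← norm_ne_zero_iff, hn]; exact one_ne_zero
    have hne : algebraMap F E n * (e * D.conj e) = 1 := by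
      rw [he, ← map_mul, mul_inv_cancel₀ hn0, map_one]
    have he0 : e ≠ 0 := left_ne_zero_of_mul (right_ne_zero_of_mul_eq_one hne)
    have he1 : ‖e‖ = 1 := by
      have h1 := congrArg norm he
      rw [norm_mul, norm_conj, norm_algebraMap', norm_inv, hn, inv_one, ← sq] at h1
      exact (pow_eq_one_iff_of_nonneg (norm_nonneg _) two_ne_zero).mp h1
    have hK : (D.torus (Units.mk0 e he0) : D.G) ∈ D.K 0 := by
      have hmat : D.mat (D.torus (Units.mk0 e he0)) = !![(D.conj e)⁻¹, 0; 0, e] := rfl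
      rw [mem_K_zero_iff, hmat]
      simp [Fin.forall_fin_two, norm_conj, he1]
    refine ⟨(torusChar χ e)⁻¹ • D.resK χ (⟨_, hK⟩ * ⟨_, hl.lower_mem⟩) hl.eigenvector,
      M.toSubmodule.smul_mem _ (M.apply_mem_toSubmodule _ hv), ?_⟩
    funext x
    change (torusChar χ e)⁻¹ * vec χ d u
      (x * ((D.torus (Units.mk0 e he0) : D.G) * D.lower τ) * D.lower (-τ)) = _
    rw [mul_assoc, mul_assoc _ (D.lower τ), ← lower_add, add_neg_cancel, lower_zero, mul_one, vec,
      sec_torus χ _ _ (e := Units.mk0 e he0) he1 hne, Units.val_mk0,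
      inv_mul_cancel_left₀ (torusChar_ne_zero χ he0)]

/-- Averaging the frequencies nu over n ∈ 𝒪_F cuts the support down to c/e ∈ 𝔭_E^(d+1) by
orthogonality. On c/e ∈ 𝔭_E^⌈(d+1)/2⌉ only n modulo 𝔭_F^⌈d/2⌉ matters, since the two exponents add
up to d + 1. -/
theorem sec_one_mem {M : Subrepresentation (D.resK χ)} (hv : hl.eigenvector ∈ M.toSubmodule)
    (hM : fixedBy (D.principalSeries χ) (D.K d) ≤ M.toSubmodule) :
    ∃ f ∈ M.toSubmodule, f.1 = sec χ (d + 1 : ℕ) fun _ => 1 := by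
  have hd := hl.one_le
  have hex : ∀ q : D.PF 0 ⧸ (D.PF ((d + 1) / 2)).addSubgroupOf (D.PF 0), ∃ f ∈ M.toSubmodule,
      f.1 = sec χ ((d + 2) / 2 : ℕ) fun t =>
        D.psi (u • D.sqrtEps * (algebraMap F E (q.out : D.PF 0) * t)) := fun q =>
    hl.sec_psi_mem hv hM (by simpa using mem_PF.mp (q.out : D.PF 0).2)
  choose f hf hfsec using hex
  set c : ℂ := (Fintype.card (D.PF 0 ⧸ (D.PF ((d + 1) / 2)).addSubgroupOf (D.PF 0)) : ℂ) with hcdef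
  have hc : c ≠ 0 := Nat.cast_ne_zero.mpr Fintype.card_ne_zero
  refine ⟨c⁻¹ • ∑ q, f q, M.toSubmodule.smul_mem _ (M.toSubmodule.sum_mem fun q _ => hf q), ?_⟩
  funext x
  have h1 : (c⁻¹ • ∑ q, f q).1 x = c⁻¹ * ∑ q, (f q).1 x := by
    change c⁻¹ * (∑ q, f q).1 x = _
    rw [Submodule.coe_sum, Finset.sum_apply]
  rw [h1]
  simp only [hfsec]
  by_cases hx : Near ((d + 2) / 2 : ℕ) x
  · simp only [sec_of_near hx]
    rw [← Finset.mul_sum]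
    obtain ⟨s, hs⟩ := exists_smul_sqrtEps_eq (conj_row_div x)
    have hmul : ∀ n : F, u • D.sqrtEps * (algebraMap F E n * (s • D.sqrtEps)) =
        algebraMap F E (n * (s * (u * D.eps))) := fun n => by
      rw [map_mul, ← smul_mul_smul_sqrtEps]
      ring
    by_cases ht : Near (d + 1 : ℕ) x
    · rw [sec_of_near ht, Finset.sum_congr rfl (g := fun _ => 1), Finset.sum_const, nsmul_one,
        Finset.card_univ, mul_one, mul_comm _ (c : ℂ), inv_mul_cancel_left₀ hc]
      intro q _
      apply psi_eq_one
      refine mul_mem_P (l := (d + 1 : ℕ)) hl.mem_P_u (mul_mem_P_right ?_ ht.2) (by omega)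
      rw [norm_algebraMap']
      simpa using mem_PF.mp (q.out : D.PF 0).2
    · rw [sec_of_not_near ht]
      -- Outside 𝔭_E^(d+1) the product suε is not in 𝔭_F, so n ↦ ψ'(nsuε) is a nontrivial character
      -- of 𝒪_F.
      have hs' : ‖D.unif‖ ^ (1 - (0 : ℤ)) < ‖s * (u * D.eps)‖ := by
        by_contra hle
        apply ht
        refine ⟨hx.1, ?_⟩
        rw [← hs, smul_sqrtEps_mem_P]
        rw [not_lt, norm_mul, norm_mul, D.norm_eps, mul_one, hl.norm_u,
          ← le_div_iff₀ (D.norm_unif_zpow_pos _), ← zpow_sub₀ D.norm_unif_pos.ne'] at hle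
        refine hle.trans_eq ?_
        congr 1
        push_cast
        ring
      obtain ⟨n₀, hn₀, hne⟩ := exists_psi'_mul_ne_one (D := D) hs'
      rw [sum_quotient_eq_zero _ (fun n : D.PF 0 => D.psi (u • D.sqrtEps * (algebraMap F E n *
        (D.mat x 1 0 / D.mat x 1 1)))) ?_ ⟨n₀, mem_PF.mpr hn₀⟩ _ hne ?_, mul_zero, mul_zero]
      · intro n b hb
        have hb' : algebraMap F E (b : F) ∈ D.P ((d + 1) / 2 : ℕ) :=
          AddSubgroup.mem_addSubgroupOf.mp hb
        apply psi_congr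
        simp only [AddSubgroup.coe_add, map_add]
        rw [← mul_sub, ← sub_mul, add_sub_cancel_left]
        exact mul_mem_P (l := d + 1) hl.mem_P_u (mul_mem_P hb' hx.2 (by omega)) (by omega)
      · intro n
        rw [← hs]
        simp only [AddSubgroup.coe_add]
        rw [hmul, hmul, psi_algebraMap, psi_algebraMap, add_mul, AddChar.map_add_eq_mul, mul_comm]
  · have ht : ¬ Near (d + 1 : ℕ) x := fun h => hx ⟨h.1, P_mono (by omega) h.2⟩
    simp only [sec_of_not_near hx, sec_of_not_near ht, Finset.sum_const_zero, mul_zero]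

theorem fixedBy_le {M : Subrepresentation (D.resK χ)} (hv : hl.eigenvector ∈ M.toSubmodule)
    (hM : fixedBy (D.principalSeries χ) (D.K d) ≤ M.toSubmodule) :
    fixedBy (D.principalSeries χ) (D.K (d + 1)) ≤ M.toSubmodule := by
  obtain ⟨e, he, hsec⟩ := hl.sec_one_mem hv hM
  exact fun f hf => mem_of_sec_mem (by omega) M he hsec hf

theorem eigenvector_ne_zero : hl.eigenvector ≠ 0 := by
  intro h
  apply hl.fourier_vec_ne_zero
  have h1 : (fun x => vec χ d u (x * D.lower (-τ))) = 0 := congrArg Subtype.val h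
  rw [h1, map_zero]

theorem resK_eigenvector {k : D.K 0} {C : ℂ}
    (h : ∀ x, vec χ d u (x * (D.lower τ * k * D.lower (-τ))) = C * vec χ d u x) :
    D.resK χ k hl.eigenvector = C • hl.eigenvector := by
  apply Subtype.ext
  funext x
  change vec χ d u (x * k * D.lower (-τ)) = C * vec χ d u (x * D.lower (-τ))
  rw [← h, lower_neg]
  congr 1
  group

theorem resK_eigenvector_J {k : D.K 0} (hk : k ∈ D.JK d) :
    D.resK χ k hl.eigenvector = D.Psi (shalika D u z τ) k • hl.eigenvector :=
  hl.resK_eigenvector (hl.vec_J (Subgroup.mem_subgroupOf.mp hk))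

theorem sup_le_lineStabilizer :
    D.TX (shalika D u z τ) ⊔ D.JK d ≤ lineStabilizer (D.resK χ) hl.eigenvector := by
  refine sup_le (fun k hk => ?_) fun k hk => ?_
  · obtain ⟨C, hC⟩ := hl.vec_TX hk
    exact ⟨C, hl.resK_eigenvector hC⟩
  · exact ⟨Units.mk0 (D.Psi (shalika D u z τ) k) (D.psi_ne_zero _), hl.resK_eigenvector_J hk⟩

end Linearised

end UnramifiedDatum

end U11

end

open U11 UnramifiedDatum in
theorem theorem6p1 {F E : Type*} [NontriviallyNormedField F] [IsUltrametricDist F] [ProperSpace F]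
    [NormedField E] [IsUltrametricDist E] [NormedAlgebra F E] [Algebra.IsQuadraticExtension F E]
    (D : U11.UnramifiedDatum F E) (χ : D.T →* ℂˣ) (r : ℕ) (hχ : D.HasMinimalDepth χ r)
    (d : ℕ) (hd : r + 1 ≤ d) :
    ∃ Y : Matrix (Fin 2) (Fin 2) E, Y ∈ D.lieFilt (-(d : ℤ)) ∧ D.IsShalikaElement d Y ∧
      ∃ ζ : D.TX Y →* ℂˣ, D.Compatible d Y ζ ∧
        ∃ Ψ : (D.TX Y ⊔ D.JK d : Subgroup (D.K 0)) →* ℂˣ, D.IsExtension d Y ζ Ψ ∧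
          (∃ W : Subrepresentation (D.resK χ), D.IsComponent χ d W) ∧
          ∀ W : Subrepresentation (D.resK χ), D.IsComponent χ d W →
            Nonempty (W.toRepresentation.Equiv (D.Sd d Y Ψ)) := by
  obtain ⟨u, z, τ, hl⟩ := exists_linearised χ (d := d) (by omega)
    fun x hx => torusChar_one_add χ hd hχ.1 hx
  have hv0 := hl.eigenvector_ne_zero
  -- The character ζ is then taken to be the restriction of Ψ to T(Y), so its compatibility with Ψ_Y
  -- reduces to the action of 𝒥_d on the eigenvector.
  obtain ⟨Ψ, hΨ⟩ := exists_eigencharacter hv0 _ hl.sup_le_lineStabilizer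
  have hJ : ∀ j (hj : j ∈ D.JK d), (Ψ ⟨j, Subgroup.mem_sup_right hj⟩ : ℂ) =
      D.Psi (Linearised.shalika D u z τ) j := fun j hj =>
    smul_left_injective ℂ hv0 ((hΨ ⟨j, _⟩).symm.trans (hl.resK_eigenvector_J hj))
  refine ⟨Linearised.shalika D u z τ, hl.shalika_mem, hl.isShalikaElement,
    Ψ.comp (Subgroup.inclusion le_sup_left), fun t ht => hJ t ht, Ψ,
    ⟨fun t => rfl, fun j => hJ j j.2⟩, ?_⟩
  let H : Subgroup (D.K 0) := D.TX (Linearised.shalika D u z τ) ⊔ D.JK d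
  let N := (D.K (d + 1)).subgroupOf (D.K 0)
  have hNH : N ≤ H := fun n hn => Subgroup.mem_sup_right (Subgroup.mem_subgroupOf.mpr
    (K_le_J hl.one_le (K_mono (Nat.le_succ d) (Subgroup.mem_subgroupOf.mp hn))))
  have hNΨ : ∀ n (hn : n ∈ N), Ψ ⟨n, hNH hn⟩ = 1 := fun n hn => by
    have h1 : D.resK χ n hl.eigenvector = hl.eigenvector :=
      hl.eigenvector_mem_fixedBy ⟨n, Subgroup.mem_subgroupOf.mp hn⟩
    have h2 := (hΨ ⟨n, hNH hn⟩).symm.trans h1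
    rw [← one_smul ℂ hl.eigenvector, smul_smul, mul_one] at h2
    exact Units.ext (smul_left_injective ℂ hv0 h2)
  have hfin : Finite ((D.K 0) ⧸ H) := by
    have : Finite ((D.K 0) ⧸ N) := finite_quotient_K (d + 1)
    have : N.FiniteIndex := Subgroup.finiteIndex_of_finite_quotient
    have : H.FiniteIndex := Subgroup.finiteIndex_of_le hNH
    exact Subgroup.finite_quotient_of_finiteIndex
  have := Fintype.ofFinite ((D.K 0) ⧸ H)
  let L : D.V χ →ₗ[ℂ] ℂ := fourier D d u τ ∘ₗ (D.V χ).subtype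
  have hL0 : L hl.eigenvector ≠ 0 := hl.fourier_vec_ne_zero
  have hLH : ∀ k, L (D.resK χ k hl.eigenvector) ≠ 0 → k ∈ H := fun k hk =>
    hl.mem_sup_of_fourier_ne_zero hk
  have hLU : ∀ f ∈ fixedBy (D.principalSeries χ) (D.K d), L f = 0 := fun f hf =>
    hl.fourier_eq_zero (mem_fixedBy.mp hf)
  let Φ := inducedMap H Ψ (D.resK χ) hl.eigenvector
  -- By L(g Φ(f)) = f(g) L(v), this one statement gives both the injectivity of Φ and, as L kills
  -- the stable space V_χ^{𝒦_d}, the disjointness of its image from that space.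
  have hΦL : ∀ f, (∀ g, L (D.resK χ g (Φ f)) = 0) → f = 0 := fun f hf => by
    apply Subtype.ext
    funext g
    have h1 := hf g
    rw [functional_inducedMap hΨ L hLH] at h1
    exact (mul_eq_zero.mp h1).resolve_right hL0
  have hinj : Function.Injective Φ := by
    rw [← LinearMap.ker_eq_bot, LinearMap.ker_eq_bot']
    intro f hf
    exact hΦL f fun g => by rw [hf, map_zero, map_zero]
  let W₀ : Subrepresentation (D.resK χ) :=
    { toSubmodule := LinearMap.range Φ
      apply_mem_toSubmodule := by
        rintro g _ ⟨f, rfl⟩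
        exact ⟨_, inducedMap_intertwines hΨ g f⟩ }
  have hW₀ : D.IsComponent χ d W₀ := by
    constructor
    · rw [Submodule.disjoint_def]
      rintro _ hU ⟨f, rfl⟩
      rw [hΦL f fun g => hLU _ (fixedBy_stable d g hU), map_zero]
    · have hv : hl.eigenvector ∈ LinearMap.range Φ :=
        mem_range_inducedMap hΨ N (isOpen_K_subgroupOf (d + 1)) hNH hNΨ
      apply le_antisymm
      · refine sup_le (fixedBy_mono (Nat.le_succ d)) ?_
        rintro _ ⟨f, rfl⟩
        exact Submodule.sum_mem _ fun q _ =>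
          Submodule.smul_mem _ _ (fixedBy_stable (d + 1) _ hl.eigenvector_mem_fixedBy)
      -- The sum of V_χ^{𝒦_d} and the image of Φ is stable under 𝒦 and contains the eigenvector,
      -- hence it is everything.
      · exact hl.fixedBy_le (M := fixedSub χ d ⊔ W₀) (Submodule.mem_sup_right hv) le_sup_left
  refine ⟨⟨W₀, hW₀⟩, fun W hW => ?_⟩
  obtain ⟨e₁⟩ := nonempty_equiv_of_complements (fixedSub χ d) W W₀ hW.1 hW₀.1
    (hW.2.trans hW₀.2.symm)
  have e₂ : (D.Sd d (Linearised.shalika D u z τ) Ψ).Equiv W₀.toRepresentation :=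
    Representation.Equiv.mk (LinearEquiv.ofInjective Φ hinj) fun g =>
      LinearMap.ext fun f => Subtype.ext (inducedMap_intertwines hΨ g f)
  exact ⟨e₁.trans e₂.symm⟩
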